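/- **Theorem (Existence of fast solutions).** Let $H$ be a real separable Hilbert space with norm $|\cdot|$ and scalar product $\langle\cdot,\cdot\rangle$, let $\delta>0$, and let $A$ be a nonnegative self-adjoint linear operator on $H$ with dense domain $D(A)$, whose spectrum $\sigma(A)$ is a finite or countable set of eigenvalues without finite accumulation points. Let $D(A^{1/2})$ carry the norm $|u|_{D(A^{1/2})}=(|u|^2+|A^{1/2}u|^2)^{1/2}$, and let $$\mathcal D:=\{\operatorname{Re} z:\ z\in\mathbb C,\ z^2-2\delta z+\lambda=0\text{ for some }\lambda\in\sigma(A)\}.$$ *Solutions.* Given $g\in C^0([0,\infty),H)$, a solution of $u''+2\delta u'+Au=g$ is a function $u\in C^0([0,\infty),D(A^{1/2}))\cap C^1([0,\infty),H)$ such that, for every $\varphi\in D(A^{1/2})$ and every $t\ge 0$, the derivative of $\langle u',\varphi\rangle$ exists at $t$ (one-sided at $t=0$) and equals $\langle g,\varphi\rangle-2\delta\langle u',\varphi\rangle-\langle A^{1/2}u,A^{1/2}\varphi\rangle$. If $f$ is defined on $B_{R_0}:=\{u\in D(A^{1/2}):|u|_{D(A^{1/2})}<R_0\}$, a global solution of $$u''(t)+2\delta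 u'(t)+Au(t)=f(u(t)),\qquad t\ge 0, \tag{1}$$ is a solution of the equation above for some $g\in C^0([0,\infty),H)$, such that $u(t)\in B_{R_0}$ and $g(t)=f(u(t))$ for every $t\ge0$. *Pure, fast and slow pairs.* In $\mathcal H:=D(A^{1/2})\times H$ consider the operator $\mathcal A(x,y):=(-y,\,Ax+2\delta y)$. For $r\in\mathcal D$ with $r\ne\delta$ let $\mathcal H_r$ be the eigenspace of $\mathcal A$ relative to the eigenvalue $r$; if $\delta\in\mathcal D$, let $\mathcal H_\delta$ be the closed span in $\mathcal H$ of all pairs $(e,0)$ and $(0,e)$, where $e$ is an eigenvector of $A$ with eigenvalue $\lambda\ge\delta^2$. Let $r_0\in\mathcal D$. A pair in $\mathcal H$ is called $r_0$-pure (respectively $r_0$-fast, $r_0$-slow) if the solution $u$ of $u''+2\delta u'+Au=0$ with this pair as initial data $(u(0),u'(0))$ satisfies, for every $t\ge 0$, $(u(t),u'(t))\in\mathcal H_{r_0}$ (respectively $\bigoplus_{r\in\mathcal D,\,r>r_0}\mathcal H_r$, $\bigoplus_{r\in\mathcal D,\,r\le r_0}\mathcal H_r$). *Statement.* Let $R_0>0$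 and let $f:B_{R_0}\to H$ satisfy $f(0)=0$ and, for some constants $p>0$ and $L\ge0$, $$|f(u)-f(v)|\le L\left(|u|^p_{D(A^{1/2})}+|v|^p_{D(A^{1/2})}\right)|u-v|_{D(A^{1/2})}\qquad\forall u,v\in B_{R_0}.$$ Then for every $r_0\in\mathcal D$ with $r_0>0$ there exists $\varepsilon_0>0$ with the following property. For every $r_0$-pure pair $(v_0,v_1)\in D(A^{1/2})\times H$ and every $r_0$-fast pair $(z_0,z_1)\in D(A^{1/2})\times H$ such that $$|v_1|+|v_0|_{D(A^{1/2})}+|z_1|+|z_0|_{D(A^{1/2})}\le\varepsilon_0,$$ there exists an $r_0$-slow pair $(w_0,w_1)\in D(A^{1/2})\times H$ such that (1) has a global solution $u$ with initial data $u(0)=v_0+z_0+w_0$, $u'(0)=v_1+z_1+w_1$, satisfying $$\lim_{t\to+\infty}\left(|u'(t)-v'(t)|+|u(t)-v(t)|_{D(A^{1/2})}\right)e^{r_0t}=0,$$ where $v$ is the solution of $v''+2\delta v'+Av=0$ with initial data $v(0)=v_0$, $v'(0)=v_1$. -/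

import Mathlib

open scoped InnerProductSpace Topology

noncomputable section

namespace DampedWave

variable {H : Type*} [NormedAddCommGroup H] [InnerProductSpace ℝ H]

/-- The resolvent set of a partially defined operator `A`: the `μ` for which `A - μ` is a bijection
of the domain of `A` onto `H` with bounded inverse `R`. -/
def resolventSet (A : H →ₗ.[ℝ] H) : Set ℝ :=
  {μ | ∃ R : H →L[ℝ] H,
    (∀ y : H, ∃ h : R y ∈ A.domain, A ⟨R y, h⟩ - μ • R y = y) ∧
    ∀ x : A.domain, R (A x - μ • (x : H)) = x}

/-- The spectrum `σ(A)`. -/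
def opSpectrum (A : H →ₗ.[ℝ] H) : Set ℝ := (resolventSet A)ᶜ

/-- The kernel of `A - μ`. -/
def eigenspace (A : H →ₗ.[ℝ] H) (μ : ℝ) : Submodule ℝ H where
  carrier := {x | ∃ h : x ∈ A.domain, A ⟨x, h⟩ = μ • x}
  zero_mem' := ⟨A.domain.zero_mem, by
    rw [smul_zero]
    exact A.map_zero⟩
  add_mem' := by
    rintro x y ⟨hx, ex⟩ ⟨hy, ey⟩
    refine ⟨A.domain.add_mem hx hy, ?_⟩
    rw [smul_add, ← ex, ← ey]
    exact A.map_add ⟨x, hx⟩ ⟨y, hy⟩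
  smul_mem' := by
    rintro c x ⟨hx, ex⟩
    refine ⟨A.domain.smul_mem c hx, ?_⟩
    rw [smul_comm, ← ex]
    exact A.map_smul c ⟨x, hx⟩

/-- The spectrum of `A` is a finite or countable set of eigenvalues without finite accumulation
points. -/
structure HasDiscreteSpectrum (A : H →ₗ.[ℝ] H) : Prop where
  countable : (opSpectrum A).Countable
  eigenvalue : ∀ μ ∈ opSpectrum A, ∃ x ∈ eigenspace A μ, x ≠ 0
  no_accPt : ∀ x : ℝ, ¬ AccPt x (Filter.principal (opSpectrum A))

variable [CompleteSpace H]

/-- The orthogonal projection onto the kernel of `A - μ`. (The kernel is closed when `A` is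
self-adjoint, so taking the closure changes nothing then.) -/
def eigenProj (A : H →ₗ.[ℝ] H) (μ : ℝ) : H →L[ℝ] H :=
  (eigenspace A μ).topologicalClosure.starProjection

/-- The square root `A^{1/2}` of a nonnegative self-adjoint operator whose spectrum is a discrete
set of eigenvalues, by the spectral calculus: `A^{1/2} x = ∑ √μ P_μ x`, the sum being over
`μ ∈ σ(A)`, with domain the set of all `x` for which this (orthogonal) series converges, that is
`∑ μ |P_μ x|² < ∞`. -/
def sqrtOp (A : H →ₗ.[ℝ] H) : H →ₗ.[ℝ] H where
  domain :=
    { carrier := {x | Summable fun μ : opSpectrum A => √(μ : ℝ) • eigenProj A μ x}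
      zero_mem' := by simp
      add_mem' := by
        intro x y hx hy
        simpa [smul_add] using Summable.add hx hy
      smul_mem' := by
        intro c x hx
        simpa [smul_comm c] using Summable.const_smul c hx }
  toFun :=
    { toFun := fun x => ∑' μ : opSpectrum A, √(μ : ℝ) • eigenProj A μ (x : H)
      map_add' := by
        intro x y
        simpa [smul_add] using Summable.tsum_add x.2 y.2
      map_smul' := by
        intro c x
        simpa [smul_comm c] using Summable.tsum_const_smul c x.2 }

/-- The space `D(A^{1/2})`, realized as the graph of `A^{1/2}` in `H × H` with the Hilbert norm, so
that its norm is `(|x|² + |A^{1/2} x|²)^{1/2}`. -/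
abbrev EnergySpace (A : H →ₗ.[ℝ] H) : Submodule ℝ (WithLp 2 (H × H)) :=
  (sqrtOp A).graph.map (WithLp.linearEquiv 2 ℝ (H × H)).symm.toLinearMap

/-- The inclusion of `D(A^{1/2})` in `H`. -/
def incl {A : H →ₗ.[ℝ] H} (x : EnergySpace A) : H := (x : WithLp 2 (H × H)).fst

/-- The map `A^{1/2}` from `D(A^{1/2})` to `H`. -/
def sqrtMap {A : H →ₗ.[ℝ] H} (x : EnergySpace A) : H := (x : WithLp 2 (H × H)).snd

theorem incl_mem_domain {A : H →ₗ.[ℝ] H} (x : EnergySpace A) :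
    incl x ∈ (sqrtOp A).domain := by
  obtain ⟨_, ⟨y, hy, rfl⟩⟩ := x
  exact LinearPMap.mem_domain_of_mem_graph hy

theorem sqrtMap_eq {A : H →ₗ.[ℝ] H} (x : EnergySpace A) :
    sqrtMap x = sqrtOp A ⟨incl x, incl_mem_domain x⟩ := by
  obtain ⟨_, ⟨y, hy, rfl⟩⟩ := x
  exact LinearPMap.image_iff (LinearPMap.mem_domain_of_mem_graph hy) |>.2 hy

theorem norm_sq_eq {A : H →ₗ.[ℝ] H} (x : EnergySpace A) :
    ‖x‖ ^ 2 = ‖incl x‖ ^ 2 + ‖sqrtMap x‖ ^ 2 :=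
  WithLp.prod_norm_sq_eq_of_L2 (x : WithLp 2 (H × H))

/-- The time derivative `u'(t)` in `H`, for `t ∈ [0, ∞)` (one-sided at `t = 0`). -/
def velocity {A : H →ₗ.[ℝ] H} (u : ℝ → EnergySpace A) (t : ℝ) : H :=
  derivWithin (fun s => incl (u s)) (Set.Ici 0) t

/-- `u ∈ C⁰([0,∞), D(A^{1/2})) ∩ C¹([0,∞), H)` is a weak solution of
`u'' + 2δ u' + A u = g` in `[0, ∞)`: for every `φ ∈ D(A^{1/2})` one has
`d/dt ⟨u', φ⟩ + 2δ ⟨u', φ⟩ + ⟨A^{1/2} u, A^{1/2} φ⟩ = ⟨g, φ⟩` in `[0, ∞)`. -/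
structure IsLinearSolution (A : H →ₗ.[ℝ] H) (δ : ℝ) (g : ℝ → H) (u : ℝ → EnergySpace A) :
    Prop where
  continuousOn : ContinuousOn u (Set.Ici 0)
  contDiffOn : ContDiffOn ℝ 1 (fun t => incl (u t)) (Set.Ici 0)
  weak : ∀ φ : EnergySpace A, ∀ t : ℝ, 0 ≤ t →
    HasDerivWithinAt (fun s => ⟪velocity u s, incl φ⟫_ℝ)
      (⟪g t, incl φ⟫_ℝ - 2 * δ * ⟪velocity u t, incl φ⟫_ℝ - ⟪sqrtMap (u t), sqrtMap φ⟫_ℝ)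
      (Set.Ici 0) t

/-- `u` is a global solution of `u'' + 2δ u' + A u = f(u)`, where `f` is defined on the open ball of
radius `R` of `D(A^{1/2})` (its values outside the ball are irrelevant). -/
def IsSemilinearSolution (A : H →ₗ.[ℝ] H) (δ R : ℝ) (f : EnergySpace A → H)
    (u : ℝ → EnergySpace A) : Prop :=
  ∃ g : ℝ → H, ContinuousOn g (Set.Ici 0) ∧ IsLinearSolution A δ g u ∧
    ∀ t : ℝ, 0 ≤ t → u t ∈ Metric.ball (0 : EnergySpace A) R ∧ g t = f (u t)

/-- `u(0) = U.1` and `u'(0) = U.2`. -/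
def HasInitialData {A : H →ₗ.[ℝ] H} (u : ℝ → EnergySpace A) (U : EnergySpace A × H) : Prop :=
  u 0 = U.1 ∧ velocity u 0 = U.2

/-- The set `𝒟` of the real parts of the complex roots of `z² - 2δz + μ`, where `μ ∈ σ(A)`. -/
def decayRates (A : H →ₗ.[ℝ] H) (δ : ℝ) : Set ℝ :=
  {r | ∃ μ ∈ opSpectrum A, ∃ z : ℂ, z ^ 2 - 2 * (δ : ℂ) * z + (μ : ℂ) = 0 ∧ z.re = r}

/-- For real `r`, the kernel of `𝒜 - r`, where `𝒜 (x, y) = (-y, A x + 2δ y)` is the operator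
in `D(A^{1/2}) × H` for which `u'' + 2δ u' + A u = 0` reads `U' + 𝒜 U = 0`,
with `U = (u, u')`. -/
def systemEigenspace (A : H →ₗ.[ℝ] H) (δ r : ℝ) : Submodule ℝ (EnergySpace A × H) where
  carrier := {U | -U.2 = r • incl U.1 ∧
    ∃ h : incl U.1 ∈ A.domain, A ⟨incl U.1, h⟩ + (2 * δ) • U.2 = r • U.2}
  zero_mem' := by
    refine ⟨?_, A.domain.zero_mem, ?_⟩
    · change -(0 : H) = r • (0 : H)
      simp
    · change A 0 + (2 * δ) • (0 : H) = r • (0 : H)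
      simp
  add_mem' := by
    rintro U V ⟨h1, hU, h2⟩ ⟨k1, hV, k2⟩
    refine ⟨?_, A.domain.add_mem hU hV, ?_⟩
    · change -(U.2 + V.2) = r • (incl U.1 + incl V.1)
      rw [smul_add, ← h1, ← k1, neg_add]
    · change A (⟨incl U.1, hU⟩ + ⟨incl V.1, hV⟩) + (2 * δ) • (U.2 + V.2) = r • (U.2 + V.2)
      rw [A.map_add, smul_add, smul_add, ← h2, ← k2]
      abel
  smul_mem' := by
    rintro c U ⟨h1, hU, h2⟩
    refine ⟨?_, A.domain.smul_mem c hU, ?_⟩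
    · change -(c • U.2) = r • (c • incl U.1)
      rw [smul_comm, ← h1, smul_neg]
    · change A (c • ⟨incl U.1, hU⟩) + (2 * δ) • (c • U.2) = r • (c • U.2)
      rw [A.map_smul, smul_comm r, ← h2, smul_add, smul_comm c]

/-- The component `ℋ_r` of `ℋ = D(A^{1/2}) × H`, which collects the simple modes with exponential
factor `e^{-rt}`: for `r ≠ δ` the eigenspace of `𝒜` for the eigenvalue `r`; for `r = δ` the closed
span of the pairs formed with eigenvectors of `A` whose eigenvalue is at least `δ²`. -/
def modeSpace (A : H →ₗ.[ℝ] H) (δ r : ℝ) : Submodule ℝ (EnergySpace A × H) :=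
  open Classical in
  if r = δ then
    (Submodule.span ℝ {U : EnergySpace A × H | ∃ μ ∈ opSpectrum A, δ ^ 2 ≤ μ ∧
      incl U.1 ∈ eigenspace A μ ∧ U.2 ∈ eigenspace A μ}).topologicalClosure
  else systemEigenspace A δ r

/-- The (finite) sum of the components `ℋ_r` with `r ∈ 𝒟 ∩ S`. -/
def modeSum (A : H →ₗ.[ℝ] H) (δ : ℝ) (S : Set ℝ) : Submodule ℝ (EnergySpace A × H) :=
  ⨆ r ∈ decayRates A δ ∩ S, modeSpace A δ r

/-- The solution of `u'' + 2δ u' + A u = 0` with initial data `U` only has components with exponents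
in `S`. -/
def HasRatesIn (A : H →ₗ.[ℝ] H) (δ : ℝ) (S : Set ℝ) (U : EnergySpace A × H) : Prop :=
  ∃ u : ℝ → EnergySpace A, IsLinearSolution A δ 0 u ∧ HasInitialData u U ∧
    ∀ t : ℝ, 0 ≤ t → (u t, velocity u t) ∈ modeSum A δ S

/-- `r₀`-pure pairs. -/
def IsPurePair (A : H →ₗ.[ℝ] H) (δ r₀ : ℝ) (U : EnergySpace A × H) : Prop :=
  HasRatesIn A δ {r₀} U

/-- `r₀`-fast pairs. -/
def IsFastPair (A : H →ₗ.[ℝ] H) (δ r₀ : ℝ) (U : EnergySpace A × H) : Prop :=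
  HasRatesIn A δ (Set.Ioi r₀) U

/-- `r₀`-slow pairs. -/
def IsSlowPair (A : H →ₗ.[ℝ] H) (δ r₀ : ℝ) (U : EnergySpace A × H) : Prop :=
  HasRatesIn A δ (Set.Iic r₀) U

end DampedWave

end

/-!
The theorem is proved by a Lyapunov–Perron argument. The solution is sought as `u = v + z + w`,
where `v` and `z` solve the linear equation with the pure and the fast data, and `w` solves it with
the force `f(u)`. Among all such `w` there is one that decays faster than `e^{-r₀t}`: in each mode
the components with rate beyond `r₀` are integrated from time `0`, starting with zero data, and
those with rate at most `r₀` are integrated backward from `+∞`. So the initial data of `w` are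
slow.

*Diagonalization.* The hypothesis on the spectrum has to be turned into a Hilbert basis of
eigenvectors (`exists_eigenBasis`), without using a spectral theorem for unbounded operators. A
bounded symmetric operator has plus or minus its norm in the approximate point spectrum, so that
the resolvent of `A` is bounded by the inverse distance to the approximate point spectrum of `A`,
also on invariant subspaces (`IsResolventAt.norm_le_of_boundedBelow`). At an isolated point `c` of
the spectrum `A - c` is bounded below on the complement of its kernel (`mul_norm_le_of_isolated`).
Therefore the restriction of `A` to the orthogonal complement of all eigenspaces has no spectrum,
and this complement is zero (`iSup_eigenspace_orthogonal`).

*Modes.* In coordinates the linear equation splits into systems of two ordinary differential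
equations, with the explicit flows `flow δ S μ`; here `S` selects the rates that are kept. The sum
of the mode spaces with rates in `S` consists of the pairs whose coordinates are fixed by the
projections `flow δ S μ 0` (`EigenBasis.modeSum_eq`). With the weights of the energy norm, the
flows are bounded by `e^{-κt}` uniformly in the mode, forward in time if the selected rates exceed
`κ`, and backward in time if they are below `κ` (`exists_abs_wflow_le`): the eigenvalues `μ ≥ δ²`
share the rate `δ` and admit a common bound, and only finitely many others remain.

*Forced equation.* Since only finitely many rates occur, there are `κ > r₀` and a margin `η > 0`
such that no rate lies between `r₀` and `κ + η` (`EigenBasis.exists_rate_gap`). The Green function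
obtained by propagating the fast rates forward and the others backward is bounded by
`e^{-κτ - η|τ|}`. Hence it maps forces of size `e^{-κt}` to solutions of size `e^{-κt}` with slow initial
data (`EigenBasis.exists_forcedSolution`).

*Contraction.* If `κ` is also less than `(1 + p) r₀`, then `r = κ / (1 + p)` is less than `r₀`. So
`v` and `z` decay as `e^{-rt}`, and a function `u` with this decay yields a force `f(u)` of size
`e^{-(1+p)rt} = e^{-κt}`. On a small ball of the space of functions with weight `e^{rt}` the
equation for `u` is a contraction (`exists_decaying_fixedPoint`). For the fixed point, the difference
`u - v = z + w` is of size `e^{-κt}`, which is `o(e^{-r₀t})`.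
-/

noncomputable section

namespace DampedWave

/-! ### Completeness of the eigenvectors -/

/-- A symmetric bounded operator `R` on a nonzero space has `‖R‖` or `-‖R‖` in its approximate point
spectrum: `R - ‖R‖` and `R + ‖R‖` cannot both be bounded below. -/
theorem eq_zero_of_symmetric_of_boundedBelow {E : Type*} [NormedAddCommGroup E]
    [InnerProductSpace ℝ E] (R : E →L[ℝ] E) (hR : ∀ x y, ⟪R x, y⟫_ℝ = ⟪x, R y⟫_ℝ) {ρ σ : ℝ}
    (hρ : 0 < ρ) (hσ : 0 < σ) (h1 : ∀ x, ρ * ‖x‖ ≤ ‖R x - ‖R‖ • x‖)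
    (h2 : ∀ x, σ * ‖x‖ ≤ ‖R x + ‖R‖ • x‖) (x : E) : x = 0 := by
  set N := ‖R‖ with hN
  have hN0 : 0 ≤ N := norm_nonneg _
  by_contra hx
  have key : ∀ y, N ^ 2 * ‖R y‖ ^ 2 ≤ (N ^ 4 - (ρ * σ) ^ 2) * ‖y‖ ^ 2 := by
    intro y
    have e1 : ρ * σ * ‖y‖ ≤ ‖R (R y) - N ^ 2 • y‖ := by
      have := h1 (R y + N • y)
      have e : R (R y + N • y) - N • (R y + N • y) = R (R y) - N ^ 2 • y := by
        rw [map_add, map_smul, smul_add, smul_smul, pow_two]; abel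
      rw [e] at this
      calc ρ * σ * ‖y‖ = ρ * (σ * ‖y‖) := by ring
        _ ≤ ρ * ‖R y + N • y‖ := by gcongr; exact h2 y
        _ ≤ _ := this
    have e2 : ‖R (R y) - N ^ 2 • y‖ ^ 2
        = ‖R (R y)‖ ^ 2 - 2 * N ^ 2 * ‖R y‖ ^ 2 + N ^ 4 * ‖y‖ ^ 2 := by
      rw [norm_sub_sq_real, inner_smul_right, hR, real_inner_self_eq_norm_sq, norm_smul,
        Real.norm_of_nonneg (by positivity)]
      ring
    have e3 : ‖R (R y)‖ ≤ N * ‖R y‖ := R.le_opNorm _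
    have e4 : ‖R (R y)‖ ^ 2 ≤ N ^ 2 * ‖R y‖ ^ 2 := by
      rw [← mul_pow]; gcongr
    have e5 : (ρ * σ * ‖y‖) ^ 2 ≤ ‖R (R y) - N ^ 2 • y‖ ^ 2 := by gcongr
    nlinarith
  have hx' : 0 < ‖x‖ ^ 2 := by positivity
  have hc : 0 < (ρ * σ) ^ 2 := by positivity
  have hN4 : 0 ≤ N ^ 4 - (ρ * σ) ^ 2 := by
    by_contra hneg
    have := key x
    have h0 : 0 ≤ N ^ 2 * ‖R x‖ ^ 2 := by positivity
    nlinarith [mul_pos_of_neg_of_neg (not_le.1 hneg) (neg_lt_zero.2 hx')]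
  have hNpos : 0 < N := by
    rcases hN0.eq_or_lt with h | h
    · rw [← h] at hN4; nlinarith
    · exact h
  have hle : N ≤ Real.sqrt ((N ^ 4 - (ρ * σ) ^ 2) / N ^ 2) := by
    rw [hN]
    refine R.opNorm_le_bound (Real.sqrt_nonneg _) fun y => ?_
    refine le_of_sq_le_sq ?_ (by positivity)
    rw [mul_pow, Real.sq_sqrt (by positivity), div_mul_eq_mul_div, le_div_iff₀ (by positivity)]
    linarith [key y]
  have := Real.le_sqrt' hNpos |>.1 hle
  rw [le_div_iff₀ (by positivity)] at this
  nlinarith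

variable {H : Type*} [NormedAddCommGroup H] [InnerProductSpace ℝ H]

/-- `R` is the (everywhere defined, bounded) inverse of `A - c`. -/
def IsResolventAt (A : H →ₗ.[ℝ] H) (c : ℝ) (R : H →L[ℝ] H) : Prop :=
  (∀ y : H, ∃ h : R y ∈ A.domain, A ⟨R y, h⟩ - c • R y = y) ∧
    ∀ x : A.domain, R (A x - c • (x : H)) = x

theorem IsResolventAt.symmetric {A : H →ₗ.[ℝ] H} {c : ℝ} {R : H →L[ℝ] H}
    (h : IsResolventAt A c R) (hsym : ∀ x y : A.domain, ⟪A x, (y : H)⟫_ℝ = ⟪(x : H), A y⟫_ℝ)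
    (x y : H) : ⟪R x, y⟫_ℝ = ⟪x, R y⟫_ℝ := by
  obtain ⟨hx, ex⟩ := h.1 x
  obtain ⟨hy, ey⟩ := h.1 y
  have := hsym ⟨R x, hx⟩ ⟨R y, hy⟩
  simp only at this
  conv_lhs => rw [← ey]
  conv_rhs => rw [← ex]
  rw [inner_sub_right, inner_sub_left, this, inner_smul_left, inner_smul_right]
  simp

/-- The resolvent is bounded by the inverse distance to the approximate point spectrum, on every
invariant subspace `W`. -/
theorem IsResolventAt.norm_le_of_boundedBelow {A : H →ₗ.[ℝ] H} {c : ℝ} {R : H →L[ℝ] H}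
    (h : IsResolventAt A c R) (hsym : ∀ x y : A.domain, ⟪A x, (y : H)⟫_ℝ = ⟪(x : H), A y⟫_ℝ)
    (W : Submodule ℝ H) (hW : ∀ x ∈ W, R x ∈ W) {a : ℝ} (ha : 0 < a)
    (hbd : ∀ c', |c' - c| < a →
      ∃ ρ > 0, ∀ x : A.domain, (x : H) ∈ W → ρ * ‖(x : H)‖ ≤ ‖A x - c' • (x : H)‖)
    {w : H} (hw : w ∈ W) : ‖R w‖ ≤ a⁻¹ * ‖w‖ := by
  let R' : W →L[ℝ] W := (R.comp W.subtypeL).codRestrict W fun x => hW x x.2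
  have hR' : ∀ x : W, ((R' x : W) : H) = R x := fun x => rfl
  set N := ‖R'‖ with hN
  rcases le_or_gt N a⁻¹ with hle | hgt
  · have := R'.le_of_opNorm_le hle ⟨w, hw⟩
    exact this
  exfalso
  have hNpos : 0 < N := lt_trans (by positivity) hgt
  -- boundedness below of `A - (c + 1/τ)` passes to `R - τ`, where `τ = ±N`
  have transfer : ∀ τ : ℝ, |τ| = N → ∃ ρ > 0, ∀ x : W, ρ * ‖x‖ ≤ ‖R' x - τ • x‖ := by
    intro τ hτ
    have hτ0 : τ ≠ 0 := by rintro rfl; simp at hτ; linarith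
    obtain ⟨ρ, hρ, hb⟩ := hbd (c + τ⁻¹) (by
      rw [add_sub_cancel_left, abs_inv, hτ]; exact inv_lt_of_inv_lt₀ ha hgt)
    refine ⟨N / (1 + (N * ρ)⁻¹), by positivity, fun x => ?_⟩
    obtain ⟨hd, he⟩ := h.1 (x : H)
    have hb' := hb ⟨R x, hd⟩ (hW _ x.2)
    simp only at hb'
    have e1 : R x - τ • (x : H) = (-τ) • (A ⟨R x, hd⟩ - (c + τ⁻¹) • R x) := by
      have : (τ * (c + τ⁻¹)) • R (x : H) = (τ * c) • R (x : H) + R (x : H) := by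
        rw [mul_add, mul_inv_cancel₀ hτ0, add_smul, one_smul]
      conv_lhs => rw [← he]
      rw [smul_sub, smul_sub, neg_smul, neg_smul, smul_smul, smul_smul, this, he]
      abel
    have e2 : ‖R x - τ • (x : H)‖ = N * ‖A ⟨R x, hd⟩ - (c + τ⁻¹) • R x‖ := by
      rw [e1, norm_smul, norm_neg, Real.norm_eq_abs, hτ]
    have e3 : N * ρ * ‖R x‖ ≤ ‖R x - τ • (x : H)‖ := by
      rw [e2, mul_assoc]; gcongr
    have e4 : N * ‖(x : H)‖ ≤ ‖R x - τ • (x : H)‖ + ‖R x‖ := by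
      have : τ • (x : H) = R x - (R x - τ • (x : H)) := by abel
      have h5 : ‖τ • (x : H)‖ = N * ‖(x : H)‖ := by rw [norm_smul, Real.norm_eq_abs, hτ]
      rw [← h5]
      conv_lhs => rw [this]
      rw [add_comm]
      exact norm_sub_le _ _
    have e6 : ‖R (x : H)‖ ≤ (N * ρ)⁻¹ * ‖R x - τ • (x : H)‖ := by
      rw [inv_mul_eq_div, le_div_iff₀ (by positivity)]; linarith
    have e7 : ‖R' x - τ • x‖ = ‖R x - τ • (x : H)‖ := rfl
    rw [e7, div_mul_eq_mul_div, div_le_iff₀ (by positivity)]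
    calc N * ‖x‖ ≤ ‖R x - τ • (x : H)‖ + ‖R x‖ := e4
      _ ≤ _ := by linarith
  obtain ⟨ρ, hρ, h1⟩ := transfer N (abs_of_pos hNpos)
  obtain ⟨σ, hσ, h2⟩ := transfer (-N) (by rw [abs_neg, abs_of_pos hNpos])
  have hz := eq_zero_of_symmetric_of_boundedBelow R'
    (fun x y => h.symmetric hsym (x : H) (y : H)) hρ hσ h1
    (fun x => by simpa [neg_smul, sub_neg_eq_add] using h2 x)
  exact hNpos.not_ge (R'.opNorm_le_bound le_rfl fun x => by rw [hz x]; simp)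

theorem IsResolventAt.boundedBelow {A : H →ₗ.[ℝ] H} {c : ℝ} {R : H →L[ℝ] H}
    (h : IsResolventAt A c R) :
    ∃ ρ > 0, ∀ x : A.domain, ρ * ‖(x : H)‖ ≤ ‖A x - c • (x : H)‖ := by
  refine ⟨(‖R‖ + 1)⁻¹, by positivity, fun x => ?_⟩
  rw [inv_mul_le_iff₀ (by positivity)]
  have := R.le_opNorm (A x - c • (x : H))
  rw [h.2 x] at this
  nlinarith [norm_nonneg (A x - c • (x : H))]

/-- If `(c - a, c + a)` lies in the resolvent set, then `A - c` is bounded below by `a`. -/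
theorem mul_norm_le_of_subset_resolventSet {A : H →ₗ.[ℝ] H}
    (hsym : ∀ x y : A.domain, ⟪A x, (y : H)⟫_ℝ = ⟪(x : H), A y⟫_ℝ) {c a : ℝ} (ha : 0 < a)
    (hres : ∀ c', |c' - c| < a → c' ∈ resolventSet A) (x : A.domain) :
    a * ‖(x : H)‖ ≤ ‖A x - c • (x : H)‖ := by
  obtain ⟨R, hR⟩ := hres c (by simpa using ha)
  have hR : IsResolventAt A c R := hR
  have := hR.norm_le_of_boundedBelow hsym ⊤ (fun _ _ => Submodule.mem_top) ha
    (fun c' hc' => by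
      obtain ⟨R', hR'⟩ := hres c' hc'
      obtain ⟨ρ, hρ, hb⟩ := IsResolventAt.boundedBelow (R := R') hR'
      exact ⟨ρ, hρ, fun x _ => hb x⟩) (w := A x - c • (x : H)) Submodule.mem_top
  rw [hR.2 x, le_inv_mul_iff₀ ha] at this
  exact this

/-- Near an isolated point `c` of the spectrum, `(A - c)² ± η (A - c) ≥ 0`. -/
theorem mul_abs_inner_le_of_isolated {A : H →ₗ.[ℝ] H}
    (hsym : ∀ x y : A.domain, ⟪A x, (y : H)⟫_ℝ = ⟪(x : H), A y⟫_ℝ) {c η : ℝ} (hη : 0 < η)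
    (hres : ∀ c', c' ≠ c → |c' - c| < 2 * η → c' ∈ resolventSet A) (x : A.domain) :
    η * |⟪A x - c • (x : H), x⟫_ℝ| ≤ ‖A x - c • (x : H)‖ ^ 2 := by
  have key : ∀ h : ℝ, |h| = η / 2 →
      0 ≤ ‖A x - c • (x : H)‖ ^ 2 - 2 * h * ⟪A x - c • (x : H), x⟫_ℝ := by
    intro h hh
    have hb := mul_norm_le_of_subset_resolventSet hsym (c := c + h) (a := η / 2) (by positivity)
      (fun c' hc' => hres c' (by
          rintro rfl
          rw [sub_add_cancel_left, abs_neg, hh] at hc'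
          exact lt_irrefl _ hc')
        (by
          have : c' - c = (c' - (c + h)) + h := by ring
          rw [this]
          refine (abs_add_le _ _).trans_lt ?_
          linarith)) x
    have e : A x - (c + h) • (x : H) = (A x - c • (x : H)) - h • (x : H) := by
      rw [add_smul]; abel
    rw [e] at hb
    have h2 : (η / 2 * ‖(x : H)‖) ^ 2 ≤ ‖(A x - c • (x : H)) - h • (x : H)‖ ^ 2 := by
      gcongr
    rw [norm_sub_sq_real, inner_smul_right, norm_smul, Real.norm_eq_abs, hh] at h2
    linarith
  have h1 := key (η / 2) (abs_of_pos (by positivity))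
  have h2 := key (-(η / 2)) (by rw [abs_neg, abs_of_pos (by positivity)])
  rcases abs_cases ⟪A x - c • (x : H), x⟫_ℝ with ⟨h, _⟩ | ⟨h, _⟩ <;> rw [h] <;> linarith

variable [CompleteSpace H]

/-- At an isolated point `c` of the spectrum, `A - c` is bounded below on the orthogonal complement
of its kernel. The two nonnegative operators `P = b² - η b K` and `Q = b² + η b K`, with `K` the
resolvent at a nearby point and `b = (A - c) K`, commute; so `P Q P + Q P Q = 2 b² (b⁴ - η² b² K²)`
is nonnegative. -/
theorem mul_norm_le_of_isolated {A : H →ₗ.[ℝ] H}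
    (hsym : ∀ x y : A.domain, ⟪A x, (y : H)⟫_ℝ = ⟪(x : H), A y⟫_ℝ) {c η : ℝ} (hη : 0 < η)
    (hres : ∀ c', c' ≠ c → |c' - c| < 2 * η → c' ∈ resolventSet A)
    (W : Submodule ℝ H) (hAW : ∀ x : A.domain, (x : H) ∈ W → A x ∈ W)
    (hW : ∀ e ∈ eigenspace A c, ∀ w ∈ W, ⟪e, w⟫_ℝ = 0) (x : A.domain) (hx : (x : H) ∈ W) :
    η * ‖(x : H)‖ ≤ ‖A x - c • (x : H)‖ := by
  obtain ⟨K, hK⟩ := hres (c + η) (by linarith) (by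
    rw [add_sub_cancel_left, abs_of_pos hη]; linarith)
  have hK : IsResolventAt A (c + η) K := hK
  have hKs := hK.symmetric hsym
  let b : H →L[ℝ] H := ContinuousLinearMap.id ℝ H + η • K
  have hb : ∀ z, ∃ h : K z ∈ A.domain, A ⟨K z, h⟩ - c • K z = b z := by
    intro z
    obtain ⟨h, e⟩ := hK.1 z
    refine ⟨h, ?_⟩
    have : b z = z + η • K z := rfl
    rw [this, ← sub_eq_iff_eq_add, sub_sub, ← add_smul, e]
  have hbs : ∀ y z, ⟪b y, z⟫_ℝ = ⟪y, b z⟫_ℝ := by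
    intro y z
    have e : ∀ y, b y = y + η • K y := fun _ => rfl
    rw [e, e, inner_add_left, inner_add_right, inner_smul_left, inner_smul_right, hKs]; simp
  have hcomm : ∀ z, K (b z) = b (K z) := by
    intro z
    have e : ∀ y, b y = y + η • K y := fun _ => rfl
    rw [e, e, map_add, map_smul]
  have hpos : ∀ z, η * |⟪b z, K z⟫_ℝ| ≤ ‖b z‖ ^ 2 := by
    intro z
    obtain ⟨h, e⟩ := hb z
    have := mul_abs_inner_le_of_isolated hsym hη hres ⟨K z, h⟩
    simp only [e] at this
    exact this
  have hrange : ∀ z, η * ‖K (b (b z))‖ ≤ ‖b (b (b z))‖ := by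
    intro z
    refine le_of_sq_le_sq ?_ (norm_nonneg _)
    have hq := hpos (b (b z) + η • K (b z))
    have hp := hpos (b (b z) - η • K (b z))
    have hq' := le_trans (mul_le_mul_of_nonneg_left (le_abs_self _) hη.le) hq
    have hp' := le_trans (mul_le_mul_of_nonneg_left (neg_le_abs _) hη.le) hp
    simp only [map_add, map_sub, map_smul, hcomm] at hq' hp' ⊢
    have hαγ : ⟪b (b (b z)), b (K (K z))⟫_ℝ = ‖b (b (K z))‖ ^ 2 := by
      rw [hbs, ← hcomm, ← hcomm, ← hKs, hcomm, hcomm, real_inner_self_eq_norm_sq]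
    rw [norm_add_sq_real, inner_add_left, inner_add_right, inner_add_right] at hq'
    rw [norm_sub_sq_real, inner_sub_left, inner_sub_right, inner_sub_right] at hp'
    simp only [inner_smul_left, inner_smul_right, norm_smul, Real.norm_of_nonneg hη.le,
      conj_trivial] at hq' hp'
    rw [real_inner_self_eq_norm_sq, hαγ] at hq' hp'
    linarith
  have hclos : ∀ u ∈ W, η * ‖K u‖ ≤ ‖b u‖ := by
    intro u hu
    let V : Submodule ℝ H := (b.comp b).toLinearMap.range
    have huV : u ∈ closure (V : Set H) := by
      rw [← Submodule.topologicalClosure_coe, ← Submodule.orthogonal_orthogonal_eq_closure]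
      refine (Submodule.mem_orthogonal _ _).2 fun v hv => hW v ?_ u hu
      have h0 : b (b v) = 0 := by
        refine ext_inner_left ℝ fun z => ?_
        rw [inner_zero_right, ← hbs, ← hbs]
        exact (Submodule.mem_orthogonal _ _).1 hv _ ⟨z, rfl⟩
      have h1 : b v = 0 := by
        rw [← inner_self_eq_zero (𝕜 := ℝ), hbs, h0, inner_zero_right]
      have h2 : v = -(η • K v) := eq_neg_of_add_eq_zero_left h1
      obtain ⟨hd, e⟩ := hb v
      have hKv : K v ∈ eigenspace A c := ⟨hd, by rwa [h1, sub_eq_zero] at e⟩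
      rw [h2]
      exact Submodule.neg_mem _ (Submodule.smul_mem _ _ hKv)
    have hcl : IsClosed {u : H | η * ‖K u‖ ≤ ‖b u‖} :=
      isClosed_le (by fun_prop) (by fun_prop)
    refine closure_minimal ?_ hcl huV
    rintro _ ⟨z, rfl⟩
    exact hrange z
  have hu : A x - (c + η) • (x : H) ∈ W := W.sub_mem (hAW x hx) (W.smul_mem _ hx)
  have := hclos _ hu
  obtain ⟨h, e⟩ := hb (A x - (c + η) • (x : H))
  have hx' : (⟨K (A x - (c + η) • (x : H)), h⟩ : A.domain) = x := Subtype.ext (hK.2 x)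
  rwa [← e, hx', hK.2 x] at this

theorem symmetric_of_isSelfAdjoint {A : H →ₗ.[ℝ] H} (hA : IsSelfAdjoint A) (x y : A.domain) :
    ⟪A x, (y : H)⟫_ℝ = ⟪(x : H), A y⟫_ℝ := by
  have h := LinearPMap.adjoint_isFormalAdjoint hA.dense_domain
  rw [LinearPMap.isSelfAdjoint_def.1 hA] at h
  exact h x y

theorem mem_eigenspace_of_inner {A : H →ₗ.[ℝ] H} (hA : IsSelfAdjoint A) {x : H} {μ : ℝ}
    (h : ∀ y : A.domain, ⟪μ • x, (y : H)⟫_ℝ = ⟪x, A y⟫_ℝ) : x ∈ eigenspace A μ := by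
  have h1 : x ∈ A.adjoint.domain := LinearPMap.mem_adjoint_domain_of_exists x ⟨μ • x, h⟩
  have h2 : A.adjoint ⟨x, h1⟩ = μ • x := LinearPMap.adjoint_apply_eq hA.dense_domain ⟨x, h1⟩ h
  revert h1
  rw [LinearPMap.isSelfAdjoint_def.1 hA]
  exact fun h1 h2 => ⟨h1, h2⟩

/-- A self-adjoint operator with discrete spectrum has a complete system of eigenvectors: on the
orthogonal complement of all eigenspaces `A - c` is bounded below for every real `c`, so that the
resolvent vanishes there. -/
theorem iSup_eigenspace_orthogonal {A : H →ₗ.[ℝ] H} (hA : IsSelfAdjoint A)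
    (hspec : HasDiscreteSpectrum A) : (⨆ μ : ℝ, eigenspace A μ)ᗮ = ⊥ := by
  have hsym := symmetric_of_isSelfAdjoint hA
  set W : Submodule ℝ H := (⨆ μ : ℝ, eigenspace A μ)ᗮ with hWdef
  have hW : ∀ w, w ∈ W ↔ ∀ μ, ∀ e ∈ eigenspace A μ, ⟪e, w⟫_ℝ = 0 := by
    intro w
    rw [hWdef, ← Submodule.iInf_orthogonal, Submodule.mem_iInf]
    simp only [Submodule.mem_orthogonal]
  have hAW : ∀ x : A.domain, (x : H) ∈ W → A x ∈ W := by
    intro x hx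
    rw [hW] at hx ⊢
    rintro μ e ⟨he, hee⟩
    rw [← hsym ⟨e, he⟩ x, hee, inner_smul_left, hx μ e ⟨he, hee⟩, mul_zero]
  have hb : ∀ c : ℝ, ∃ ρ > 0, ∀ x : A.domain, (x : H) ∈ W →
      ρ * ‖(x : H)‖ ≤ ‖A x - c • (x : H)‖ := by
    intro c
    have := hspec.no_accPt c
    rw [accPt_iff_frequently, Filter.not_frequently, Metric.eventually_nhds_iff] at this
    obtain ⟨ε, hε, h⟩ := this
    refine ⟨ε / 2, by positivity, fun x hx => mul_norm_le_of_isolated hsym (by positivity)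
      (fun c' hc hc' => ?_) W hAW (fun e he w hw => (hW w).1 hw c e he) x hx⟩
    by_contra hn
    exact h (y := c') (by rw [Real.dist_eq]; linarith) ⟨hc, hn⟩
  obtain ⟨c, hc⟩ : ∃ c, c ∉ opSpectrum A := (hspec.countable.dense_compl ℝ).nonempty
  obtain ⟨R, hR⟩ : c ∈ resolventSet A := not_not.1 hc
  have hR : IsResolventAt A c R := hR
  have hRW : ∀ x ∈ W, R x ∈ W := by
    intro x hx
    rw [hW] at hx ⊢
    rintro μ e ⟨he, hee⟩
    have h1 := hR.2 ⟨e, he⟩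
    rw [hee, ← sub_smul, map_smul] at h1
    rw [← hR.symmetric hsym]
    have h2 : ⟪R ((μ - c) • e), x⟫_ℝ = 0 := by rw [map_smul, h1]; exact hx μ e ⟨he, hee⟩
    rcases eq_or_ne (μ - c) 0 with h0 | h0
    · have : e = 0 := by simpa [h0] using h1.symm
      simp [this]
    · rw [map_smul, inner_smul_left] at h2
      exact (mul_eq_zero.1 h2).resolve_left (by simpa using h0)
  refine (Submodule.eq_bot_iff _).2 fun w hw => ?_
  -- `A` restricted to `W` has no spectrum, so the resolvent bound holds with any distance `a`.
  have hlim : ‖R w‖ ≤ 0 := by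
    have h1 : ∀ a : ℝ, 0 < a → ‖R w‖ ≤ a⁻¹ * ‖w‖ := fun a ha =>
      hR.norm_le_of_boundedBelow hsym W hRW ha (fun c' _ => hb c') hw
    have h2 : Filter.Tendsto (fun a : ℝ => a⁻¹ * ‖w‖) Filter.atTop (𝓝 0) := by
      simpa using tendsto_inv_atTop_zero.mul_const ‖w‖
    exact ge_of_tendsto h2 ((Filter.eventually_gt_atTop 0).mono h1)
  obtain ⟨h, e⟩ := hR.1 w
  have h0 : R w = 0 := norm_le_zero_iff.1 hlim
  have : (⟨R w, h⟩ : A.domain) = 0 := Subtype.ext h0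
  rw [← e, this, h0, A.map_zero, smul_zero, sub_zero]

end DampedWave

namespace DampedWave

/-! ### Diagonal operators in a Hilbert basis -/

section Diagonal

variable {ι H : Type*} [NormedAddCommGroup H] [InnerProductSpace ℝ H]

theorem hasSum_sq_inner (b : HilbertBasis ι ℝ H) (x : H) :
    HasSum (fun i => ⟪b i, x⟫_ℝ ^ 2) (‖x‖ ^ 2) := by
  have := b.hasSum_inner_mul_inner x x
  rw [real_inner_self_eq_norm_sq] at this
  refine this.congr_fun fun i => ?_
  rw [real_inner_comm x, pow_two]

theorem ext_inner_basis (b : HilbertBasis ι ℝ H) {x y : H}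
    (h : ∀ i, ⟪b i, x⟫_ℝ = ⟪b i, y⟫_ℝ) : x = y := by
  apply b.repr.injective
  ext i
  rw [b.repr_apply_apply, b.repr_apply_apply, h]

theorem norm_le_of_abs_inner_le (b : HilbertBasis ι ℝ H) {x y z : H} {C : ℝ} (hC : 0 ≤ C)
    (h : ∀ i, |⟪b i, x⟫_ℝ| ≤ C * (|⟪b i, y⟫_ℝ| + |⟪b i, z⟫_ℝ|)) :
    ‖x‖ ≤ 2 * C * (‖y‖ + ‖z‖) := by
  refine le_of_sq_le_sq ?_ (by positivity)
  have h1 : ‖x‖ ^ 2 ≤ 2 * C ^ 2 * (‖y‖ ^ 2 + ‖z‖ ^ 2) := by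
    refine hasSum_le (fun i => ?_) (hasSum_sq_inner b x)
      (((hasSum_sq_inner b y).add (hasSum_sq_inner b z)).mul_left (2 * C ^ 2))
    rw [← sq_abs, ← sq_abs ⟪b i, y⟫_ℝ, ← sq_abs ⟪b i, z⟫_ℝ]
    calc |⟪b i, x⟫_ℝ| ^ 2 ≤ (C * (|⟪b i, y⟫_ℝ| + |⟪b i, z⟫_ℝ|)) ^ 2 := by gcongr; exact h i
      _ ≤ _ := by nlinarith [mul_nonneg (sq_nonneg C) (sq_nonneg (|⟪b i, y⟫_ℝ| - |⟪b i, z⟫_ℝ|))]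
  have : 0 ≤ C ^ 2 * (‖y‖ * ‖z‖) := by positivity
  have h3 : 0 ≤ C ^ 2 * (‖y‖ ^ 2 + ‖z‖ ^ 2) := by positivity
  nlinarith

/-- The operator `x ↦ ∑ φ i ⟨b i, x⟩ b i`, with the value `0` where the coefficients are not square
summable; for bounded `φ` this is everywhere defined. -/
def diag (b : HilbertBasis ι ℝ H) (φ : ι → ℝ) (x : H) : H :=
  open Classical in
  b.repr.symm (if h : Memℓp (fun i => φ i * ⟪b i, x⟫_ℝ) 2 then ⟨_, h⟩ else 0)

theorem inner_diag (b : HilbertBasis ι ℝ H) {φ : ι → ℝ} {C : ℝ} (hφ : ∀ i, |φ i| ≤ C) (x : H)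
    (i : ι) : ⟪b i, diag b φ x⟫_ℝ = φ i * ⟪b i, x⟫_ℝ := by
  have h : Memℓp (fun i => φ i * ⟪b i, x⟫_ℝ) 2 := by
    rw [memℓp_gen_iff (by norm_num)]
    refine Summable.of_nonneg_of_le (fun i => by positivity) (fun i => ?_)
      ((hasSum_sq_inner b x).summable.mul_left (C ^ 2))
    simp only [ENNReal.toReal_ofNat, Real.rpow_two, Real.norm_eq_abs, sq_abs, mul_pow]
    exact mul_le_mul_of_nonneg_right (sq_le_sq.2 ((hφ i).trans (le_abs_self C))) (sq_nonneg _)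
  rw [diag, dif_pos h, ← b.repr_apply_apply, LinearIsometryEquiv.apply_symm_apply]

theorem norm_diag_le (b : HilbertBasis ι ℝ H) {φ : ι → ℝ} {C : ℝ} (hC : 0 ≤ C)
    (hφ : ∀ i, |φ i| ≤ C) (x : H) : ‖diag b φ x‖ ≤ C * ‖x‖ := by
  refine le_of_sq_le_sq ?_ (by positivity)
  rw [mul_pow]
  refine hasSum_le (fun i => ?_) (hasSum_sq_inner b _) ((hasSum_sq_inner b x).mul_left (C ^ 2))
  rw [inner_diag b hφ, mul_pow]
  exact mul_le_mul_of_nonneg_right (sq_le_sq.2 ((hφ i).trans (le_abs_self C))) (sq_nonneg _)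

theorem diag_add (b : HilbertBasis ι ℝ H) {φ : ι → ℝ} {C : ℝ} (hφ : ∀ i, |φ i| ≤ C) (x y : H) :
    diag b φ (x + y) = diag b φ x + diag b φ y :=
  ext_inner_basis b fun i => by
    rw [inner_add_right, inner_diag b hφ, inner_diag b hφ, inner_diag b hφ, inner_add_right,
      mul_add]

theorem diag_sub (b : HilbertBasis ι ℝ H) {φ : ι → ℝ} {C : ℝ} (hφ : ∀ i, |φ i| ≤ C) (x y : H) :
    diag b φ (x - y) = diag b φ x - diag b φ y :=
  ext_inner_basis b fun i => by
    rw [inner_sub_right, inner_diag b hφ, inner_diag b hφ, inner_diag b hφ, inner_sub_right,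
      mul_sub]

theorem diag_smul (b : HilbertBasis ι ℝ H) {φ : ι → ℝ} {C : ℝ} (hφ : ∀ i, |φ i| ≤ C) (c : ℝ)
    (x : H) : diag b φ (c • x) = c • diag b φ x :=
  ext_inner_basis b fun i => by
    rw [inner_smul_right, inner_diag b hφ, inner_diag b hφ, inner_smul_right]
    ring

theorem continuousAt_diag (b : HilbertBasis ι ℝ H) {X : Type*} [TopologicalSpace X]
    {φ : X → ι → ℝ} {g : X → H} {x₀ : X} {C : ℝ} (hC : 0 ≤ C)
    (hφ : ∀ i, ContinuousAt (fun x => φ x i) x₀) (hb : ∀ᶠ x in 𝓝 x₀, ∀ i, |φ x i| ≤ C)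
    (hg : ContinuousAt g x₀) : ContinuousAt (fun x => diag b (φ x) (g x)) x₀ := by
  have hb0 := hb.self_of_nhds
  have h1 : Filter.Tendsto (fun x => C * ‖g x - g x₀‖) (𝓝 x₀) (𝓝 0) := by
    have : ContinuousAt (fun x => C * ‖g x - g x₀‖) x₀ := by fun_prop
    simpa [ContinuousAt] using this
  have h2 : Filter.Tendsto (fun x => ‖diag b (φ x) (g x₀) - diag b (φ x₀) (g x₀)‖ ^ 2) (𝓝 x₀)
      (𝓝 0) := by
    have h3 : Filter.Tendsto (fun x => ∑' i, ((φ x i - φ x₀ i) * ⟪b i, g x₀⟫_ℝ) ^ 2) (𝓝 x₀)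
        (𝓝 (∑' _ : ι, 0)) := by
      refine tendsto_tsum_of_dominated_convergence
        (bound := fun i => (2 * C) ^ 2 * ⟪b i, g x₀⟫_ℝ ^ 2)
        ((hasSum_sq_inner b _).summable.mul_left _) (fun i => ?_) ?_
      · have : ContinuousAt (fun x => ((φ x i - φ x₀ i) * ⟪b i, g x₀⟫_ℝ) ^ 2) x₀ := by
          have := hφ i
          fun_prop
        simpa [ContinuousAt] using this
      · filter_upwards [hb] with x hx i
        rw [Real.norm_of_nonneg (by positivity), mul_pow]
        refine mul_le_mul_of_nonneg_right (sq_le_sq.2 (le_trans ?_ (le_abs_self _))) (sq_nonneg _)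
        linarith [abs_sub (φ x i) (φ x₀ i), hx i, hb0 i]
    rw [tsum_zero] at h3
    refine h3.congr' ?_
    filter_upwards [hb] with x hx
    rw [← (hasSum_sq_inner b _).tsum_eq]
    refine tsum_congr fun i => ?_
    rw [inner_sub_right, inner_diag b hx, inner_diag b hb0, sub_mul]
  have h4 : Filter.Tendsto (fun x => ‖diag b (φ x) (g x₀) - diag b (φ x₀) (g x₀)‖) (𝓝 x₀)
      (𝓝 0) := by
    simpa [Real.sqrt_sq] using h2.sqrt
  rw [ContinuousAt, tendsto_iff_norm_sub_tendsto_zero]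
  refine squeeze_zero' (Filter.Eventually.of_forall fun _ => norm_nonneg _) ?_
    (by simpa using h1.add h4)
  filter_upwards [hb] with x hx
  calc ‖diag b (φ x) (g x) - diag b (φ x₀) (g x₀)‖
      = ‖diag b (φ x) (g x - g x₀) + (diag b (φ x) (g x₀) - diag b (φ x₀) (g x₀))‖ := by
        rw [diag_sub b hx]; congr 1; abel
    _ ≤ _ := (norm_add_le _ _).trans (by gcongr; exact norm_diag_le b hC hx _)

end Diagonal

/-! ### Eigenbases and the energy space -/

variable {H : Type*} [NormedAddCommGroup H] [InnerProductSpace ℝ H]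

/-- A Hilbert basis of eigenvectors of `A`, with the corresponding eigenvalues `ev i`, which are
nonnegative points of the spectrum. -/
structure EigenBasis (A : H →ₗ.[ℝ] H) (ι : Type*) where
  /-- The eigenvectors. -/
  basis : HilbertBasis ι ℝ H
  /-- The eigenvalues. -/
  ev : ι → ℝ
  mem_eigenspace : ∀ i, basis i ∈ eigenspace A (ev i)
  mem_spectrum : ∀ i, ev i ∈ opSpectrum A
  nonneg : ∀ i, 0 ≤ ev i

theorem inner_eq_zero_of_mem_eigenspace {A : H →ₗ.[ℝ] H}
    (hsym : ∀ x y : A.domain, ⟪A x, (y : H)⟫_ℝ = ⟪(x : H), A y⟫_ℝ) {μ ν : ℝ} (h : μ ≠ ν) {x y : H}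
    (hx : x ∈ eigenspace A μ) (hy : y ∈ eigenspace A ν) : ⟪x, y⟫_ℝ = 0 := by
  obtain ⟨hx, ex⟩ := hx
  obtain ⟨hy, ey⟩ := hy
  have := hsym ⟨x, hx⟩ ⟨y, hy⟩
  rw [ex, ey, inner_smul_left, inner_smul_right] at this
  simp only [conj_trivial] at this
  have h2 : (μ - ν) * ⟪x, y⟫_ℝ = 0 := by linarith
  exact (mul_eq_zero.1 h2).resolve_left (sub_ne_zero.2 h)

theorem mem_opSpectrum_of_mem_eigenspace {A : H →ₗ.[ℝ] H} {μ : ℝ} {x : H}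
    (hx : x ∈ eigenspace A μ) (h0 : x ≠ 0) : μ ∈ opSpectrum A := by
  rintro ⟨R, -, hR⟩
  obtain ⟨hx, ex⟩ := hx
  have := hR ⟨x, hx⟩
  rw [ex, sub_self, map_zero] at this
  exact h0 this.symm

variable [CompleteSpace H]

theorem isClosed_eigenspace {A : H →ₗ.[ℝ] H} (hA : IsSelfAdjoint A) (μ : ℝ) :
    IsClosed (eigenspace A μ : Set H) := by
  have : (eigenspace A μ : Set H) = ⋂ y : A.domain, {x | ⟪μ • x, (y : H)⟫_ℝ = ⟪x, A y⟫_ℝ} := by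
    ext x
    simp only [Set.mem_iInter, Set.mem_ofPred_eq]
    refine ⟨?_, mem_eigenspace_of_inner hA⟩
    rintro ⟨h, e⟩ y
    rw [← e, symmetric_of_isSelfAdjoint hA]
  rw [this]
  exact isClosed_iInter fun y => isClosed_eq (by fun_prop) (by fun_prop)

theorem exists_eigenBasis.{u} {H : Type u} [NormedAddCommGroup H] [InnerProductSpace ℝ H]
    [CompleteSpace H] {A : H →ₗ.[ℝ] H} (hA : IsSelfAdjoint A)
    (hpos : ∀ x : A.domain, 0 ≤ ⟪A x, (x : H)⟫_ℝ) (hspec : HasDiscreteSpectrum A) :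
    ∃ ι : Type u, Nonempty (EigenBasis A ι) := by
  have hsym := symmetric_of_isSelfAdjoint hA
  have : ∀ μ, CompleteSpace (eigenspace A μ) := fun μ =>
    (isClosed_eigenspace hA μ).completeSpace_coe
  choose w b hb using fun μ => exists_hilbertBasis ℝ (eigenspace A μ)
  let v : (Σ μ, w μ) → H := fun p => ((p.2 : eigenspace A p.1) : H)
  have hv : Orthonormal ℝ v := by
    constructor
    · rintro ⟨μ, x⟩
      have := (b μ).orthonormal.1 x
      rwa [hb] at this
    · rintro ⟨μ, x⟩ ⟨ν, y⟩ hne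
      rcases eq_or_ne μ ν with rfl | h
      · have := (b μ).orthonormal.2 (i := x) (j := y) (fun h => hne (by rw [h]))
        rwa [hb] at this
      · exact inner_eq_zero_of_mem_eigenspace hsym h (x : eigenspace A μ).2 (y : eigenspace A ν).2
  have horth : (Submodule.span ℝ (Set.range v))ᗮ = ⊥ := by
    rw [← le_bot_iff, ← iSup_eigenspace_orthogonal hA hspec, ← Submodule.iInf_orthogonal,
      le_iInf_iff]
    intro μ y hy
    refine (Submodule.mem_orthogonal _ _).2 fun e he => ?_
    have h0 : ∀ x : w μ, ⟪((x : eigenspace A μ) : H), y⟫_ℝ = 0 := fun x =>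
      (Submodule.mem_orthogonal _ _).1 hy _ (Submodule.subset_span ⟨⟨μ, x⟩, rfl⟩)
    have h1 := ((b μ).hasSum_repr ⟨e, he⟩).mapL
      ((innerSL ℝ y).comp (eigenspace A μ).subtypeL)
    have h2 : HasSum (fun _ : w μ => (0 : ℝ)) ⟪y, e⟫_ℝ := by
      refine h1.congr_fun fun x => ?_
      rw [map_smul, hb]
      have : ((innerSL ℝ y).comp (eigenspace A μ).subtypeL) (x : eigenspace A μ) = 0 := by
        change ⟪y, ((x : eigenspace A μ) : H)⟫_ℝ = 0
        rw [real_inner_comm, h0]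
      rw [this, smul_zero]
    rw [real_inner_comm]
    exact h2.unique hasSum_zero
  let B := HilbertBasis.mkOfOrthogonalEqBot hv horth
  have hB : ∀ p, B p = v p := fun p => by
    rw [HilbertBasis.coe_mkOfOrthogonalEqBot]
  have hmem : ∀ p, B p ∈ eigenspace A p.1 := fun p => by
    rw [hB]; exact (p.2 : eigenspace A p.1).2
  refine ⟨_, ⟨⟨B, fun p => p.1, hmem,
    fun p => mem_opSpectrum_of_mem_eigenspace (hmem p) (B.orthonormal.ne_zero p),
    fun p => ?_⟩⟩⟩
  obtain ⟨h, e⟩ := hmem p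
  have := hpos ⟨_, h⟩
  rw [e, inner_smul_left, real_inner_self_eq_norm_sq, B.orthonormal.1] at this
  simpa using this

theorem EigenBasis.mem_eigenspace_of_forall {A : H →ₗ.[ℝ] H} {ι : Type*} (B : EigenBasis A ι)
    (hA : IsSelfAdjoint A) {x : H} {μ : ℝ}
    (h : ∀ i, B.ev i ≠ μ → ⟪B.basis i, x⟫_ℝ = 0) : x ∈ eigenspace A μ := by
  refine mem_eigenspace_of_inner hA fun y => ?_
  rw [← (B.basis.hasSum_inner_mul_inner (μ • x) y).tsum_eq,
    ← (B.basis.hasSum_inner_mul_inner x (A y)).tsum_eq]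
  refine tsum_congr fun i => ?_
  obtain ⟨hi, e⟩ := B.mem_eigenspace i
  have h1 : ⟪B.basis i, A y⟫_ℝ = B.ev i * ⟪B.basis i, (y : H)⟫_ℝ := by
    rw [← symmetric_of_isSelfAdjoint hA ⟨_, hi⟩, e, inner_smul_left]; rfl
  rw [h1, inner_smul_left, real_inner_comm]
  rcases eq_or_ne (B.ev i) μ with rfl | hne
  · simp only [conj_trivial]
    ring
  · rw [h i hne]; simp

theorem EigenBasis.inner_eq_zero {A : H →ₗ.[ℝ] H} {ι : Type*} (B : EigenBasis A ι)
    (hA : IsSelfAdjoint A) {x : H} {μ : ℝ} (hx : x ∈ eigenspace A μ) {i : ι} (hi : B.ev i ≠ μ) :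
    ⟪B.basis i, x⟫_ℝ = 0 :=
  inner_eq_zero_of_mem_eigenspace (symmetric_of_isSelfAdjoint hA) hi (B.mem_eigenspace i) hx

theorem EigenBasis.eigenProj_basis {A : H →ₗ.[ℝ] H} {ι : Type*} (B : EigenBasis A ι)
    (hA : IsSelfAdjoint A) (μ : ℝ) (i : ι) :
    (B.ev i = μ → eigenProj A μ (B.basis i) = B.basis i) ∧
      (B.ev i ≠ μ → eigenProj A μ (B.basis i) = 0) := by
  refine ⟨?_, fun h => ?_⟩
  · rintro rfl
    exact Submodule.starProjection_eq_self_iff.2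
      (Submodule.le_topologicalClosure _ (B.mem_eigenspace i))
  · rw [eigenProj, Submodule.starProjection_apply_eq_zero_iff, Submodule.orthogonal_closure]
    exact (Submodule.mem_orthogonal' _ _).2 fun e he => B.inner_eq_zero hA he h

theorem EigenBasis.inner_eigenProj {A : H →ₗ.[ℝ] H} {ι : Type*} (B : EigenBasis A ι)
    (hA : IsSelfAdjoint A) (μ : ℝ) (i : ι) (x : H) :
    (B.ev i = μ → ⟪B.basis i, eigenProj A μ x⟫_ℝ = ⟪B.basis i, x⟫_ℝ) ∧
      (B.ev i ≠ μ → ⟪B.basis i, eigenProj A μ x⟫_ℝ = 0) := by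
  have : ⟪B.basis i, eigenProj A μ x⟫_ℝ = ⟪eigenProj A μ (B.basis i), x⟫_ℝ :=
    (Submodule.inner_starProjection_left_eq_right _ _ _).symm
  rw [this]
  refine ⟨fun h => ?_, fun h => ?_⟩
  · rw [(B.eigenProj_basis hA μ i).1 h]
  · rw [(B.eigenProj_basis hA μ i).2 h, inner_zero_left]

theorem EigenBasis.inner_sqrtMap {A : H →ₗ.[ℝ] H} {ι : Type*} (B : EigenBasis A ι)
    (hA : IsSelfAdjoint A) (x : EnergySpace A) (i : ι) :
    ⟪B.basis i, sqrtMap x⟫_ℝ = √(B.ev i) * ⟪B.basis i, incl x⟫_ℝ := by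
  have hs : Summable fun μ : opSpectrum A => √(μ : ℝ) • eigenProj A μ (incl x) :=
    incl_mem_domain x
  have h1 := hs.hasSum.mapL (innerSL ℝ (B.basis i))
  have h2 : HasSum (fun μ : opSpectrum A =>
      innerSL ℝ (B.basis i) (√(μ : ℝ) • eigenProj A μ (incl x)))
      (innerSL ℝ (B.basis i) (√(B.ev i) • eigenProj A (B.ev i) (incl x))) := by
    refine hasSum_single (⟨B.ev i, B.mem_spectrum i⟩ : opSpectrum A) fun μ hμ => ?_
    rw [innerSL_apply_apply, inner_smul_right, (B.inner_eigenProj hA μ i _).2, mul_zero]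
    exact fun h => hμ (Subtype.ext h.symm)
  have h3 := h1.unique h2
  rw [innerSL_apply_apply, innerSL_apply_apply, inner_smul_right,
    (B.inner_eigenProj hA _ i _).1 rfl] at h3
  rw [sqrtMap_eq]
  exact h3

theorem EigenBasis.energy_ext {A : H →ₗ.[ℝ] H} {ι : Type*} (B : EigenBasis A ι)
    (hA : IsSelfAdjoint A) {x y : EnergySpace A}
    (h : ∀ i, ⟪B.basis i, incl x⟫_ℝ = ⟪B.basis i, incl y⟫_ℝ) : x = y :=
  Subtype.ext (WithLp.ofLp_injective 2 (Prod.ext (ext_inner_basis B.basis h)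
    (ext_inner_basis B.basis fun i => by
      change ⟪B.basis i, sqrtMap x⟫_ℝ = ⟪B.basis i, sqrtMap y⟫_ℝ
      rw [B.inner_sqrtMap hA, B.inner_sqrtMap hA, h])))

/-- A pair `(h, k)` lies in the graph of `A^{1/2}` as soon as the coordinates of `k` are those of
`h` multiplied by the square roots of the eigenvalues. -/
theorem EigenBasis.mem_energySpace {A : H →ₗ.[ℝ] H} {ι : Type*} (B : EigenBasis A ι)
    (hA : IsSelfAdjoint A) {h k : H}
    (hk : ∀ i, ⟪B.basis i, k⟫_ℝ = √(B.ev i) * ⟪B.basis i, h⟫_ℝ) :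
    WithLp.toLp 2 (h, k) ∈ EnergySpace A := by
  let ev' : ι → opSpectrum A := fun i => ⟨B.ev i, B.mem_spectrum i⟩
  have hproj : ∀ μ : opSpectrum A, √(μ : ℝ) • eigenProj A μ h = eigenProj A μ k := by
    intro μ
    refine ext_inner_basis B.basis fun i => ?_
    rw [inner_smul_right]
    rcases eq_or_ne (B.ev i) μ with hi | hi
    · rw [(B.inner_eigenProj hA μ i _).1 hi, (B.inner_eigenProj hA μ i _).1 hi, hk, hi]
    · rw [(B.inner_eigenProj hA μ i _).2 hi, (B.inner_eigenProj hA μ i _).2 hi, mul_zero]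
  have hsum : HasSum (fun μ : opSpectrum A => √(μ : ℝ) • eigenProj A μ h) k := by
    have h1 := (Equiv.sigmaFiberEquiv ev').hasSum_iff.2 (B.basis.hasSum_repr k)
    refine h1.sigma fun μ => ?_
    rw [hproj]
    have h2 := (B.basis.hasSum_repr k).mapL (eigenProj A μ)
    have hsupp : Function.support
        (fun i => eigenProj A μ (B.basis.repr k i • B.basis i)) ⊆ {i | ev' i = μ} := by
      intro i hi
      by_contra hne
      refine hi ?_
      simp only
      rw [map_smul, (B.eigenProj_basis hA μ i).2 (fun h => hne (Subtype.ext h)), smul_zero]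
    rw [← hasSum_subtype_iff_of_support_subset hsupp] at h2
    refine h2.congr_fun fun i => ?_
    simp only [Function.comp_apply]
    rw [map_smul, (B.eigenProj_basis hA μ i).1 (congrArg Subtype.val i.2)]
    rfl
  refine ⟨(h, k), ?_, rfl⟩
  exact LinearPMap.mem_graph_iff _ |>.2 ⟨⟨h, hsum.summable⟩, rfl, hsum.tsum_eq⟩

/-- The inclusion of `D(A^{1/2})` in `H` as a continuous linear map. -/
def inclL (A : H →ₗ.[ℝ] H) : EnergySpace A →L[ℝ] H :=
  LinearMap.mkContinuous
    { toFun := incl, map_add' := fun _ _ => rfl, map_smul' := fun _ _ => rfl } 1 fun x => by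
      rw [one_mul]
      refine le_of_sq_le_sq ?_ (norm_nonneg _)
      rw [norm_sq_eq]
      exact le_add_of_nonneg_right (sq_nonneg _)

/-- The operator `A^{1/2}` as a continuous linear map from `D(A^{1/2})` to `H`. -/
def sqrtL (A : H →ₗ.[ℝ] H) : EnergySpace A →L[ℝ] H :=
  LinearMap.mkContinuous
    { toFun := sqrtMap, map_add' := fun _ _ => rfl, map_smul' := fun _ _ => rfl } 1 fun x => by
      rw [one_mul]
      refine le_of_sq_le_sq ?_ (norm_nonneg _)
      rw [norm_sq_eq]
      exact le_add_of_nonneg_left (sq_nonneg _)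

theorem abs_inv_sqrt_one_add_le {m : ℝ} (hm : 0 ≤ m) : |(√(1 + m))⁻¹| ≤ 1 := by
  rw [abs_of_nonneg (by positivity)]
  exact inv_le_one_of_one_le₀ (Real.one_le_sqrt.2 (by linarith))

theorem abs_sqrt_div_sqrt_one_add_le {m : ℝ} (hm : 0 ≤ m) : |√m / √(1 + m)| ≤ 1 := by
  rw [abs_of_nonneg (by positivity)]
  exact div_le_one_of_le₀ (Real.sqrt_le_sqrt (by linarith)) (by positivity)

/-- The operator `(1 + A)^{-1/2}`, an isometry of `H` onto `D(A^{1/2})`. -/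
theorem EigenBasis.exists_energyEquiv {A : H →ₗ.[ℝ] H} {ι : Type*} (B : EigenBasis A ι)
    (hA : IsSelfAdjoint A) :
    ∃ E : H ≃ₗᵢ[ℝ] EnergySpace A, ∀ h i,
      ⟪B.basis i, incl (E h)⟫_ℝ = (√(1 + B.ev i))⁻¹ * ⟪B.basis i, h⟫_ℝ := by
  have b1 := fun i => abs_inv_sqrt_one_add_le (B.nonneg i)
  have b2 := fun i => abs_sqrt_div_sqrt_one_add_le (B.nonneg i)
  have hmem : ∀ h, WithLp.toLp 2 (diag B.basis (fun i => (√(1 + B.ev i))⁻¹) h,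
      diag B.basis (fun i => √(B.ev i) / √(1 + B.ev i)) h) ∈ EnergySpace A := fun h =>
    B.mem_energySpace hA fun i => by
      rw [inner_diag _ b1, inner_diag _ b2]; ring
  let L : H →ₗᵢ[ℝ] EnergySpace A :=
    { toFun := fun h => ⟨_, hmem h⟩
      map_add' := fun x y => B.energy_ext hA fun i => by
        change ⟪_, diag _ _ _⟫_ℝ = ⟪_, diag _ _ _ + diag _ _ _⟫_ℝ
        rw [diag_add _ b1]
      map_smul' := fun c x => B.energy_ext hA fun i => by
        change ⟪_, diag _ _ _⟫_ℝ = ⟪_, c • diag _ _ _⟫_ℝ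
        rw [diag_smul _ b1]
      norm_map' := fun x => by
        rw [← sq_eq_sq₀ (norm_nonneg _) (norm_nonneg _)]
        change ‖(⟨_, hmem x⟩ : EnergySpace A)‖ ^ 2 = _
        rw [norm_sq_eq]
        change ‖diag B.basis (fun i => (√(1 + B.ev i))⁻¹) x‖ ^ 2 +
          ‖diag B.basis (fun i => √(B.ev i) / √(1 + B.ev i)) x‖ ^ 2 = _
        refine ((hasSum_sq_inner B.basis _).add (hasSum_sq_inner B.basis _)).unique ?_
        refine (hasSum_sq_inner B.basis x).congr_fun fun i => ?_
        have h0 := B.nonneg i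
        have h1 : 0 < 1 + B.ev i := by linarith
        rw [inner_diag _ b1, inner_diag _ b2, mul_pow, mul_pow, inv_pow, div_pow,
          Real.sq_sqrt h1.le, Real.sq_sqrt h0]
        field_simp }
  have hL : ∀ h i, ⟪B.basis i, incl (L h)⟫_ℝ = (√(1 + B.ev i))⁻¹ * ⟪B.basis i, h⟫_ℝ :=
    fun h i => inner_diag _ b1 h i
  have hLs : Function.Surjective L := by
    intro x
    refine ⟨diag B.basis (fun i => (√(1 + B.ev i))⁻¹) (incl x) +
      diag B.basis (fun i => √(B.ev i) / √(1 + B.ev i)) (sqrtMap x), ?_⟩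
    refine B.energy_ext hA fun i => ?_
    have h0 := B.nonneg i
    have h1 : 0 < 1 + B.ev i := by linarith
    have h2 : √(1 + B.ev i) ^ 2 = 1 + B.ev i := Real.sq_sqrt h1.le
    have h3 : √(B.ev i) ^ 2 = B.ev i := Real.sq_sqrt h0
    have h4 : √(1 + B.ev i) ≠ 0 := (Real.sqrt_pos.2 h1).ne'
    rw [hL, inner_add_right, inner_diag _ b1, inner_diag _ b2, B.inner_sqrtMap hA]
    field_simp
    rw [h2, h3]; ring
  exact ⟨LinearIsometryEquiv.ofSurjective L hLs, hL⟩

end DampedWave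

namespace DampedWave

/-! ### The flow of a single mode -/

/-- The solution of `s'' = -ω² s`, `s(0) = 0`, `s'(0) = 1`. -/
def sinScaled (ω t : ℝ) : ℝ := if ω = 0 then t else Real.sin (ω * t) / ω

theorem hasDerivAt_sinScaled (ω t : ℝ) : HasDerivAt (sinScaled ω) (Real.cos (ω * t)) t := by
  unfold sinScaled
  split_ifs with h
  · simpa only [h, zero_mul, Real.cos_zero] using hasDerivAt_id' t
  · have h1 : HasDerivAt (fun t => ω * t) ω t := by simpa using (hasDerivAt_id t).const_mul ω
    simpa [h] using h1.sin.div_const ω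

theorem mul_sinScaled (ω t : ℝ) : ω * sinScaled ω t = Real.sin (ω * t) := by
  unfold sinScaled
  split_ifs with h
  · simp [h]
  · field_simp

theorem hasDerivAt_cos_mul (ω t : ℝ) :
    HasDerivAt (fun t => Real.cos (ω * t)) (-(ω ^ 2 * sinScaled ω t)) t := by
  have h1 : HasDerivAt (fun t => ω * t) ω t := by simpa using (hasDerivAt_id t).const_mul ω
  refine HasDerivAt.congr_deriv (h1.cos) ?_
  rw [← mul_sinScaled]; ring

theorem sinScaled_zero (ω : ℝ) : sinScaled ω 0 = 0 := by simp [sinScaled]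

theorem sinScaled_add (ω t s : ℝ) : sinScaled ω (t + s) =
    sinScaled ω t * Real.cos (ω * s) + Real.cos (ω * t) * sinScaled ω s := by
  unfold sinScaled
  split_ifs with h
  · simp [h]
  · rw [mul_add, Real.sin_add]; field_simp

theorem cos_mul_add (ω t s : ℝ) : Real.cos (ω * (t + s)) =
    Real.cos (ω * t) * Real.cos (ω * s) - ω ^ 2 * (sinScaled ω t * sinScaled ω s) := by
  rw [mul_add, Real.cos_add, ← mul_sinScaled, ← mul_sinScaled]; ring

theorem abs_sinScaled_le (ω t : ℝ) : |sinScaled ω t| ≤ |t| := by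
  unfold sinScaled
  split_ifs with h
  · exact le_rfl
  · rw [abs_div, div_le_iff₀ (abs_pos.2 h), ← abs_mul, mul_comm t]
    exact Real.abs_sin_le_abs

/-- The real parts of the roots of `z² - 2δz + μ`. -/
def modeRates (δ μ : ℝ) : Set ℝ :=
  if μ < δ ^ 2 then {δ + √(δ ^ 2 - μ), δ - √(δ ^ 2 - μ)} else {δ}

/-- The function `t ↦ e^{-rt}` if `r ∈ S`, and `0` otherwise. -/
def rateExp (S : Set ℝ) (r t : ℝ) : ℝ := S.indicator (fun r => Real.exp (-r * t)) r

/-- For `S = Set.univ`, the fundamental matrix of the system `x' = y`, `y' = -μ x - 2δ y`; in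
general, its product with the projection onto the components whose rate lies in `S`, in the
decomposition along the eigenvectors `(1, -r)` if `μ < δ²`, and without any splitting otherwise. -/
def flow (δ : ℝ) (S : Set ℝ) (μ t : ℝ) : Matrix (Fin 2) (Fin 2) ℝ :=
  open Classical in
  if μ < δ ^ 2 then
    let β := √(δ ^ 2 - μ)
    let a := rateExp S (δ + β) t
    let b := rateExp S (δ - β) t
    !![(-a * (δ - β) + b * (δ + β)) / (2 * β), (-a + b) / (2 * β);
      (a - b) * μ / (2 * β), (a * (δ + β) - b * (δ - β)) / (2 * β)]
  else
    let ω := √(μ - δ ^ 2)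
    rateExp S δ t •
      !![Real.cos (ω * t) + δ * sinScaled ω t, sinScaled ω t;
        -μ * sinScaled ω t, Real.cos (ω * t) - δ * sinScaled ω t]

theorem rateExp_mul_rateExp {S T : Set ℝ} (hST : S ⊆ T) (t s r : ℝ) :
    rateExp T r t * rateExp S r s = rateExp S r (t + s) := by
  unfold rateExp
  by_cases h : r ∈ S
  · rw [Set.indicator_of_mem h, Set.indicator_of_mem (hST h), Set.indicator_of_mem h, ← Real.exp_add]
    congr 1; ring
  · rw [Set.indicator_of_notMem h, Set.indicator_of_notMem h, mul_zero]

theorem rateExp_univ_zero (r : ℝ) : rateExp Set.univ r 0 = 1 := by simp [rateExp]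

theorem rateExp_add_compl (S : Set ℝ) (r t : ℝ) :
    rateExp S r t + rateExp Sᶜ r t = rateExp Set.univ r t := by
  by_cases h : r ∈ S <;> simp [rateExp, h]

theorem hasDerivAt_rateExp (S : Set ℝ) (r t : ℝ) :
    HasDerivAt (rateExp S r) (-r * rateExp S r t) t := by
  unfold rateExp
  by_cases h : r ∈ S
  · simp only [Set.indicator_of_mem h]
    have h1 : HasDerivAt (fun t => -r * t) (-r) t := (hasDerivAt_id t).const_mul (-r) |>.congr_deriv
      (mul_one _)
    exact h1.exp.congr_deriv (mul_comm _ _)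
  · simp only [Set.indicator_of_notMem h, mul_zero]
    exact hasDerivAt_const _ _

/-- The group law of the flow; for `S = T` and `t = s = 0` it says that `flow δ S μ 0` is a
projection. -/
theorem flow_mul_flow (δ : ℝ) {S T : Set ℝ} (hST : S ⊆ T) (μ t s : ℝ) :
    flow δ T μ t * flow δ S μ s = flow δ S μ (t + s) := by
  unfold flow
  split_ifs with h
  · have hβ : 0 < √(δ ^ 2 - μ) := Real.sqrt_pos.2 (by linarith)
    have hsq : √(δ ^ 2 - μ) ^ 2 = δ ^ 2 - μ := Real.sq_sqrt (by linarith)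
    have hμ : μ = δ ^ 2 - √(δ ^ 2 - μ) ^ 2 := by linarith
    simp only [← rateExp_mul_rateExp hST]
    generalize √(δ ^ 2 - μ) = β at *
    subst hμ
    rw [Matrix.mul_fin_two]
    congr 1
    ext i j
    fin_cases i <;> fin_cases j <;> simp <;> field_simp <;> ring
  · have hsq : √(μ - δ ^ 2) ^ 2 = μ - δ ^ 2 := Real.sq_sqrt (by linarith)
    have hμ : μ = δ ^ 2 + √(μ - δ ^ 2) ^ 2 := by linarith
    simp only [← rateExp_mul_rateExp hST, cos_mul_add, sinScaled_add]
    generalize √(μ - δ ^ 2) = ω at *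
    subst hμ
    rw [Matrix.smul_mul, Matrix.mul_smul, smul_smul, Matrix.mul_fin_two]
    congr 1
    ext i j
    fin_cases i <;> fin_cases j <;> simp <;> ring

theorem flow_univ_zero (δ μ : ℝ) : flow δ Set.univ μ 0 = 1 := by
  unfold flow
  simp only [rateExp_univ_zero]
  rw [Matrix.one_fin_two]
  split_ifs with h
  · have hβ : 0 < √(δ ^ 2 - μ) := Real.sqrt_pos.2 (by linarith)
    ext i j
    fin_cases i <;> fin_cases j <;> simp <;> field_simp <;> ring
  · simp [sinScaled_zero]

theorem flow_add_flow_compl (δ : ℝ) (S : Set ℝ) (μ t : ℝ) :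
    flow δ S μ t + flow δ Sᶜ μ t = flow δ Set.univ μ t := by
  unfold flow
  simp only [← rateExp_add_compl S]
  split_ifs with h
  · ext i j
    fin_cases i <;> fin_cases j <;> simp <;> ring
  · rw [add_smul]

theorem hasDerivAt_flow_zero (δ : ℝ) (S : Set ℝ) (μ t : ℝ) (j : Fin 2) :
    HasDerivAt (fun t => flow δ S μ t 0 j) (flow δ S μ t 1 j) t := by
  unfold flow
  split_ifs with h
  · have hβ : 0 < √(δ ^ 2 - μ) := Real.sqrt_pos.2 (by linarith)
    have hsq : √(δ ^ 2 - μ) ^ 2 = δ ^ 2 - μ := Real.sq_sqrt (by linarith)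
    have ha := hasDerivAt_rateExp S (δ + √(δ ^ 2 - μ)) t
    have hb := hasDerivAt_rateExp S (δ - √(δ ^ 2 - μ)) t
    have hμ : μ = δ ^ 2 - √(δ ^ 2 - μ) ^ 2 := by linarith
    fin_cases j
    · simp only [Fin.zero_eta, Matrix.of_apply, Matrix.cons_val_zero, Matrix.cons_val_one]
      refine HasDerivAt.congr_deriv ((((ha.neg.mul_const (δ - √(δ ^ 2 - μ))).add
        (hb.mul_const (δ + √(δ ^ 2 - μ)))).div_const (2 * √(δ ^ 2 - μ)))) ?_
      linear_combination (-(rateExp S (δ + √(δ ^ 2 - μ)) t - rateExp S (δ - √(δ ^ 2 - μ)) t) /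
        (2 * √(δ ^ 2 - μ))) * hsq
    · simp only [Fin.mk_one, Matrix.of_apply, Matrix.cons_val_zero, Matrix.cons_val_one]
      refine HasDerivAt.congr_deriv (((ha.neg.add hb).div_const (2 * √(δ ^ 2 - μ)))) ?_
      ring
  · have hsq : √(μ - δ ^ 2) ^ 2 = μ - δ ^ 2 := Real.sq_sqrt (by linarith)
    have hμ : μ = δ ^ 2 + √(μ - δ ^ 2) ^ 2 := by linarith
    have ha := hasDerivAt_rateExp S δ t
    have hc := hasDerivAt_cos_mul (√(μ - δ ^ 2)) t
    have hs := hasDerivAt_sinScaled (√(μ - δ ^ 2)) t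
    fin_cases j
    · simp only [Fin.zero_eta, Matrix.smul_apply, Matrix.of_apply, Matrix.cons_val_zero,
        Matrix.cons_val_one, smul_eq_mul]
      refine HasDerivAt.congr_deriv (ha.mul (hc.add (hs.const_mul δ))) ?_
      rw [hsq]; simp; ring
    · simp only [Fin.mk_one, Matrix.smul_apply, Matrix.of_apply, Matrix.cons_val_zero,
        Matrix.cons_val_one, smul_eq_mul]
      refine HasDerivAt.congr_deriv (ha.mul hs) ?_
      ring

theorem hasDerivAt_flow_one (δ : ℝ) (S : Set ℝ) (μ t : ℝ) (j : Fin 2) :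
    HasDerivAt (fun t => flow δ S μ t 1 j)
      (-2 * δ * flow δ S μ t 1 j - μ * flow δ S μ t 0 j) t := by
  unfold flow
  split_ifs with h
  · have hβ : 0 < √(δ ^ 2 - μ) := Real.sqrt_pos.2 (by linarith)
    have hsq : √(δ ^ 2 - μ) ^ 2 = δ ^ 2 - μ := Real.sq_sqrt (by linarith)
    have ha := hasDerivAt_rateExp S (δ + √(δ ^ 2 - μ)) t
    have hb := hasDerivAt_rateExp S (δ - √(δ ^ 2 - μ)) t
    fin_cases j
    · simp only [Fin.zero_eta, Matrix.of_apply, Matrix.cons_val_zero, Matrix.cons_val_one]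
      refine HasDerivAt.congr_deriv (((ha.sub hb).mul_const μ).div_const (2 * √(δ ^ 2 - μ))) ?_
      ring
    · simp only [Fin.mk_one, Matrix.of_apply, Matrix.cons_val_zero, Matrix.cons_val_one]
      refine HasDerivAt.congr_deriv (((ha.mul_const (δ + √(δ ^ 2 - μ))).sub
        (hb.mul_const (δ - √(δ ^ 2 - μ)))).div_const (2 * √(δ ^ 2 - μ))) ?_
      linear_combination ((-rateExp S (δ + √(δ ^ 2 - μ)) t + rateExp S (δ - √(δ ^ 2 - μ)) t) /
        (2 * √(δ ^ 2 - μ))) * hsq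
  · have hsq : √(μ - δ ^ 2) ^ 2 = μ - δ ^ 2 := Real.sq_sqrt (by linarith)
    have ha := hasDerivAt_rateExp S δ t
    have hc := hasDerivAt_cos_mul (√(μ - δ ^ 2)) t
    have hs := hasDerivAt_sinScaled (√(μ - δ ^ 2)) t
    fin_cases j
    · simp only [Fin.zero_eta, Matrix.smul_apply, Matrix.of_apply, Matrix.cons_val_zero,
        Matrix.cons_val_one, smul_eq_mul]
      refine HasDerivAt.congr_deriv (ha.mul (hs.const_mul (-μ))) ?_
      ring
    · simp only [Fin.mk_one, Matrix.smul_apply, Matrix.of_apply, Matrix.cons_val_zero,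
        Matrix.cons_val_one, smul_eq_mul]
      refine HasDerivAt.congr_deriv (ha.mul (hc.sub (hs.const_mul δ))) ?_
      rw [hsq]; ring

theorem mul_exp_neg_le {η t : ℝ} (hη : 0 < η) : t * Real.exp (-(η * t)) ≤ η⁻¹ := by
  have h1 : η * t ≤ Real.exp (η * t) := by linarith [Real.add_one_le_exp (η * t)]
  rw [Real.exp_neg, ← div_eq_mul_inv, div_le_iff₀ (Real.exp_pos _), inv_mul_eq_div, le_div_iff₀ hη]
  linarith

theorem abs_rateExp_le {S : Set ℝ} {r κ σ t : ℝ} (hσ : σ ^ 2 = 1)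
    (hr : r ∈ S → 0 < σ * (r - κ)) (ht : 0 ≤ σ * t) :
    |rateExp S r t| ≤ Real.exp (-κ * t) := by
  unfold rateExp
  by_cases h : r ∈ S
  · rw [Set.indicator_of_mem h, abs_of_pos (Real.exp_pos _), Real.exp_le_exp]
    have := mul_nonneg (hr h).le ht
    have e : σ * (r - κ) * (σ * t) = σ ^ 2 * ((r - κ) * t) := by ring
    rw [e, hσ] at this
    linarith
  · rw [Set.indicator_of_notMem h, abs_zero]
    exact (Real.exp_pos _).le

theorem abs_mul_rateExp_le {S : Set ℝ} {r κ σ t : ℝ} (hσ : σ ^ 2 = 1)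
    (hr : r ∈ S → 0 < σ * (r - κ)) (ht : 0 ≤ σ * t) :
    |t| * |rateExp S r t| ≤ |r - κ|⁻¹ * Real.exp (-κ * t) := by
  unfold rateExp
  by_cases h : r ∈ S
  · rw [Set.indicator_of_mem h, abs_of_pos (Real.exp_pos _)]
    have h1 := hr h
    have hσ' : |σ| = 1 := by rwa [← abs_one, ← sq_eq_sq_iff_abs_eq_abs, one_pow]
    have e1 : |t| = σ * t := by rw [← abs_of_nonneg ht, abs_mul, hσ', one_mul]
    have e2 : |r - κ| = σ * (r - κ) := by rw [← abs_of_pos h1, abs_mul, hσ', one_mul]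
    have e3 : -r * t = -(|r - κ| * |t|) + -κ * t := by
      rw [e1, e2]
      linear_combination ((r - κ) * t) * hσ
    rw [e3, Real.exp_add, ← mul_assoc]
    gcongr
    exact mul_exp_neg_le (by rw [e2]; exact h1)
  · rw [Set.indicator_of_notMem h, abs_zero, mul_zero]
    positivity

/-- The flow of a mode in the variables `(√(1 + μ) x, y)`, in which the energy norm is the Euclidean
norm. -/
def wflow (δ : ℝ) (S : Set ℝ) (μ t : ℝ) : Matrix (Fin 2) (Fin 2) ℝ :=
  !![flow δ S μ t 0 0, √(1 + μ) * flow δ S μ t 0 1;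
    (√(1 + μ))⁻¹ * flow δ S μ t 1 0, flow δ S μ t 1 1]

/-- Uniform bounds for high frequencies. The weight `√(1 + μ)` is compensated by the factor `1/ω` in
`sinScaled ω`, up to a factor `|t|` that accounts for small `ω`. -/
theorem abs_wflow_le_of_high {δ κ σ : ℝ} (hδ : 0 < δ) {S : Set ℝ} (hσ : σ ^ 2 = 1)
    (hr : δ ∈ S → 0 < σ * (δ - κ)) {μ t : ℝ} (h : ¬ μ < δ ^ 2) (ht : 0 ≤ σ * t) (j k : Fin 2) :
    |wflow δ S μ t j k| ≤ (1 + (1 + δ) * |δ - κ|⁻¹) * Real.exp (-κ * t) := by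
  have hμ : 0 ≤ μ := (sq_nonneg δ).trans (not_lt.1 h)
  set ω := √(μ - δ ^ 2) with hω
  set a := rateExp S δ t with ha
  have h1 := abs_rateExp_le (S := S) hσ hr ht
  have h2 := abs_mul_rateExp_le (S := S) hσ hr ht
  have hmain : ∀ x : ℝ, |x| ≤ 1 + (1 + δ) * |t| →
      |a * x| ≤ (1 + (1 + δ) * |δ - κ|⁻¹) * Real.exp (-κ * t) := by
    intro x hx
    rw [abs_mul]
    have := mul_le_mul_of_nonneg_left hx (abs_nonneg a)
    nlinarith
  have hs := abs_sinScaled_le ω t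
  have hsω : ω * |sinScaled ω t| ≤ 1 := by
    have hω0 : |ω| = ω := abs_of_nonneg (Real.sqrt_nonneg _)
    rw [← hω0, ← abs_mul, hω0, mul_sinScaled]
    exact Real.abs_sin_le_one _
  have hc := Real.abs_cos_le_one (ω * t)
  have hsq : ω ^ 2 = μ - δ ^ 2 := Real.sq_sqrt (by linarith)
  have hw : √(1 + μ) ≤ 1 + δ + ω := by
    rw [Real.sqrt_le_left (by positivity)]
    nlinarith [Real.sqrt_nonneg (μ - δ ^ 2), mul_nonneg hδ.le (Real.sqrt_nonneg (μ - δ ^ 2))]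
  have hs' : √(1 + μ) * |sinScaled ω t| ≤ 1 + (1 + δ) * |t| := by
    have e := mul_le_mul_of_nonneg_right hw (abs_nonneg (sinScaled ω t))
    have e2 := mul_le_mul_of_nonneg_left hs (show 0 ≤ 1 + δ by positivity)
    linarith
  have hδs : |δ * sinScaled ω t| ≤ δ * |t| := by rw [abs_mul, abs_of_pos hδ]; gcongr
  have ht0 := abs_nonneg t
  have hflow : flow δ S μ t = a • !![Real.cos (ω * t) + δ * sinScaled ω t, sinScaled ω t;
        -μ * sinScaled ω t, Real.cos (ω * t) - δ * sinScaled ω t] := by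
    rw [flow, if_neg h]
  have hentry : ∃ x, wflow δ S μ t j k = a * x ∧ |x| ≤ 1 + (1 + δ) * |t| := by
    rw [wflow, hflow]
    fin_cases j <;> fin_cases k
    · exact ⟨Real.cos (ω * t) + δ * sinScaled ω t, rfl, by
        linarith [abs_add_le (Real.cos (ω * t)) (δ * sinScaled ω t)]⟩
    · exact ⟨√(1 + μ) * sinScaled ω t, mul_left_comm _ _ _, by
        rwa [abs_mul, abs_of_nonneg (Real.sqrt_nonneg _)]⟩
    · refine ⟨(√(1 + μ))⁻¹ * (-μ * sinScaled ω t), mul_left_comm _ _ _, le_trans ?_ hs'⟩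
      rw [← mul_assoc, abs_mul]
      gcongr
      rw [abs_mul, abs_neg, abs_of_nonneg hμ, abs_of_nonneg (by positivity), inv_mul_eq_div,
        div_le_iff₀ (by positivity), Real.mul_self_sqrt (by positivity)]
      linarith
    · exact ⟨Real.cos (ω * t) - δ * sinScaled ω t, rfl, by
        linarith [abs_sub (Real.cos (ω * t)) (δ * sinScaled ω t)]⟩
  obtain ⟨x, hx, hx'⟩ := hentry
  rw [hx]
  exact hmain x hx'

theorem exists_abs_wflow_le_of_low {δ κ σ : ℝ} {S : Set ℝ} (hσ : σ ^ 2 = 1) {μ : ℝ}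
    (hr : ∀ r ∈ S, r ∈ modeRates δ μ → 0 < σ * (r - κ)) (h : μ < δ ^ 2) :
    ∃ C, 0 ≤ C ∧ ∀ t, 0 ≤ σ * t → ∀ j k, |wflow δ S μ t j k| ≤ C * Real.exp (-κ * t) := by
  have hentry : ∀ j k, ∃ c d : ℝ, ∀ t, wflow δ S μ t j k =
      c * rateExp S (δ + √(δ ^ 2 - μ)) t + d * rateExp S (δ - √(δ ^ 2 - μ)) t := by
    have hflow : ∀ j k, ∃ c d : ℝ, ∀ t, flow δ S μ t j k =
        c * rateExp S (δ + √(δ ^ 2 - μ)) t + d * rateExp S (δ - √(δ ^ 2 - μ)) t := by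
      simp only [flow, if_pos h]
      intro j k
      fin_cases j <;> fin_cases k <;> simp
      · exact ⟨-(δ - √(δ ^ 2 - μ)) / (2 * √(δ ^ 2 - μ)), (δ + √(δ ^ 2 - μ)) / (2 * √(δ ^ 2 - μ)),
          fun t => by ring⟩
      · exact ⟨-1 / (2 * √(δ ^ 2 - μ)), 1 / (2 * √(δ ^ 2 - μ)), fun t => by ring⟩
      · exact ⟨μ / (2 * √(δ ^ 2 - μ)), -μ / (2 * √(δ ^ 2 - μ)), fun t => by ring⟩
      · exact ⟨(δ + √(δ ^ 2 - μ)) / (2 * √(δ ^ 2 - μ)), -(δ - √(δ ^ 2 - μ)) / (2 * √(δ ^ 2 - μ)),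
          fun t => by ring⟩
    have hscale : ∀ (w : ℝ) j k, ∃ c d : ℝ, ∀ t, w * flow δ S μ t j k =
        c * rateExp S (δ + √(δ ^ 2 - μ)) t + d * rateExp S (δ - √(δ ^ 2 - μ)) t := by
      intro w j k
      obtain ⟨c, d, hcd⟩ := hflow j k
      exact ⟨w * c, w * d, fun t => by rw [hcd]; ring⟩
    intro j k
    fin_cases j <;> fin_cases k
    · exact hflow 0 0
    · exact hscale _ 0 1
    · exact hscale _ 1 0
    · exact hflow 1 1
  choose c d hcd using hentry
  refine ⟨∑ j, ∑ k, (|c j k| + |d j k|), by positivity, fun t ht j k => ?_⟩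
  have hrate : modeRates δ μ = {δ + √(δ ^ 2 - μ), δ - √(δ ^ 2 - μ)} := if_pos h
  have h1 := abs_rateExp_le (S := S) (r := δ + √(δ ^ 2 - μ)) hσ
    (fun hS => hr _ hS (by rw [hrate]; simp)) ht
  have h2 := abs_rateExp_le (S := S) (r := δ - √(δ ^ 2 - μ)) hσ
    (fun hS => hr _ hS (by rw [hrate]; simp)) ht
  have h3 : |c j k| + |d j k| ≤ ∑ j, ∑ k, (|c j k| + |d j k|) :=
    (Finset.single_le_sum (f := fun k => |c j k| + |d j k|) (fun _ _ => by positivity)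
      (Finset.mem_univ k)).trans
      (Finset.single_le_sum (f := fun j => ∑ k, (|c j k| + |d j k|)) (fun _ _ => by positivity)
        (Finset.mem_univ j))
  rw [hcd]
  calc _ ≤ |c j k| * |rateExp S (δ + √(δ ^ 2 - μ)) t| +
        |d j k| * |rateExp S (δ - √(δ ^ 2 - μ)) t| := by
        rw [← abs_mul, ← abs_mul]; exact abs_add_le _ _
    _ ≤ |c j k| * Real.exp (-κ * t) + |d j k| * Real.exp (-κ * t) := by gcongr
    _ = (|c j k| + |d j k|) * Real.exp (-κ * t) := by ring
    _ ≤ _ := by gcongr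

/-- If the selected rates all lie strictly above `κ` (for `σ = 1`, in forward time) or strictly
below `κ` (for `σ = -1`, in backward time), then the flow is bounded by `e^{-κt}`, uniformly over
all modes: below `δ²` there are only finitely many frequencies. -/
theorem exists_abs_wflow_le {ι : Type*} {ev : ι → ℝ} {δ κ σ : ℝ} (hδ : 0 < δ)
    (hfin : (Set.range ev ∩ Set.Iio (δ ^ 2)).Finite) {S : Set ℝ} (hσ : σ ^ 2 = 1)
    (hr : ∀ i, ∀ r ∈ S, r ∈ modeRates δ (ev i) → 0 < σ * (r - κ)) :
    ∃ C, 0 ≤ C ∧ ∀ i t, 0 ≤ σ * t → ∀ j k, |wflow δ S (ev i) t j k| ≤ C * Real.exp (-κ * t) := by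
  have hlow : ∀ μ ∈ Set.range ev ∩ Set.Iio (δ ^ 2), ∃ C, 0 ≤ C ∧ ∀ t, 0 ≤ σ * t →
      ∀ j k, |wflow δ S μ t j k| ≤ C * Real.exp (-κ * t) := by
    rintro _ ⟨⟨i, rfl⟩, h⟩
    exact exists_abs_wflow_le_of_low hσ (hr i) h
  choose! C hC0 hC using hlow
  set D := ∑ μ ∈ hfin.toFinset, C μ with hD
  have hD0 : 0 ≤ D := Finset.sum_nonneg fun μ hμ => hC0 μ (hfin.mem_toFinset.1 hμ)
  refine ⟨D + (1 + (1 + δ) * |δ - κ|⁻¹), by positivity, fun i t ht j k => ?_⟩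
  by_cases h : ev i < δ ^ 2
  · have hm : ev i ∈ Set.range ev ∩ Set.Iio (δ ^ 2) := ⟨⟨i, rfl⟩, h⟩
    refine (hC _ hm t ht j k).trans ?_
    gcongr
    have h1 : C (ev i) ≤ D := Finset.single_le_sum
      (fun μ hμ => hC0 μ (hfin.mem_toFinset.1 hμ)) (hfin.mem_toFinset.2 hm)
    have : 0 ≤ 1 + (1 + δ) * |δ - κ|⁻¹ := by positivity
    linarith
  · refine (abs_wflow_le_of_high hδ hσ (fun hS => hr i δ hS ?_) h ht j k).trans ?_
    · rw [modeRates, if_neg h]; rfl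
    · exact mul_le_mul_of_nonneg_right (by linarith) (Real.exp_pos _).le

/-- Every solution of the equation of a single mode is given by the flow. -/
theorem mode_unique {δ μ : ℝ} {x y : ℝ → ℝ}
    (hx : ∀ t, 0 ≤ t → HasDerivWithinAt x (y t) (Set.Ici 0) t)
    (hy : ∀ t, 0 ≤ t → HasDerivWithinAt y (-2 * δ * y t - μ * x t) (Set.Ici 0) t) {t : ℝ}
    (ht : 0 ≤ t) : ![x t, y t] = (flow δ Set.univ μ t).mulVec ![x 0, y 0] := by
  let v : ℝ × ℝ →L[ℝ] ℝ × ℝ := (ContinuousLinearMap.snd ℝ ℝ ℝ).prod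
    ((-2 * δ) • ContinuousLinearMap.snd ℝ ℝ ℝ - μ • ContinuousLinearMap.fst ℝ ℝ ℝ)
  let X : ℝ → ℝ := fun t => flow δ Set.univ μ t 0 0 * x 0 + flow δ Set.univ μ t 0 1 * y 0
  let Y : ℝ → ℝ := fun t => flow δ Set.univ μ t 1 0 * x 0 + flow δ Set.univ μ t 1 1 * y 0
  have hX : ∀ t, HasDerivAt X (Y t) t := fun t =>
    ((hasDerivAt_flow_zero _ _ _ _ _).mul_const _).add
      ((hasDerivAt_flow_zero _ _ _ _ _).mul_const _)
  have hY : ∀ t, HasDerivAt Y (-2 * δ * Y t - μ * X t) t := fun t =>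
    (((hasDerivAt_flow_one _ _ _ _ _).mul_const _).add
      ((hasDerivAt_flow_one _ _ _ _ _).mul_const _)).congr_deriv (by simp only [X, Y]; ring)
  have key := ODE_solution_unique_of_mem_Icc_right (v := fun _ => v) (s := fun _ => Set.univ)
    (K := ‖v‖₊) (f := fun t => (x t, y t)) (g := fun t => (X t, Y t)) (a := 0) (b := t)
    (fun s _ => v.lipschitz.lipschitzOnWith)
    (fun s hs => (((hx s hs.1).continuousWithinAt.prodMk (hy s hs.1).continuousWithinAt).mono
      Set.Icc_subset_Ici_self))
    (fun s hs => ((hx s hs.1).prodMk (hy s hs.1)).mono (Set.Ici_subset_Ici.2 hs.1))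
    (fun _ _ => Set.mem_univ _)
    (fun s _ => ((hX s).continuousAt.prodMk (hY s).continuousAt).continuousWithinAt)
    (fun s _ => ((hX s).prodMk (hY s)).hasDerivWithinAt)
    (fun _ _ => Set.mem_univ _)
    (by simp [X, Y, flow_univ_zero]) (Set.right_mem_Icc.2 ht)
  have h1 : x t = X t := congrArg Prod.fst key
  have h2 : y t = Y t := congrArg Prod.snd key
  rw [h1, h2]
  ext j
  fin_cases j <;> simp [X, Y, Matrix.mulVec, dotProduct, Fin.sum_univ_two]

end DampedWave

namespace DampedWave

/-! ### The spaces of modes in coordinates -/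

theorem flow_zero_mulVec_of_rate {δ r : ℝ} {S : Set ℝ} (hr : r ∈ S) (hrδ : r ≠ δ) (x : ℝ) :
    (flow δ S (2 * δ * r - r ^ 2) 0).mulVec ![x, -r * x] = ![x, -r * x] := by
  have hlt : 2 * δ * r - r ^ 2 < δ ^ 2 := by
    have := sq_pos_of_ne_zero (sub_ne_zero.2 hrδ)
    nlinarith
  have hβ : √(δ ^ 2 - (2 * δ * r - r ^ 2)) = |r - δ| := by
    rw [← Real.sqrt_sq_eq_abs]; congr 1; ring
  have h1 : rateExp S r 0 = 1 := by simp [rateExp, hr]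
  unfold flow
  rw [if_pos hlt]
  simp only [hβ]
  rcases lt_or_gt_of_ne hrδ with h | h
  · have h0 : δ - r ≠ 0 := by linarith
    rw [abs_of_neg (by linarith)]
    have e1 : δ - -(r - δ) = r := by ring
    rw [e1, h1]
    ext j
    fin_cases j <;> simp [Matrix.mulVec, dotProduct, Fin.sum_univ_two] <;> field_simp <;> ring
  · have h0 : r - δ ≠ 0 := by linarith
    rw [abs_of_pos (by linarith)]
    have e1 : δ + (r - δ) = r := by ring
    rw [e1, h1]
    ext j
    fin_cases j <;> simp [Matrix.mulVec, dotProduct, Fin.sum_univ_two] <;> field_simp <;> ring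

theorem flow_zero_of_high {δ μ : ℝ} {S : Set ℝ} (hμ : ¬ μ < δ ^ 2) :
    flow δ S μ 0 = rateExp S δ 0 • (1 : Matrix (Fin 2) (Fin 2) ℝ) := by
  unfold flow
  rw [if_neg hμ, Matrix.one_fin_two]
  simp [sinScaled_zero]

variable {H : Type*} [NormedAddCommGroup H] [InnerProductSpace ℝ H]
  {A : H →ₗ.[ℝ] H} {ι : Type*}

theorem EigenBasis.modeRates_subset (B : EigenBasis A ι) (δ : ℝ) (i : ι) :
    modeRates δ (B.ev i) ⊆ decayRates A δ := by
  intro r hr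
  refine ⟨B.ev i, B.mem_spectrum i, ?_⟩
  unfold modeRates at hr
  split_ifs at hr with h
  · have hsq : √(δ ^ 2 - B.ev i) ^ 2 = δ ^ 2 - B.ev i := Real.sq_sqrt (by linarith)
    refine ⟨(r : ℂ), ?_, Complex.ofReal_re r⟩
    have : r ^ 2 - 2 * δ * r + B.ev i = 0 := by
      rcases hr with rfl | rfl <;> linear_combination hsq
    exact_mod_cast this
  · have hsq : √(B.ev i - δ ^ 2) ^ 2 = B.ev i - δ ^ 2 := Real.sq_sqrt (by linarith)
    have hsq' : ((√(B.ev i - δ ^ 2) : ℝ) : ℂ) ^ 2 = (B.ev i : ℂ) - (δ : ℂ) ^ 2 := by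
      exact_mod_cast hsq
    refine ⟨(δ : ℂ) + (√(B.ev i - δ ^ 2) : ℝ) * Complex.I, ?_, ?_⟩
    · linear_combination (-1 : ℂ) * hsq' + ((√(B.ev i - δ ^ 2) : ℝ) : ℂ) ^ 2 * Complex.I_sq
    · rw [Set.mem_singleton_iff.1 hr]; simp

theorem EigenBasis.finite_low (B : EigenBasis A ι) (hspec : HasDiscreteSpectrum A) (c : ℝ) :
    (Set.range B.ev ∩ Set.Iio c).Finite := by
  by_contra hinf
  obtain ⟨x, -, hx⟩ := Set.Infinite.exists_accPt_of_subset_isCompact hinf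
    (isCompact_Icc (a := 0) (b := c)) (by
      rintro _ ⟨⟨i, rfl⟩, h⟩
      exact ⟨B.nonneg i, le_of_lt h⟩)
  refine hspec.no_accPt x (hx.mono (Filter.principal_mono.2 ?_))
  rintro _ ⟨⟨i, rfl⟩, -⟩
  exact B.mem_spectrum i

variable [CompleteSpace H]

/-- The coordinates of a pair `(x, y)` in `D(A^{1/2}) × H` along the `i`-th eigenvector. -/
def EigenBasis.pair (B : EigenBasis A ι) (U : EnergySpace A × H) (i : ι) : Fin 2 → ℝ :=
  ![⟪B.basis i, incl U.1⟫_ℝ, ⟪B.basis i, U.2⟫_ℝ]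

theorem EigenBasis.pair_add (B : EigenBasis A ι) (U V : EnergySpace A × H) (i : ι) :
    B.pair (U + V) i = B.pair U i + B.pair V i := by
  have : incl (U.1 + V.1) = incl U.1 + incl V.1 := rfl
  ext j
  fin_cases j <;> simp [pair, this, inner_add_right]

theorem EigenBasis.pair_smul (B : EigenBasis A ι) (c : ℝ) (U : EnergySpace A × H) (i : ι) :
    B.pair (c • U) i = c • B.pair U i := by
  have : incl (c • U.1) = c • incl U.1 := rfl
  ext j
  fin_cases j <;> simp [pair, this, inner_smul_right]

theorem EigenBasis.pair_zero (B : EigenBasis A ι) (i : ι) :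
    B.pair (0 : EnergySpace A × H) i = 0 := by
  simpa using B.pair_smul 0 0 i

theorem EigenBasis.pair_sub (B : EigenBasis A ι) (U V : EnergySpace A × H) (i : ι) :
    B.pair (U - V) i = B.pair U i - B.pair V i := by
  rw [sub_eq_add_neg, ← neg_one_smul ℝ V, pair_add, pair_smul, neg_one_smul, sub_eq_add_neg]

theorem EigenBasis.pair_sum (B : EigenBasis A ι) {κ : Type*} (s : Finset κ)
    (U : κ → EnergySpace A × H) (i : ι) : B.pair (∑ k ∈ s, U k) i = ∑ k ∈ s, B.pair (U k) i := by
  classical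
  induction s using Finset.induction_on with
  | empty => simp [pair_zero]
  | insert k s hk ih => rw [Finset.sum_insert hk, Finset.sum_insert hk, pair_add, ih]

theorem EigenBasis.pair_ext (B : EigenBasis A ι) (hA : IsSelfAdjoint A) {U V : EnergySpace A × H}
    (h : ∀ i, B.pair U i = B.pair V i) : U = V :=
  Prod.ext (B.energy_ext hA fun i => congrFun (h i) 0)
    (ext_inner_basis B.basis fun i => congrFun (h i) 1)

theorem EigenBasis.continuous_pair (B : EigenBasis A ι) (i : ι) :
    Continuous fun U : EnergySpace A × H => B.pair U i := by
  refine continuous_pi fun j => ?_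
  fin_cases j
  · exact (continuous_const.inner ((inclL A).continuous.comp continuous_fst))
  · exact continuous_const.inner continuous_snd

/-- The pairs all of whose coordinates only have rates in `S`, that is, lie in the range of the
projection `flow δ S μ 0`. -/
def EigenBasis.ratesSubmodule (B : EigenBasis A ι) (δ : ℝ) (S : Set ℝ) :
    Submodule ℝ (EnergySpace A × H) where
  carrier := {U | ∀ i, (flow δ S (B.ev i) 0).mulVec (B.pair U i) = B.pair U i}
  zero_mem' := fun i => by rw [B.pair_zero, Matrix.mulVec_zero]
  add_mem' := fun hU hV i => by rw [B.pair_add, Matrix.mulVec_add, hU i, hV i]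
  smul_mem' := fun c U hU i => by rw [B.pair_smul, Matrix.mulVec_smul, hU i]

theorem EigenBasis.isClosed_ratesSubmodule (B : EigenBasis A ι) (δ : ℝ) (S : Set ℝ) :
    IsClosed (B.ratesSubmodule δ S : Set (EnergySpace A × H)) := by
  have : (B.ratesSubmodule δ S : Set (EnergySpace A × H)) =
      ⋂ i, {U | (flow δ S (B.ev i) 0).mulVec (B.pair U i) = B.pair U i} := by
    ext U; simp [ratesSubmodule]
  rw [this]
  exact isClosed_iInter fun i => isClosed_eq
    (continuous_const.matrix_mulVec (B.continuous_pair i)) (B.continuous_pair i)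

theorem EigenBasis.modeSum_le (B : EigenBasis A ι) (hA : IsSelfAdjoint A) (δ : ℝ) (S : Set ℝ) :
    modeSum A δ S ≤ B.ratesSubmodule δ S := by
  refine iSup₂_le fun r hr => ?_
  unfold modeSpace
  split_ifs with hrδ
  · subst hrδ
    refine Submodule.topologicalClosure_minimal _ (Submodule.span_le.2 ?_)
      (B.isClosed_ratesSubmodule _ _)
    rintro U ⟨μ, -, hμ, h1, h2⟩ i
    rcases eq_or_ne (B.ev i) μ with rfl | hne
    · have : rateExp S r 0 = 1 := by simp [rateExp, hr.2]
      rw [flow_zero_of_high (not_lt.2 hμ), this, one_smul, Matrix.one_mulVec]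
    · have : B.pair U i = 0 := by
        rw [pair, B.inner_eq_zero hA h1 hne, B.inner_eq_zero hA h2 hne]; simp
      rw [this, Matrix.mulVec_zero]
  · rintro U ⟨h1, hd, h2⟩ i
    set x := ⟪B.basis i, incl U.1⟫_ℝ with hx
    have hy : ⟪B.basis i, U.2⟫_ℝ = -r * x := by
      have := congrArg (fun z => ⟪B.basis i, z⟫_ℝ) h1
      simp only [inner_neg_right, inner_smul_right] at this
      linarith
    obtain ⟨hb, e⟩ := B.mem_eigenspace i
    have hAx : ⟪B.basis i, A ⟨incl U.1, hd⟩⟫_ℝ = B.ev i * x := by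
      rw [← symmetric_of_isSelfAdjoint hA ⟨_, hb⟩, e, inner_smul_left]; rfl
    have h3 := congrArg (fun z => ⟪B.basis i, z⟫_ℝ) h2
    simp only [inner_add_right, inner_smul_right, hAx, hy] at h3
    have h4 : (B.ev i - (2 * δ * r - r ^ 2)) * x = 0 := by linarith
    have hp : B.pair U i = ![x, -r * x] := by rw [pair, hy]
    rw [hp]
    rcases mul_eq_zero.1 h4 with h | h
    · rw [sub_eq_zero.1 h]
      exact flow_zero_mulVec_of_rate hr.2 hrδ x
    · rw [h]
      have : ![(0 : ℝ), -r * 0] = 0 := by simp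
      rw [this, Matrix.mulVec_zero]

theorem EigenBasis.exists_incl_eq (B : EigenBasis A ι) (hA : IsSelfAdjoint A) {μ : ℝ} (hμ : 0 ≤ μ)
    {ξ : H} (hξ : ξ ∈ eigenspace A μ) : ∃ x : EnergySpace A, incl x = ξ := by
  obtain ⟨E, hE⟩ := B.exists_energyEquiv hA
  refine ⟨E (√(1 + μ) • ξ), ext_inner_basis B.basis fun i => ?_⟩
  rw [hE, inner_smul_right]
  rcases eq_or_ne (B.ev i) μ with rfl | hne
  · rw [inv_mul_cancel_left₀ (Real.sqrt_pos.2 (by linarith)).ne']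
  · rw [B.inner_eq_zero hA hξ hne]; simp

/-- An element `ξ` of the eigenspace of `A` for the eigenvalue `2δr - r² < δ²` gives the pair
`(ξ, -rξ)` in the space of the modes with rate `r`. -/
theorem EigenBasis.exists_mem_modeSum (B : EigenBasis A ι) (hA : IsSelfAdjoint A) {δ r : ℝ}
    {S : Set ℝ} {i₀ : ι} (hr : r ∈ S) (hrate : r ∈ modeRates δ (B.ev i₀)) (hlt : B.ev i₀ < δ ^ 2)
    {ξ : H} (hξ : ξ ∈ eigenspace A (B.ev i₀)) :
    ∃ V ∈ modeSum A δ S, ∀ i, B.pair V i = ![⟪B.basis i, ξ⟫_ℝ, -r * ⟪B.basis i, ξ⟫_ℝ] := by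
  obtain ⟨x, hx⟩ := B.exists_incl_eq hA (B.nonneg i₀) hξ
  refine ⟨(x, -r • ξ), ?_, fun i => ?_⟩
  · have hsq : √(δ ^ 2 - B.ev i₀) ^ 2 = δ ^ 2 - B.ev i₀ := Real.sq_sqrt (by linarith)
    have hpos : 0 < √(δ ^ 2 - B.ev i₀) := Real.sqrt_pos.2 (by linarith)
    have hr' : r = δ + √(δ ^ 2 - B.ev i₀) ∨ r = δ - √(δ ^ 2 - B.ev i₀) := by
      rwa [modeRates, if_pos hlt] at hrate
    have hne : r ≠ δ := by rcases hr' with h | h <;> rw [h] <;> intro h' <;> linarith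
    have hμ : B.ev i₀ = 2 * δ * r - r ^ 2 := by
      rcases hr' with h | h <;> rw [h] <;> linear_combination hsq
    refine (le_iSup₂_of_le (f := fun r (_ : r ∈ decayRates A δ ∩ S) => modeSpace A δ r) r
      ⟨B.modeRates_subset δ i₀ hrate, hr⟩ le_rfl) ?_
    rw [modeSpace, if_neg hne]
    obtain ⟨hd, e⟩ := hξ
    subst hx
    refine ⟨by simp, hd, ?_⟩
    change A ⟨incl x, hd⟩ + (2 * δ) • (-r • incl x) = r • (-r • incl x)
    rw [e, smul_smul, smul_smul, ← add_smul]
    congr 1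
    rw [hμ]; ring
  · rw [pair, hx, inner_smul_right]

/-- The component of a pair along the eigenspace of an eigenvalue below `δ²`. -/
theorem EigenBasis.exists_low_component (B : EigenBasis A ι) (hA : IsSelfAdjoint A) {δ : ℝ}
    {S : Set ℝ} {U : EnergySpace A × H} (hU : U ∈ B.ratesSubmodule δ S) {i₀ : ι}
    (hlt : B.ev i₀ < δ ^ 2) :
    ∃ V ∈ modeSum A δ S, ∀ i, (B.ev i = B.ev i₀ → B.pair V i = B.pair U i) ∧
      (B.ev i ≠ B.ev i₀ → B.pair V i = 0) := by
  classical
  set μ := B.ev i₀ with hμ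
  have hpos : 0 < √(δ ^ 2 - μ) := Real.sqrt_pos.2 (by linarith)
  have hsq : √(δ ^ 2 - μ) ^ 2 = δ ^ 2 - μ := Real.sq_sqrt (by linarith)
  set β := √(δ ^ 2 - μ) with hβ
  let φ : ι → ℝ := fun i => if B.ev i = μ then 1 else 0
  have hφ : ∀ i, |φ i| ≤ 1 := fun i => by
    simp only [φ]; split_ifs <;> simp
  have hmem : ∀ z : H, diag B.basis φ z ∈ eigenspace A μ := fun z =>
    B.mem_eigenspace_of_forall hA fun i hi => by
      rw [inner_diag _ hφ]; simp [φ, hi]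
  have hrates : modeRates δ μ = {δ + β, δ - β} := by rw [modeRates, if_pos hlt]
  -- The component along `(1, -r)` is present only if `r ∈ S`.
  have hcomp : ∀ r ∈ modeRates δ μ, ∀ z : H, ∃ V ∈ modeSum A δ S, ∀ i, B.pair V i =
      ![φ i * rateExp S r 0 * ⟪B.basis i, z⟫_ℝ, -r * (φ i * rateExp S r 0 * ⟪B.basis i, z⟫_ℝ)] := by
    intro r hr z
    by_cases hS : r ∈ S
    · obtain ⟨V, hV, hV'⟩ := B.exists_mem_modeSum hA hS hr hlt (hmem z)
      refine ⟨V, hV, fun i => ?_⟩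
      have : rateExp S r 0 = 1 := by simp [rateExp, hS]
      rw [hV', inner_diag _ hφ, this, mul_one]
    · refine ⟨0, Submodule.zero_mem _, fun i => ?_⟩
      have : rateExp S r 0 = 0 := by simp [rateExp, hS]
      rw [B.pair_zero, this]
      ext j
      fin_cases j <;> simp
  obtain ⟨V, hV, hV'⟩ := hcomp (δ + β) (by rw [hrates]; simp)
    ((-(2 * β)⁻¹) • ((δ - β) • incl U.1 + U.2))
  obtain ⟨W, hW, hW'⟩ := hcomp (δ - β) (by rw [hrates]; simp)
    (((2 * β)⁻¹) • ((δ + β) • incl U.1 + U.2))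
  refine ⟨V + W, Submodule.add_mem _ hV hW, fun i => ⟨fun hi => ?_, fun hi => ?_⟩⟩
  · have h1 := hU i
    rw [hi] at h1
    have hφi : φ i = 1 := by simp [φ, hi]
    rw [B.pair_add, hV', hW', hφi, ← h1, flow, if_pos hlt]
    simp only [← hβ, inner_smul_right, inner_add_right]
    have hμ' : μ = δ ^ 2 - β ^ 2 := by linarith
    rw [pair, hμ']
    ext j
    fin_cases j <;> simp [Matrix.mulVec, dotProduct, Fin.sum_univ_two] <;> field_simp <;> ring
  · have hφi : φ i = 0 := by simp [φ, hi]
    rw [B.pair_add, hV', hW', hφi]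
    simp

/-- A pair without components below `δ²` is a limit of finite sums of pairs of eigenvectors, all of
which belong to the rate `δ`. -/
theorem EigenBasis.mem_modeSum_of_high (B : EigenBasis A ι) (hA : IsSelfAdjoint A) {δ : ℝ}
    {S : Set ℝ} {U : EnergySpace A × H} (hU : U ∈ B.ratesSubmodule δ S)
    (hhigh : ∀ i, B.ev i < δ ^ 2 → B.pair U i = 0) : U ∈ modeSum A δ S := by
  by_cases hex : δ ∈ S ∧ ∃ i, ¬ B.ev i < δ ^ 2
  · obtain ⟨hS, i₀, hi₀⟩ := hex
    have hD : δ ∈ decayRates A δ := B.modeRates_subset δ i₀ (by rw [modeRates, if_neg hi₀]; rfl)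
    refine (le_iSup₂_of_le (f := fun r (_ : r ∈ decayRates A δ ∩ S) => modeSpace A δ r) δ
      ⟨hD, hS⟩ le_rfl) ?_
    rw [modeSpace, if_pos rfl]
    obtain ⟨E, hE⟩ := B.exists_energyEquiv hA
    have h1 : HasSum (fun i => E (B.basis.repr (E.symm U.1) i • B.basis i)) U.1 := by
      have := (B.basis.hasSum_repr (E.symm U.1)).mapL
        (E.toContinuousLinearEquiv : H →L[ℝ] EnergySpace A)
      simpa using this
    have h2 := h1.prodMk (B.basis.hasSum_repr U.2)
    refine (Submodule.isClosed_topologicalClosure _).mem_of_tendsto h2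
      (Filter.Eventually.of_forall fun s => Submodule.sum_mem _ fun i _ => ?_)
    refine Submodule.le_topologicalClosure _ ?_
    have hincl : incl (E (B.basis.repr (E.symm U.1) i • B.basis i)) =
        ⟪B.basis i, incl U.1⟫_ℝ • B.basis i := by
      have hU1 := hE (E.symm U.1) i
      rw [E.apply_symm_apply] at hU1
      refine ext_inner_basis B.basis fun k => ?_
      rw [hE, inner_smul_right, inner_smul_right, B.basis.repr_apply_apply, hU1]
      rcases eq_or_ne k i with rfl | hk
      · ring
      · rw [B.basis.orthonormal.2 hk]; ring
    by_cases hi : B.ev i < δ ^ 2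
    · have hp := hhigh i hi
      have hp0 : ⟪B.basis i, incl U.1⟫_ℝ = 0 := congrFun hp 0
      have hp1 : ⟪B.basis i, U.2⟫_ℝ = 0 := congrFun hp 1
      have hz : ((E (B.basis.repr (E.symm U.1) i • B.basis i), B.basis.repr U.2 i • B.basis i) :
          EnergySpace A × H) = 0 := by
        have hy : B.basis.repr U.2 i = 0 := by rw [B.basis.repr_apply_apply, hp1]
        rw [hp0, zero_smul] at hincl
        refine Prod.ext (B.energy_ext hA fun k => ?_) (by rw [hy, zero_smul]; rfl)
        rw [hincl]
        rfl
      rw [hz]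
      exact Submodule.zero_mem _
    · refine Submodule.subset_span ⟨B.ev i, B.mem_spectrum i, not_lt.1 hi, ?_, ?_⟩
      · rw [hincl]; exact Submodule.smul_mem _ _ (B.mem_eigenspace i)
      · exact Submodule.smul_mem _ _ (B.mem_eigenspace i)
  · have : U = 0 := by
      refine B.pair_ext hA fun i => ?_
      rw [B.pair_zero]
      by_cases hi : B.ev i < δ ^ 2
      · exact hhigh i hi
      · have hS : δ ∉ S := fun hS => hex ⟨hS, i, hi⟩
        have h0 : rateExp S δ 0 = 0 := by simp [rateExp, hS]
        rw [← hU i, flow_zero_of_high hi, h0, zero_smul, Matrix.zero_mulVec]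
    rw [this]
    exact Submodule.zero_mem _

/-- The sum of the mode spaces with rates in `S` is described by conditions on the coordinates.
Only finitely many eigenvalues lie below `δ²`, and the others are collected in the single space for
the rate `δ`; so no closure of the sum is needed. -/
theorem EigenBasis.modeSum_eq (B : EigenBasis A ι) (hA : IsSelfAdjoint A) (δ : ℝ)
    (hfin : (Set.range B.ev ∩ Set.Iio (δ ^ 2)).Finite) (S : Set ℝ) :
    modeSum A δ S = B.ratesSubmodule δ S := by
  refine le_antisymm (B.modeSum_le hA δ S) fun U hU => ?_
  have hlow : ∀ μ ∈ Set.range B.ev ∩ Set.Iio (δ ^ 2), ∃ V ∈ modeSum A δ S,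
      ∀ i, (B.ev i = μ → B.pair V i = B.pair U i) ∧ (B.ev i ≠ μ → B.pair V i = 0) := by
    rintro _ ⟨⟨i₀, rfl⟩, h⟩
    exact B.exists_low_component hA hU h
  choose! V hV hV' using hlow
  set W := ∑ μ ∈ hfin.toFinset, V μ with hW
  have hWm : W ∈ modeSum A δ S := Submodule.sum_mem _ fun μ hμ => hV μ (hfin.mem_toFinset.1 hμ)
  have hUW : U - W ∈ modeSum A δ S := by
    refine B.mem_modeSum_of_high hA
      (Submodule.sub_mem _ hU (B.modeSum_le hA δ S hWm)) fun i hi => ?_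
    have hm : B.ev i ∈ Set.range B.ev ∩ Set.Iio (δ ^ 2) := ⟨⟨i, rfl⟩, hi⟩
    rw [B.pair_sub, hW, B.pair_sum, Finset.sum_eq_single_of_mem (B.ev i)
      (hfin.mem_toFinset.2 hm) (fun μ hμ hne => (hV' μ (hfin.mem_toFinset.1 hμ) i).2 hne.symm),
      (hV' _ hm i).1 rfl, sub_self]
  simpa using Submodule.add_mem _ hUW hWm

end DampedWave

namespace DampedWave

/-! ### Crude bounds and continuity of the flow -/

variable {H : Type*} [NormedAddCommGroup H] [InnerProductSpace ℝ H]
  {A : H →ₗ.[ℝ] H} {ι : Type*}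

theorem modeRates_nonneg {δ μ r : ℝ} (hδ : 0 < δ) (hμ : 0 ≤ μ) (hr : r ∈ modeRates δ μ) :
    0 ≤ r ∧ r ≤ 2 * δ := by
  unfold modeRates at hr
  split_ifs at hr with h
  · have h1 : √(δ ^ 2 - μ) ≤ δ := (Real.sqrt_le_left hδ.le).2 (by linarith)
    have h2 := Real.sqrt_nonneg (δ ^ 2 - μ)
    rcases hr with rfl | rfl <;> constructor <;> linarith
  · rw [Set.mem_singleton_iff.1 hr]; constructor <;> linarith

/-- Crude bounds, valid for any selection of rates and all times: all rates lie in `[0, 2δ]`. -/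
theorem EigenBasis.exists_abs_wflow_le_exp_abs (B : EigenBasis A ι)
    (hspec : HasDiscreteSpectrum A) {δ : ℝ} (hδ : 0 < δ) (S : Set ℝ) :
    ∃ C, 0 ≤ C ∧ ∀ i t, ∀ j k,
      |wflow δ S (B.ev i) t j k| ≤ C * Real.exp ((2 * δ + 1) * |t|) := by
  obtain ⟨C, hC, h1⟩ := exists_abs_wflow_le (κ := -1) (σ := 1) hδ (B.finite_low hspec _) (S := S)
    (by norm_num) (fun i r _ hr => by linarith [(modeRates_nonneg hδ (B.nonneg i) hr).1])
  obtain ⟨D, hD, h2⟩ := exists_abs_wflow_le (κ := 2 * δ + 1) (σ := -1) hδ (B.finite_low hspec _)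
    (S := S) (by norm_num) (fun i r _ hr => by linarith [(modeRates_nonneg hδ (B.nonneg i) hr).2])
  refine ⟨C + D, by positivity, fun i t j k => ?_⟩
  rcases le_total 0 t with ht | ht
  · refine (h1 i t (by linarith) j k).trans ?_
    rw [abs_of_nonneg ht]
    have : 0 ≤ δ * t := by positivity
    gcongr
    · linarith
    · linarith
  · refine (h2 i t (by linarith) j k).trans ?_
    rw [abs_of_nonpos ht, show -(2 * δ + 1) * t = (2 * δ + 1) * -t by ring]
    gcongr
    linarith

theorem continuous_flow (δ : ℝ) (S : Set ℝ) (μ : ℝ) (j k : Fin 2) :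
    Continuous fun t => flow δ S μ t j k := by
  fin_cases j
  · exact continuous_iff_continuousAt.2 fun t => (hasDerivAt_flow_zero δ S μ t k).continuousAt
  · exact continuous_iff_continuousAt.2 fun t => (hasDerivAt_flow_one δ S μ t k).continuousAt

theorem continuous_wflow (δ : ℝ) (S : Set ℝ) (μ : ℝ) (j k : Fin 2) :
    Continuous fun t => wflow δ S μ t j k := by
  fin_cases j <;> fin_cases k
  · exact continuous_flow δ S μ 0 0
  · exact continuous_const.mul (continuous_flow δ S μ 0 1)
  · exact continuous_const.mul (continuous_flow δ S μ 1 0)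
  · exact continuous_flow δ S μ 1 1

theorem EigenBasis.continuous_diag_wflow (B : EigenBasis A ι) (hspec : HasDiscreteSpectrum A)
    {δ : ℝ} (hδ : 0 < δ) (S : Set ℝ) (j k : Fin 2) {τ : ℝ → ℝ} {g : ℝ → H} (hτ : Continuous τ)
    (hg : Continuous g) :
    Continuous fun t => diag B.basis (fun i => wflow δ S (B.ev i) (τ t) j k) (g t) := by
  obtain ⟨C, hC, h⟩ := B.exists_abs_wflow_le_exp_abs hspec hδ S
  refine continuous_iff_continuousAt.2 fun t₀ => ?_
  refine continuousAt_diag (C := C * Real.exp ((2 * δ + 1) * (|τ t₀| + 1))) B.basis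
    (by positivity) (fun i => ((continuous_wflow δ S _ j k).comp hτ).continuousAt) ?_
    hg.continuousAt
  have : ∀ᶠ t in 𝓝 t₀, |τ t| < |τ t₀| + 1 :=
    (hτ.abs.continuousAt (x := t₀)).eventually (gt_mem_nhds (lt_add_one _))
  filter_upwards [this] with t ht i
  refine (h i _ j k).trans ?_
  gcongr

/-! ### Linear solutions in coordinates -/

variable [CompleteSpace H]

theorem integral_eq_sub_of_hasDerivWithinAt_Ici {f f' : ℝ → ℝ}
    (hf : ∀ t, 0 ≤ t → HasDerivWithinAt f (f' t) (Set.Ici 0) t) (hf' : Continuous f') {t : ℝ}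
    (ht : 0 ≤ t) : ∫ s in (0 : ℝ)..t, f' s = f t - f 0 :=
  intervalIntegral.integral_eq_sub_of_hasDerivAt_of_le ht
    (fun s hs => (hf s hs.1).continuousWithinAt.mono Set.Icc_subset_Ici_self)
    (fun s hs => (hf s hs.1.le).hasDerivAt (Ici_mem_nhds hs.1))
    (hf'.intervalIntegrable _ _)

theorem inner_intervalIntegral {y : ℝ → H} (hy : Continuous y) (b : H) (t : ℝ) :
    ⟪b, ∫ s in (0 : ℝ)..t, y s⟫_ℝ = ∫ s in (0 : ℝ)..t, ⟪b, y s⟫_ℝ :=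
  ((innerSL ℝ b).intervalIntegral_comp_comm (hy.intervalIntegrable 0 t)).symm

/-- Continuous functions whose coordinates solve the equations of the single modes are weak
solutions of the linear equation. -/
theorem EigenBasis.isLinearSolution (B : EigenBasis A ι) (hA : IsSelfAdjoint A) {δ : ℝ}
    {x : ℝ → EnergySpace A} {y g : ℝ → H} (hx : Continuous x) (hy : Continuous y)
    (hg : Continuous g)
    (h1 : ∀ i t, 0 ≤ t → HasDerivWithinAt (fun t => ⟪B.basis i, incl (x t)⟫_ℝ)
      ⟪B.basis i, y t⟫_ℝ (Set.Ici 0) t)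
    (h2 : ∀ i t, 0 ≤ t → HasDerivWithinAt (fun t => ⟪B.basis i, y t⟫_ℝ)
      (⟪B.basis i, g t⟫_ℝ - 2 * δ * ⟪B.basis i, y t⟫_ℝ - B.ev i * ⟪B.basis i, incl (x t)⟫_ℝ)
      (Set.Ici 0) t) :
    IsLinearSolution A δ g x ∧ ∀ t, 0 ≤ t → velocity x t = y t := by
  have hix : Continuous fun t => incl (x t) := (inclL A).continuous.comp hx
  have hsx : Continuous fun t => sqrtMap (x t) := (sqrtL A).continuous.comp hx
  have hF : ∀ t, 0 ≤ t → incl (x t) = incl (x 0) + ∫ s in (0 : ℝ)..t, y s := by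
    intro t ht
    refine ext_inner_basis B.basis fun i => ?_
    rw [inner_add_right, inner_intervalIntegral hy,
      integral_eq_sub_of_hasDerivWithinAt_Ici (h1 i) (by fun_prop) ht]
    ring
  have hFd : ∀ t, HasDerivAt (fun t => incl (x 0) + ∫ s in (0 : ℝ)..t, y s) (y t) t := fun t =>
    (hy.integral_hasStrictDerivAt 0 t).hasDerivAt.const_add _
  have hvel : ∀ t, 0 ≤ t → velocity x t = y t := by
    intro t ht
    have : HasDerivWithinAt (fun s => incl (x s)) (y t) (Set.Ici 0) t :=
      (hFd t).hasDerivWithinAt.congr (fun s hs => hF s hs) (hF t ht)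
    exact this.derivWithin (uniqueDiffOn_Ici 0 t ht)
  refine ⟨⟨hx.continuousOn, ?_, ?_⟩, hvel⟩
  · have : ContDiff ℝ 1 (fun t => incl (x 0) + ∫ s in (0 : ℝ)..t, y s) := by
      rw [contDiff_one_iff_deriv]
      refine ⟨fun t => (hFd t).differentiableAt, ?_⟩
      rw [funext fun t => (hFd t).deriv]
      exact hy
    exact this.contDiffOn.congr fun t ht => hF t ht
  · intro φ t ht
    -- The weak equation is first verified in integrated form, coordinate by coordinate.
    have hgy : Continuous fun s => g s - (2 * δ) • y s := by fun_prop
    have hw : ∀ t, 0 ≤ t → ⟪y t, incl φ⟫_ℝ =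
        ⟪y 0 + ∫ s in (0 : ℝ)..t, (g s - (2 * δ) • y s), incl φ⟫_ℝ -
          ⟪∫ s in (0 : ℝ)..t, sqrtMap (x s), sqrtMap φ⟫_ℝ := by
      intro t ht
      rw [eq_sub_iff_add_eq, ← sub_eq_zero, add_sub_right_comm, ← inner_sub_left,
        ← B.basis.tsum_inner_mul_inner, ← B.basis.tsum_inner_mul_inner,
        ← (B.basis.summable_inner_mul_inner _ _).tsum_add (B.basis.summable_inner_mul_inner _ _)]
      rw [tsum_congr, tsum_zero]
      intro i
      have e1 := integral_eq_sub_of_hasDerivWithinAt_Ici (h2 i) (by fun_prop) ht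
      have e2 : ⟪B.basis i, ∫ s in (0 : ℝ)..t, (g s - (2 * δ) • y s)⟫_ℝ =
          (∫ s in (0 : ℝ)..t, (⟪B.basis i, g s⟫_ℝ - 2 * δ * ⟪B.basis i, y s⟫_ℝ)) := by
        rw [inner_intervalIntegral hgy]
        simp only [inner_sub_right, inner_smul_right]
      have e3 : ⟪B.basis i, ∫ s in (0 : ℝ)..t, sqrtMap (x s)⟫_ℝ =
          √(B.ev i) * ∫ s in (0 : ℝ)..t, ⟪B.basis i, incl (x s)⟫_ℝ := by
        rw [inner_intervalIntegral hsx, ← intervalIntegral.integral_const_mul]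
        simp only [B.inner_sqrtMap hA]
      rw [intervalIntegral.integral_sub (Continuous.intervalIntegrable (by fun_prop) _ _)
        (Continuous.intervalIntegrable (by fun_prop) _ _), intervalIntegral.integral_const_mul,
        ← e2] at e1
      have e4 : √(B.ev i) * √(B.ev i) = B.ev i := Real.mul_self_sqrt (B.nonneg i)
      rw [B.inner_sqrtMap hA, real_inner_comm (B.basis i), real_inner_comm (B.basis i), e3,
        inner_sub_right, inner_add_right]
      linear_combination ⟪B.basis i, incl φ⟫_ℝ * (-e1) + ⟪B.basis i, incl φ⟫_ℝ *
        (∫ s in (0 : ℝ)..t, ⟪B.basis i, incl (x s)⟫_ℝ) * e4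
    have hd1 : HasDerivAt (fun t => y 0 + ∫ s in (0 : ℝ)..t, (g s - (2 * δ) • y s))
        (g t - (2 * δ) • y t) t := (hgy.integral_hasStrictDerivAt 0 t).hasDerivAt.const_add _
    have hd2 : HasDerivAt (fun t => ∫ s in (0 : ℝ)..t, sqrtMap (x s)) (sqrtMap (x t)) t :=
      (hsx.integral_hasStrictDerivAt 0 t).hasDerivAt
    have hd := ((hd1.inner ℝ (hasDerivAt_const t (incl φ))).sub
      (hd2.inner ℝ (hasDerivAt_const t (sqrtMap φ)))).hasDerivWithinAt (s := Set.Ici 0)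
    refine (hd.congr (f₁ := fun s => ⟪velocity x s, incl φ⟫_ℝ) (fun s hs => ?_) ?_).congr_deriv ?_
    · rw [hvel s hs]; exact hw s hs
    · rw [hvel t ht]; exact hw t ht
    · rw [hvel t ht, inner_sub_left, inner_smul_left]
      simp

theorem IsLinearSolution.hasDerivWithinAt {δ : ℝ} {g : ℝ → H} {u : ℝ → EnergySpace A}
    (hu : IsLinearSolution A δ g u) {t : ℝ} (ht : 0 ≤ t) :
    HasDerivWithinAt (fun s => incl (u s)) (velocity u t) (Set.Ici 0) t :=
  ((hu.contDiffOn.differentiableOn one_ne_zero) t ht).hasDerivWithinAt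

theorem IsLinearSolution.add {δ : ℝ} {g h : ℝ → H} {u v : ℝ → EnergySpace A}
    (hu : IsLinearSolution A δ g u) (hv : IsLinearSolution A δ h v) :
    IsLinearSolution A δ (fun t => g t + h t) (fun t => u t + v t) ∧
      ∀ t, 0 ≤ t → velocity (fun t => u t + v t) t = velocity u t + velocity v t := by
  have hvel : ∀ t, 0 ≤ t → velocity (fun t => u t + v t) t = velocity u t + velocity v t :=
    fun t ht => ((hu.hasDerivWithinAt ht).add (hv.hasDerivWithinAt ht)).derivWithin
      (uniqueDiffOn_Ici 0 t ht)
  refine ⟨⟨hu.continuousOn.add hv.continuousOn, hu.contDiffOn.add hv.contDiffOn, ?_⟩, hvel⟩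
  intro φ t ht
  have hs : sqrtMap (u t + v t) = sqrtMap (u t) + sqrtMap (v t) := rfl
  refine (((hu.weak φ t ht).add (hv.weak φ t ht)).congr (fun s hs => ?_) ?_).congr_deriv ?_
  · rw [hvel s hs, inner_add_left]; rfl
  · rw [hvel t ht, inner_add_left]; rfl
  · rw [hvel t ht, hs, inner_add_left, inner_add_left, inner_add_left]; ring

/-- The coordinates of a weak solution solve the equations of the single modes. -/
theorem EigenBasis.mode_deriv (B : EigenBasis A ι) (hA : IsSelfAdjoint A) {δ : ℝ} {g : ℝ → H}
    {u : ℝ → EnergySpace A} (hu : IsLinearSolution A δ g u) (i : ι) {t : ℝ} (ht : 0 ≤ t) :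
    HasDerivWithinAt (fun t => ⟪B.basis i, incl (u t)⟫_ℝ) ⟪B.basis i, velocity u t⟫_ℝ
        (Set.Ici 0) t ∧
      HasDerivWithinAt (fun t => ⟪B.basis i, velocity u t⟫_ℝ)
        (⟪B.basis i, g t⟫_ℝ - 2 * δ * ⟪B.basis i, velocity u t⟫_ℝ -
          B.ev i * ⟪B.basis i, incl (u t)⟫_ℝ) (Set.Ici 0) t := by
  constructor
  · exact (innerSL ℝ (B.basis i)).hasFDerivAt.comp_hasDerivWithinAt t (hu.hasDerivWithinAt ht)
  · obtain ⟨φ, hφ⟩ := B.exists_incl_eq hA (B.nonneg i) (B.mem_eigenspace i)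
    have hs : sqrtMap φ = √(B.ev i) • B.basis i := by
      refine ext_inner_basis B.basis fun k => ?_
      rw [B.inner_sqrtMap hA, hφ, inner_smul_right]
      rcases eq_or_ne k i with rfl | hk
      · rfl
      · rw [B.basis.orthonormal.2 hk]; ring
    have := hu.weak φ t ht
    rw [hφ, hs, inner_smul_right] at this
    simp only [real_inner_comm (B.basis i)] at this
    rw [real_inner_comm, B.inner_sqrtMap hA, ← mul_assoc, Real.mul_self_sqrt (B.nonneg i)] at this
    exact this.congr_deriv (by rw [real_inner_comm (B.basis i)])

theorem EigenBasis.pair_eq_flow (B : EigenBasis A ι) (hA : IsSelfAdjoint A) {δ : ℝ}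
    {u : ℝ → EnergySpace A} (hu : IsLinearSolution A δ 0 u) (i : ι) {t : ℝ} (ht : 0 ≤ t) :
    B.pair (u t, velocity u t) i =
      (flow δ Set.univ (B.ev i) t).mulVec (B.pair (u 0, velocity u 0) i) :=
  mode_unique (fun s hs => (B.mode_deriv hA hu i hs).1)
    (fun s hs => (B.mode_deriv hA hu i hs).2.congr_deriv (by simp)) ht

theorem EigenBasis.linearSolution_unique (B : EigenBasis A ι) (hA : IsSelfAdjoint A) {δ : ℝ}
    {u v : ℝ → EnergySpace A} (hu : IsLinearSolution A δ 0 u) (hv : IsLinearSolution A δ 0 v)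
    {U : EnergySpace A × H} (hu0 : HasInitialData u U) (hv0 : HasInitialData v U) {t : ℝ}
    (ht : 0 ≤ t) : (u t, velocity u t) = (v t, velocity v t) :=
  B.pair_ext hA fun i => by
    rw [B.pair_eq_flow hA hu i ht, B.pair_eq_flow hA hv i ht, hu0.1, hu0.2, hv0.1, hv0.2]

theorem wflow_mulVec {δ μ t : ℝ} (hμ : 0 ≤ μ) (S : Set ℝ) (x y : ℝ) :
    √(1 + μ) * (flow δ S μ t).mulVec ![x, y] 0 =
        wflow δ S μ t 0 0 * (√(1 + μ) * x) + wflow δ S μ t 0 1 * y ∧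
      (flow δ S μ t).mulVec ![x, y] 1 =
        wflow δ S μ t 1 0 * (√(1 + μ) * x) + wflow δ S μ t 1 1 * y := by
  have : √(1 + μ) ≠ 0 := (Real.sqrt_pos.2 (by linarith)).ne'
  constructor <;> simp [wflow, Matrix.mulVec, dotProduct, Fin.sum_univ_two] <;> field_simp

theorem EigenBasis.inner_energyEquiv_symm (B : EigenBasis A ι) {E : H ≃ₗᵢ[ℝ] EnergySpace A}
    (hE : ∀ h i, ⟪B.basis i, incl (E h)⟫_ℝ = (√(1 + B.ev i))⁻¹ * ⟪B.basis i, h⟫_ℝ)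
    (x : EnergySpace A) (i : ι) :
    ⟪B.basis i, E.symm x⟫_ℝ = √(1 + B.ev i) * ⟪B.basis i, incl x⟫_ℝ := by
  have h := hE (E.symm x) i
  have : √(1 + B.ev i) ≠ 0 := (Real.sqrt_pos.2 (by linarith [B.nonneg i])).ne'
  rw [E.apply_symm_apply] at h
  rw [h, mul_inv_cancel_left₀ this]

/-- A linear solution inherits the decay rate of the modes that are present in its data. -/
theorem EigenBasis.norm_le_of_rates (B : EigenBasis A ι) (hA : IsSelfAdjoint A) {δ κ C : ℝ}
    {S : Set ℝ} (hC : 0 ≤ C)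
    (hb : ∀ i t, 0 ≤ t → ∀ j k, |wflow δ S (B.ev i) t j k| ≤ C * Real.exp (-κ * t))
    {u : ℝ → EnergySpace A} (hu : IsLinearSolution A δ 0 u) {U : EnergySpace A × H}
    (hu0 : HasInitialData u U) (hU : U ∈ B.ratesSubmodule δ S) {t : ℝ} (ht : 0 ≤ t) :
    ‖u t‖ ≤ 2 * C * Real.exp (-κ * t) * (‖U.1‖ + ‖U.2‖) ∧
      ‖velocity u t‖ ≤ 2 * C * Real.exp (-κ * t) * (‖U.1‖ + ‖U.2‖) := by
  obtain ⟨E, hE⟩ := B.exists_energyEquiv hA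
  have hflow : ∀ i, B.pair (u t, velocity u t) i = (flow δ S (B.ev i) t).mulVec (B.pair U i) := by
    intro i
    rw [B.pair_eq_flow hA hu i ht, hu0.1, hu0.2, ← hU i, Matrix.mulVec_mulVec,
      flow_mul_flow _ (Set.subset_univ S), add_zero, Matrix.mulVec_mulVec,
      flow_mul_flow _ subset_rfl, add_zero]
  have hbound : ∀ i j (p q : ℝ), |wflow δ S (B.ev i) t j 0 * p + wflow δ S (B.ev i) t j 1 * q| ≤
      C * Real.exp (-κ * t) * (|p| + |q|) := by
    intro i j p q
    rw [mul_add]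
    refine (abs_add_le _ _).trans (add_le_add ?_ ?_) <;> rw [abs_mul] <;> gcongr
    · exact hb i t ht j 0
    · exact hb i t ht j 1
  have hC' : 0 ≤ C * Real.exp (-κ * t) := by positivity
  rw [← E.symm.norm_map (u t), ← E.symm.norm_map U.1, mul_assoc 2]
  constructor
  · refine norm_le_of_abs_inner_le B.basis hC' fun i => ?_
    have h0 : ⟪B.basis i, incl (u t)⟫_ℝ = (flow δ S (B.ev i) t).mulVec (B.pair U i) 0 :=
      congrFun (hflow i) 0
    rw [B.inner_energyEquiv_symm hE, B.inner_energyEquiv_symm hE, h0, pair,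
      (wflow_mulVec (B.nonneg i) S _ _).1]
    exact hbound i 0 _ _
  · refine norm_le_of_abs_inner_le B.basis hC' fun i => ?_
    have h0 : ⟪B.basis i, velocity u t⟫_ℝ = (flow δ S (B.ev i) t).mulVec (B.pair U i) 1 :=
      congrFun (hflow i) 1
    rw [B.inner_energyEquiv_symm hE, h0, pair, (wflow_mulVec (B.nonneg i) S _ _).2]
    exact hbound i 1 _ _

theorem EigenBasis.exists_linearSolution (B : EigenBasis A ι) (hA : IsSelfAdjoint A)
    (hspec : HasDiscreteSpectrum A) {δ : ℝ} (hδ : 0 < δ) (U : EnergySpace A × H) :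
    ∃ u : ℝ → EnergySpace A, IsLinearSolution A δ 0 u ∧ HasInitialData u U := by
  obtain ⟨E, hE⟩ := B.exists_energyEquiv hA
  obtain ⟨C, hC, hb⟩ := B.exists_abs_wflow_le_exp_abs hspec hδ Set.univ
  let X : ℝ → H := fun t => diag B.basis (fun i => wflow δ Set.univ (B.ev i) t 0 0) (E.symm U.1) +
    diag B.basis (fun i => wflow δ Set.univ (B.ev i) t 0 1) U.2
  let Y : ℝ → H := fun t => diag B.basis (fun i => wflow δ Set.univ (B.ev i) t 1 0) (E.symm U.1) +
    diag B.basis (fun i => wflow δ Set.univ (B.ev i) t 1 1) U.2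
  have hXc : Continuous X := (B.continuous_diag_wflow hspec hδ _ 0 0 continuous_id
    continuous_const).add (B.continuous_diag_wflow hspec hδ _ 0 1 continuous_id continuous_const)
  have hYc : Continuous Y := (B.continuous_diag_wflow hspec hδ _ 1 0 continuous_id
    continuous_const).add (B.continuous_diag_wflow hspec hδ _ 1 1 continuous_id continuous_const)
  have hX : ∀ i t, ⟪B.basis i, incl (E (X t))⟫_ℝ =
      (flow δ Set.univ (B.ev i) t).mulVec (B.pair U i) 0 := by
    intro i t
    have h0 : √(1 + B.ev i) ≠ 0 := (Real.sqrt_pos.2 (by linarith [B.nonneg i])).ne'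
    rw [hE, inner_add_right, inner_diag _ (fun i => hb i t 0 0), inner_diag _ (fun i => hb i t 0 1),
      B.inner_energyEquiv_symm hE, ← (wflow_mulVec (B.nonneg i) _ _ _).1,
      inv_mul_cancel_left₀ h0]
    rfl
  have hY : ∀ i t, ⟪B.basis i, Y t⟫_ℝ =
      (flow δ Set.univ (B.ev i) t).mulVec (B.pair U i) 1 := by
    intro i t
    rw [inner_add_right, inner_diag _ (fun i => hb i t 1 0), inner_diag _ (fun i => hb i t 1 1),
      B.inner_energyEquiv_symm hE, ← (wflow_mulVec (B.nonneg i) _ _ _).2]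
    rfl
  have hmv : ∀ (M : Matrix (Fin 2) (Fin 2) ℝ) v j, M.mulVec v j = M j 0 * v 0 + M j 1 * v 1 :=
    fun M v j => by simp [Matrix.mulVec, dotProduct, Fin.sum_univ_two]
  obtain ⟨hsol, hvel⟩ := B.isLinearSolution hA (δ := δ) (x := fun t => E (X t)) (y := Y) (g := 0)
    (E.continuous.comp hXc) hYc continuous_const
    (fun i t _ => by
      simp only [hX, hY, hmv]
      exact (((hasDerivAt_flow_zero _ _ _ _ _).mul_const _).add
        ((hasDerivAt_flow_zero _ _ _ _ _).mul_const _)).hasDerivWithinAt)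
    (fun i t _ => by
      simp only [hX, hY, hmv]
      refine ((((hasDerivAt_flow_one _ _ _ _ _).mul_const _).add
        ((hasDerivAt_flow_one _ _ _ _ _).mul_const _)).hasDerivWithinAt).congr_deriv ?_
      simp only [Pi.zero_apply, inner_zero_right]
      ring)
  refine ⟨_, hsol, ?_⟩
  have : (E (X 0), Y 0) = U := B.pair_ext hA fun i => by
    have h1 : B.pair (E (X 0), Y 0) i = (flow δ Set.univ (B.ev i) 0).mulVec (B.pair U i) := by
      ext j
      fin_cases j
      · exact hX i 0
      · exact hY i 0
    rw [h1, flow_univ_zero, Matrix.one_mulVec]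
  exact ⟨congrArg Prod.fst this, (hvel 0 le_rfl).trans (congrArg Prod.snd this)⟩

/-- Pairs whose coordinates only have rates in `S` keep this property along the linear flow. -/
theorem EigenBasis.hasRatesIn (B : EigenBasis A ι) (hA : IsSelfAdjoint A)
    (hspec : HasDiscreteSpectrum A) {δ : ℝ} (hδ : 0 < δ) {S : Set ℝ} {U : EnergySpace A × H}
    (hU : U ∈ B.ratesSubmodule δ S) : HasRatesIn A δ S U := by
  obtain ⟨u, hu, hu0⟩ := B.exists_linearSolution hA hspec hδ U
  refine ⟨u, hu, hu0, fun t ht => ?_⟩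
  rw [B.modeSum_eq hA δ (B.finite_low hspec _)]
  intro i
  have h : (flow δ Set.univ (B.ev i) t).mulVec (B.pair U i) =
      (flow δ S (B.ev i) t).mulVec (B.pair U i) := by
    conv_lhs => rw [← hU i, Matrix.mulVec_mulVec, flow_mul_flow _ (Set.subset_univ S), add_zero]
  rw [B.pair_eq_flow hA hu i ht, hu0.1, hu0.2, h, Matrix.mulVec_mulVec,
    flow_mul_flow _ subset_rfl, zero_add]

end DampedWave

namespace DampedWave

/-! ### The solution of the forced equation with prescribed decay -/

open MeasureTheory

theorem integrable_exp_neg_mul_abs_sub {η : ℝ} (hη : 0 < η) (t : ℝ) :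
    Integrable fun s : ℝ => Real.exp (-η * |t - s|) := by
  have h : Integrable fun s : ℝ => Real.exp (-η * |s|) := by
    rw [← integrableOn_univ, ← Set.Iic_union_Ioi (a := (0 : ℝ))]
    refine IntegrableOn.union ?_ ?_
    · exact (integrableOn_exp_mul_Iic hη 0).congr_fun
        (fun s hs => by simp only [abs_of_nonpos (Set.mem_Iic.1 hs)]; ring_nf) measurableSet_Iic
    · exact (integrableOn_exp_mul_Ioi (neg_lt_zero.2 hη) 0).congr_fun
        (fun s hs => by simp only [abs_of_pos (Set.mem_Ioi.1 hs)]) measurableSet_Ioi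
  exact h.comp_sub_left t

variable {H : Type*} [NormedAddCommGroup H] [InnerProductSpace ℝ H]
  {A : H →ₗ.[ℝ] H} {ι : Type*}

/-- The second column (the response to a force) of the Green function of a single mode, weighted as
`wflow`: it propagates the rates beyond `r₀` forward in time, and the rates up to `r₀` backward. -/
def greenKernel (δ r₀ μ : ℝ) (j : Fin 2) (τ : ℝ) : ℝ :=
  if 0 ≤ τ then wflow δ (Set.Ioi r₀) μ τ j 1 else -wflow δ (Set.Iic r₀) μ τ j 1

/-- The margin `η` between `κ` and the rates on both sides yields the integrable factor
`e^{-η|τ|}`. -/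
theorem EigenBasis.exists_abs_greenKernel_le (B : EigenBasis A ι) (hspec : HasDiscreteSpectrum A)
    {δ r₀ κ η : ℝ} (hδ : 0 < δ)
    (hfast : ∀ i, ∀ r ∈ modeRates δ (B.ev i), r₀ < r → κ + η < r)
    (hslow : ∀ i, ∀ r ∈ modeRates δ (B.ev i), r ≤ r₀ → r < κ - η) :
    ∃ C, 0 ≤ C ∧ ∀ i j τ, |greenKernel δ r₀ (B.ev i) j τ| ≤
      C * (Real.exp (-κ * τ) * Real.exp (-η * |τ|)) := by
  obtain ⟨C, hC, h1⟩ := exists_abs_wflow_le (κ := κ + η) (σ := 1) hδ (B.finite_low hspec _)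
    (S := Set.Ioi r₀) (by norm_num) (fun i r hr hr' => by linarith [hfast i r hr' hr])
  obtain ⟨D, hD, h2⟩ := exists_abs_wflow_le (κ := κ - η) (σ := -1) hδ (B.finite_low hspec _)
    (S := Set.Iic r₀) (by norm_num) (fun i r hr hr' => by linarith [hslow i r hr' hr])
  refine ⟨C + D, by positivity, fun i j τ => ?_⟩
  unfold greenKernel
  rw [← Real.exp_add]
  split_ifs with hτ
  · refine (h1 i τ (by linarith) j 1).trans ?_
    rw [abs_of_nonneg hτ, show -(κ + η) * τ = -κ * τ + -η * τ by ring]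
    gcongr
    linarith
  · rw [abs_neg]
    refine (h2 i τ (by linarith) j 1).trans ?_
    rw [abs_of_neg (not_le.1 hτ), show -(κ - η) * τ = -κ * τ + -η * -τ by ring]
    gcongr
    linarith

/-- The solution of the equation with force `g` that is given by `greenKernel`: the velocity for
`j = 1`, and for `j = 0` the position multiplied by `(1 + A)^{1/2}`, so that its norm in `H` is the
energy norm of the position. -/
def green (b : HilbertBasis ι ℝ H) (ev : ι → ℝ) (δ r₀ : ℝ) (j : Fin 2) (g : ℝ → H) (t : ℝ) : H :=
  ∫ s in Set.Ioi (0 : ℝ), diag b (fun i => greenKernel δ r₀ (ev i) j (t - s)) (g s)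

section

variable {B : EigenBasis A ι} {δ r₀ κ η C M : ℝ}

theorem EigenBasis.diag_greenKernel (B : EigenBasis A ι) (hspec : HasDiscreteSpectrum A)
    (hδ : 0 < δ) (r₀ : ℝ) (j : Fin 2) (t s : ℝ) (x : H) :
    diag B.basis (fun i => greenKernel δ r₀ (B.ev i) j (t - s)) x =
      if s ≤ t then diag B.basis (fun i => wflow δ (Set.Ioi r₀) (B.ev i) (t - s) j 1) x
      else -diag B.basis (fun i => wflow δ (Set.Iic r₀) (B.ev i) (t - s) j 1) x := by
  obtain ⟨C, hC, h⟩ := B.exists_abs_wflow_le_exp_abs hspec hδ (Set.Iic r₀)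
  split_ifs with hts
  · simp only [greenKernel, if_pos (sub_nonneg.2 hts)]
  · simp only [greenKernel, sub_nonneg, if_neg hts]
    refine ext_inner_basis B.basis fun i => ?_
    rw [inner_neg_right, inner_diag _ (fun i => h i (t - s) j 1),
      inner_diag _ (fun i => (abs_neg _).trans_le (h i (t - s) j 1)), neg_mul]

theorem norm_diag_greenKernel_le
    (hC : 0 ≤ C) (hb : ∀ i j τ, |greenKernel δ r₀ (B.ev i) j τ| ≤
      C * (Real.exp (-κ * τ) * Real.exp (-η * |τ|)))
    {g : ℝ → H} {s : ℝ} (hgM : ‖g s‖ ≤ M * Real.exp (-κ * s)) (j : Fin 2) (t : ℝ) :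
    ‖diag B.basis (fun i => greenKernel δ r₀ (B.ev i) j (t - s)) (g s)‖ ≤
      C * M * Real.exp (-κ * t) * Real.exp (-η * |t - s|) := by
  have : Real.exp (-κ * t) = Real.exp (-κ * (t - s)) * Real.exp (-κ * s) := by
    rw [← Real.exp_add]; ring_nf
  calc _ ≤ C * (Real.exp (-κ * (t - s)) * Real.exp (-η * |t - s|)) * ‖g s‖ :=
        norm_diag_le B.basis (by positivity) (fun i => hb i j (t - s)) _
    _ ≤ C * (Real.exp (-κ * (t - s)) * Real.exp (-η * |t - s|)) * (M * Real.exp (-κ * s)) := by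
        gcongr
    _ = _ := by rw [this]; ring

theorem aestronglyMeasurable_green (hspec : HasDiscreteSpectrum A) (hδ : 0 < δ)
    {g : ℝ → H} (hg : Continuous g) (j : Fin 2) (t : ℝ) (μ : Measure ℝ) :
    AEStronglyMeasurable
      (fun s => diag B.basis (fun i => greenKernel δ r₀ (B.ev i) j (t - s)) (g s)) μ := by
  simp only [B.diag_greenKernel hspec hδ r₀]
  exact (StronglyMeasurable.ite measurableSet_Iic
    (B.continuous_diag_wflow hspec hδ _ j 1 (by fun_prop) hg).stronglyMeasurable
    (B.continuous_diag_wflow hspec hδ _ j 1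
      (by fun_prop) hg).neg.stronglyMeasurable).aestronglyMeasurable

theorem integrable_green (hspec : HasDiscreteSpectrum A) (hδ : 0 < δ) (hη : 0 < η)
    (hC : 0 ≤ C) (hb : ∀ i j τ, |greenKernel δ r₀ (B.ev i) j τ| ≤
      C * (Real.exp (-κ * τ) * Real.exp (-η * |τ|)))
    {g : ℝ → H} (hg : Continuous g) (hgM : ∀ s, 0 ≤ s → ‖g s‖ ≤ M * Real.exp (-κ * s))
    (j : Fin 2) (t : ℝ) :
    IntegrableOn (fun s => diag B.basis (fun i => greenKernel δ r₀ (B.ev i) j (t - s)) (g s))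
      (Set.Ioi 0) :=
  ((integrable_exp_neg_mul_abs_sub hη t).const_mul
    (C * M * Real.exp (-κ * t))).integrableOn.mono' (aestronglyMeasurable_green hspec hδ hg j t _)
    ((ae_restrict_iff' measurableSet_Ioi).2 (ae_of_all _ fun s hs =>
      norm_diag_greenKernel_le hC hb (hgM s (le_of_lt hs)) j t))

theorem norm_green_le (hη : 0 < η)
    (hC : 0 ≤ C) (hb : ∀ i j τ, |greenKernel δ r₀ (B.ev i) j τ| ≤
      C * (Real.exp (-κ * τ) * Real.exp (-η * |τ|)))
    {g : ℝ → H} (hgM : ∀ s, 0 ≤ s → ‖g s‖ ≤ M * Real.exp (-κ * s))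
    (j : Fin 2) (t : ℝ) :
    ‖green B.basis B.ev δ r₀ j g t‖ ≤
      C * (∫ s : ℝ, Real.exp (-η * |s|)) * M * Real.exp (-κ * t) := by
  have hM : 0 ≤ M := by simpa using (norm_nonneg _).trans (hgM 0 le_rfl)
  have hi := (integrable_exp_neg_mul_abs_sub hη t).const_mul (C * M * Real.exp (-κ * t))
  refine (norm_integral_le_of_norm_le hi.integrableOn ((ae_restrict_iff' measurableSet_Ioi).2
    (ae_of_all _ fun s hs => norm_diag_greenKernel_le hC hb (hgM s (le_of_lt hs)) j t))).trans ?_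
  refine (setIntegral_le_integral hi (ae_of_all _ fun s => by
    simp only [Pi.zero_apply]; positivity)).trans (le_of_eq ?_)
  rw [integral_const_mul, integral_sub_left_eq_self (fun s => Real.exp (-η * |s|))]
  ring

theorem green_sub (hspec : HasDiscreteSpectrum A) (hδ : 0 < δ) (hη : 0 < η)
    (hC : 0 ≤ C) (hb : ∀ i j τ, |greenKernel δ r₀ (B.ev i) j τ| ≤
      C * (Real.exp (-κ * τ) * Real.exp (-η * |τ|)))
    {g h : ℝ → H} (hg : Continuous g) (hgM : ∀ s, 0 ≤ s → ‖g s‖ ≤ M * Real.exp (-κ * s))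
    (hh : Continuous h) (hhM : ∀ s, 0 ≤ s → ‖h s‖ ≤ M * Real.exp (-κ * s)) (j : Fin 2) (t : ℝ) :
    green B.basis B.ev δ r₀ j g t - green B.basis B.ev δ r₀ j h t =
      green B.basis B.ev δ r₀ j (fun s => g s - h s) t := by
  unfold green
  rw [← integral_sub (integrable_green hspec hδ hη hC hb hg hgM j t)
    (integrable_green hspec hδ hη hC hb hh hhM j t)]
  simp only [diag_sub _ (fun i => hb i j _)]

theorem continuous_green (hspec : HasDiscreteSpectrum A) (hδ : 0 < δ) (hη : 0 < η) (hκ : 0 < κ)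
    (hC : 0 ≤ C) (hb : ∀ i j τ, |greenKernel δ r₀ (B.ev i) j τ| ≤
      C * (Real.exp (-κ * τ) * Real.exp (-η * |τ|)))
    {g : ℝ → H} (hg : Continuous g) (hgM : ∀ s, 0 ≤ s → ‖g s‖ ≤ M * Real.exp (-κ * s))
    (j : Fin 2) : Continuous (green B.basis B.ev δ r₀ j g) := by
  have hM : 0 ≤ M := by simpa using (norm_nonneg _).trans (hgM 0 le_rfl)
  refine continuous_iff_continuousAt.2 fun t₀ => ?_
  refine continuousAt_of_dominated (bound := fun s => C * M * Real.exp (κ * (|t₀| + 1)) *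
      (Real.exp (η * (|t₀| + 1)) * Real.exp (-η * s)))
    (Filter.Eventually.of_forall fun t => aestronglyMeasurable_green hspec hδ hg j t _) ?_
    (((exp_neg_integrableOn_Ioi 0 hη).const_mul _).const_mul _) ?_
  · have : ∀ᶠ t in 𝓝 t₀, |t| < |t₀| + 1 :=
      (continuous_abs.continuousAt (x := t₀)).eventually (gt_mem_nhds (lt_add_one _))
    filter_upwards [this] with t ht
    refine (ae_restrict_iff' measurableSet_Ioi).2 (ae_of_all _ fun s hs => ?_)
    refine (norm_diag_greenKernel_le hC hb (hgM s (le_of_lt hs)) j t).trans ?_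
    have h1 := neg_abs_le t
    have h2 : s - |t| ≤ |t - s| := by linarith [neg_abs_le (t - s), le_abs_self t]
    rw [← Real.exp_add]
    have h3 : -κ * t ≤ κ * (|t₀| + 1) := by nlinarith
    have h4 : -η * |t - s| ≤ η * (|t₀| + 1) + -η * s := by nlinarith
    gcongr
  · -- The kernel jumps only at `s = t₀`.
    refine ae_restrict_of_ae ?_
    have : ∀ᵐ s : ℝ, s ≠ t₀ := by simp [ae_iff]
    filter_upwards [this] with s hs
    simp only [B.diag_greenKernel hspec hδ r₀]
    have hc := fun S : Set ℝ => (B.continuous_diag_wflow hspec hδ S j 1 (τ := fun t => t - s)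
      (g := fun _ => g s) (by fun_prop) continuous_const).continuousAt (x := t₀)
    rcases lt_or_gt_of_ne hs with hs | hs
    · refine (hc (Set.Ioi r₀)).congr ?_
      filter_upwards [lt_mem_nhds hs] with t ht
      rw [if_pos ht.le]
    · refine (hc (Set.Iic r₀)).neg.congr ?_
      filter_upwards [gt_mem_nhds hs] with t ht
      rw [if_neg ht.not_ge]
      rfl

end

end DampedWave

namespace DampedWave

/-! ### The forced equation in coordinates -/

open MeasureTheory

theorem flow_univ_mul_apply (δ μ : ℝ) (S : Set ℝ) (t s : ℝ) (j : Fin 2) :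
    flow δ Set.univ μ t j 0 * flow δ S μ s 0 1 + flow δ Set.univ μ t j 1 * flow δ S μ s 1 1 =
      flow δ S μ (t + s) j 1 := by
  rw [← flow_mul_flow δ (Set.subset_univ S), Matrix.mul_apply, Fin.sum_univ_two]

/-- The solution (`j = 0`) and its derivative (`j = 1`) of the equation of a single mode with force
`γ`, where the rates beyond `r₀` are integrated from the past and the others from the future. -/
def modeGreen (δ r₀ μ : ℝ) (γ : ℝ → ℝ) (j : Fin 2) (t : ℝ) : ℝ :=
  ∫ s in Set.Ioi (0 : ℝ), (if s ≤ t then flow δ (Set.Ioi r₀) μ (t - s) j 1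
    else -flow δ (Set.Iic r₀) μ (t - s) j 1) * γ s

section

variable {δ r₀ μ : ℝ} {γ : ℝ → ℝ}

/-- Duhamel's formula: since the fast and the slow part of the flow add up to the whole flow,
`modeGreen` solves the forced equation, with data such that the slow part vanishes at infinity. -/
theorem modeGreen_eq (hγ : Continuous γ)
    (hint : ∀ j, IntegrableOn (fun s => flow δ (Set.Iic r₀) μ (-s) j 1 * γ s) (Set.Ioi 0))
    (j : Fin 2) {t : ℝ} (ht : 0 ≤ t) :
    modeGreen δ r₀ μ γ j t =
      flow δ Set.univ μ t j 0 * ((∫ s in (0 : ℝ)..t, flow δ Set.univ μ (-s) 0 1 * γ s) -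
        ∫ s in Set.Ioi (0 : ℝ), flow δ (Set.Iic r₀) μ (-s) 0 1 * γ s) +
      flow δ Set.univ μ t j 1 * ((∫ s in (0 : ℝ)..t, flow δ Set.univ μ (-s) 1 1 * γ s) -
        ∫ s in Set.Ioi (0 : ℝ), flow δ (Set.Iic r₀) μ (-s) 1 1 * γ s) := by
  have hF : ∀ k : Fin 2, Continuous fun s => flow δ Set.univ μ (-s) k 1 * γ s := fun k =>
    ((continuous_flow δ _ μ k 1).comp continuous_neg).mul hγ
  have hsplit : ∀ s, (if s ≤ t then flow δ (Set.Ioi r₀) μ (t - s) j 1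
      else -flow δ (Set.Iic r₀) μ (t - s) j 1) * γ s =
      (Set.Iic t).indicator (fun s => flow δ Set.univ μ (t - s) j 1 * γ s) s -
        flow δ (Set.Iic r₀) μ (t - s) j 1 * γ s := by
    intro s
    have h := congrFun (congrFun (flow_add_flow_compl δ (Set.Iic r₀) μ (t - s)) j) 1
    rw [Set.compl_Iic, Matrix.add_apply] at h
    rw [Set.indicator_apply, ← h]
    split_ifs with h1 h2 h2
    · ring
    · exact absurd h1 h2
    · exact absurd h2 h1
    · ring
  have hslow : ∀ s, flow δ (Set.Iic r₀) μ (t - s) j 1 * γ s =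
      flow δ Set.univ μ t j 0 * (flow δ (Set.Iic r₀) μ (-s) 0 1 * γ s) +
      flow δ Set.univ μ t j 1 * (flow δ (Set.Iic r₀) μ (-s) 1 1 * γ s) := by
    intro s
    rw [sub_eq_add_neg, ← flow_univ_mul_apply]
    ring
  have hall : ∀ s, flow δ Set.univ μ (t - s) j 1 * γ s =
      flow δ Set.univ μ t j 0 * (flow δ Set.univ μ (-s) 0 1 * γ s) +
      flow δ Set.univ μ t j 1 * (flow δ Set.univ μ (-s) 1 1 * γ s) := by
    intro s
    rw [sub_eq_add_neg, ← flow_univ_mul_apply]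
    ring
  unfold modeGreen
  simp only [hsplit]
  rw [integral_sub, setIntegral_indicator measurableSet_Iic, Set.Ioi_inter_Iic,
    ← intervalIntegral.integral_of_le ht]
  · simp only [hslow, hall]
    rw [intervalIntegral.integral_add (((hF 0).intervalIntegrable _ _).const_mul _)
      (((hF 1).intervalIntegrable _ _).const_mul _), integral_add ((hint 0).const_mul _)
      ((hint 1).const_mul _), intervalIntegral.integral_const_mul,
      intervalIntegral.integral_const_mul, integral_const_mul, integral_const_mul]
    ring
  · rw [← integrableOn_univ, integrableOn_univ]
    refine (integrable_indicator_iff measurableSet_Iic).2 ?_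
    rw [IntegrableOn, Measure.restrict_restrict measurableSet_Iic, Set.inter_comm,
      Set.Ioi_inter_Iic]
    have hc : Continuous fun s => flow δ Set.univ μ (t - s) j 1 * γ s :=
      ((continuous_flow δ _ μ j 1).comp (continuous_const.sub continuous_id)).mul hγ
    exact (hc.integrableOn_Icc (a := 0) (b := t)).mono_set Set.Ioc_subset_Icc_self
  · simp only [hslow]
    exact ((hint 0).const_mul _).add ((hint 1).const_mul _)

theorem hasDerivWithinAt_modeGreen (hγ : Continuous γ)
    (hint : ∀ j, IntegrableOn (fun s => flow δ (Set.Iic r₀) μ (-s) j 1 * γ s) (Set.Ioi 0))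
    {t : ℝ} (ht : 0 ≤ t) :
    HasDerivWithinAt (modeGreen δ r₀ μ γ 0) (modeGreen δ r₀ μ γ 1 t) (Set.Ici 0) t ∧
      HasDerivWithinAt (modeGreen δ r₀ μ γ 1)
        (γ t - 2 * δ * modeGreen δ r₀ μ γ 1 t - μ * modeGreen δ r₀ μ γ 0 t) (Set.Ici 0) t := by
  have hp : ∀ k : Fin 2, HasDerivAt (fun t => ∫ s in (0 : ℝ)..t, flow δ Set.univ μ (-s) k 1 * γ s)
      (flow δ Set.univ μ (-t) k 1 * γ t) t := fun k =>
    ((((continuous_flow δ _ μ k 1).comp continuous_neg).mul hγ).integral_hasStrictDerivAt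
      0 t).hasDerivAt
  have h0 : ∀ j, flow δ Set.univ μ t j 0 * flow δ Set.univ μ (-t) 0 1 +
      flow δ Set.univ μ t j 1 * flow δ Set.univ μ (-t) 1 1 = (1 : Matrix (Fin 2) (Fin 2) ℝ) j 1 :=
    fun j => by rw [flow_univ_mul_apply, add_neg_cancel, flow_univ_zero]
  have h00 := h0 0
  have h01 := h0 1
  rw [Matrix.one_apply_ne (by decide)] at h00
  rw [Matrix.one_apply_eq] at h01
  constructor
  · have hd := ((hasDerivAt_flow_zero δ Set.univ μ t 0).mul ((hp 0).sub_const
      (∫ s in Set.Ioi (0 : ℝ), flow δ (Set.Iic r₀) μ (-s) 0 1 * γ s))).add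
      ((hasDerivAt_flow_zero δ Set.univ μ t 1).mul ((hp 1).sub_const
      (∫ s in Set.Ioi (0 : ℝ), flow δ (Set.Iic r₀) μ (-s) 1 1 * γ s)))
    refine (hd.hasDerivWithinAt.congr (fun s hs => modeGreen_eq hγ hint 0 hs)
      (modeGreen_eq hγ hint 0 ht)).congr_deriv ?_
    rw [modeGreen_eq hγ hint 1 ht]
    linear_combination γ t * h00
  · have hd := ((hasDerivAt_flow_one δ Set.univ μ t 0).mul ((hp 0).sub_const
      (∫ s in Set.Ioi (0 : ℝ), flow δ (Set.Iic r₀) μ (-s) 0 1 * γ s))).add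
      ((hasDerivAt_flow_one δ Set.univ μ t 1).mul ((hp 1).sub_const
      (∫ s in Set.Ioi (0 : ℝ), flow δ (Set.Iic r₀) μ (-s) 1 1 * γ s)))
    refine (hd.hasDerivWithinAt.congr (fun s hs => modeGreen_eq hγ hint 1 hs)
      (modeGreen_eq hγ hint 1 ht)).congr_deriv ?_
    rw [modeGreen_eq hγ hint 1 ht, modeGreen_eq hγ hint 0 ht]
    linear_combination γ t * h01

/-- The initial data of `modeGreen` only have rates up to `r₀`. -/
theorem flow_mulVec_modeGreen_zero (hγ : Continuous γ)
    (hint : ∀ j, IntegrableOn (fun s => flow δ (Set.Iic r₀) μ (-s) j 1 * γ s) (Set.Ioi 0)) :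
    (flow δ (Set.Iic r₀) μ 0).mulVec ![modeGreen δ r₀ μ γ 0 0, modeGreen δ r₀ μ γ 1 0] =
      ![modeGreen δ r₀ μ γ 0 0, modeGreen δ r₀ μ γ 1 0] := by
  have h : ∀ j, modeGreen δ r₀ μ γ j 0 =
      -∫ s in Set.Ioi (0 : ℝ), flow δ (Set.Iic r₀) μ (-s) j 1 * γ s := by
    refine Fin.forall_fin_two.2 ⟨?_, ?_⟩ <;> rw [modeGreen_eq hγ hint _ le_rfl, flow_univ_zero] <;>
      simp
  have hk : ∀ j, flow δ (Set.Iic r₀) μ 0 j 0 * modeGreen δ r₀ μ γ 0 0 +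
      flow δ (Set.Iic r₀) μ 0 j 1 * modeGreen δ r₀ μ γ 1 0 = modeGreen δ r₀ μ γ j 0 := by
    intro j
    have he : ∀ s, flow δ (Set.Iic r₀) μ (-s) j 1 * γ s =
        flow δ (Set.Iic r₀) μ 0 j 0 * (flow δ (Set.Iic r₀) μ (-s) 0 1 * γ s) +
        flow δ (Set.Iic r₀) μ 0 j 1 * (flow δ (Set.Iic r₀) μ (-s) 1 1 * γ s) := by
      intro s
      have := congrFun (congrFun (flow_mul_flow δ (subset_refl (Set.Iic r₀)) μ 0 (-s)) j) 1
      rw [Matrix.mul_apply, Fin.sum_univ_two, zero_add] at this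
      rw [← this]
      ring
    rw [h, h, h, integral_congr_ae (ae_of_all _ he), integral_add ((hint 0).const_mul _)
      ((hint 1).const_mul _), integral_const_mul, integral_const_mul]
    ring
  ext j
  have := hk j
  fin_cases j <;> simpa [Matrix.mulVec, dotProduct, Fin.sum_univ_two] using this

end

variable {H : Type*} [NormedAddCommGroup H] [InnerProductSpace ℝ H] [CompleteSpace H]
  {A : H →ₗ.[ℝ] H} {ι : Type*} {B : EigenBasis A ι} {δ r₀ κ η C M : ℝ}

theorem inner_green (hspec : HasDiscreteSpectrum A) (hδ : 0 < δ) (hη : 0 < η)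
    (hC : 0 ≤ C) (hb : ∀ i j τ, |greenKernel δ r₀ (B.ev i) j τ| ≤
      C * (Real.exp (-κ * τ) * Real.exp (-η * |τ|)))
    {g : ℝ → H} (hg : Continuous g) (hgM : ∀ s, 0 ≤ s → ‖g s‖ ≤ M * Real.exp (-κ * s))
    (i : ι) (j : Fin 2) (t : ℝ) :
    IntegrableOn (fun s => greenKernel δ r₀ (B.ev i) j (t - s) * ⟪B.basis i, g s⟫_ℝ) (Set.Ioi 0) ∧
    ⟪B.basis i, green B.basis B.ev δ r₀ j g t⟫_ℝ =
      ∫ s in Set.Ioi (0 : ℝ), greenKernel δ r₀ (B.ev i) j (t - s) * ⟪B.basis i, g s⟫_ℝ := by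
  have h := integrable_green hspec hδ hη hC hb hg hgM j t
  have he : ∀ s, ⟪B.basis i, diag B.basis (fun i => greenKernel δ r₀ (B.ev i) j (t - s)) (g s)⟫_ℝ =
      greenKernel δ r₀ (B.ev i) j (t - s) * ⟪B.basis i, g s⟫_ℝ := fun s =>
    inner_diag B.basis (fun i => hb i j (t - s)) (g s) i
  simp only [← he]
  exact ⟨h.const_inner _, (integral_inner h _).symm⟩

theorem integrableOn_flow_mul (hspec : HasDiscreteSpectrum A) (hδ : 0 < δ) (hη : 0 < η)
    (hC : 0 ≤ C) (hb : ∀ i j τ, |greenKernel δ r₀ (B.ev i) j τ| ≤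
      C * (Real.exp (-κ * τ) * Real.exp (-η * |τ|)))
    {g : ℝ → H} (hg : Continuous g) (hgM : ∀ s, 0 ≤ s → ‖g s‖ ≤ M * Real.exp (-κ * s)) (i : ι) :
    ∀ j, IntegrableOn (fun s => flow δ (Set.Iic r₀) (B.ev i) (-s) j 1 * ⟪B.basis i, g s⟫_ℝ)
      (Set.Ioi 0) := by
  have h0 : √(1 + B.ev i) ≠ 0 := (Real.sqrt_pos.2 (by linarith [B.nonneg i])).ne'
  have h := fun j => (inner_green hspec hδ hη hC hb hg hgM i j 0).1
  refine Fin.forall_fin_two.2 ⟨?_, ?_⟩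
  · refine IntegrableOn.congr_fun ((h 0).const_mul (-(√(1 + B.ev i))⁻¹)) (fun s hs => ?_)
      measurableSet_Ioi
    simp only [greenKernel, zero_sub, if_neg (not_le.2 (neg_lt_zero.2 (Set.mem_Ioi.1 hs))), wflow,
      Matrix.of_apply, Matrix.cons_val', Matrix.cons_val_zero, Matrix.cons_val_one,
      Matrix.cons_val_fin_one]
    field_simp
  · refine ((h 1).neg).congr_fun (fun s hs => ?_) measurableSet_Ioi
    simp [greenKernel, not_le.2 (Set.mem_Ioi.1 hs), wflow]

theorem inner_green_eq_modeGreen (hspec : HasDiscreteSpectrum A) (hδ : 0 < δ) (hη : 0 < η)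
    (hC : 0 ≤ C) (hb : ∀ i j τ, |greenKernel δ r₀ (B.ev i) j τ| ≤
      C * (Real.exp (-κ * τ) * Real.exp (-η * |τ|)))
    {g : ℝ → H} (hg : Continuous g) (hgM : ∀ s, 0 ≤ s → ‖g s‖ ≤ M * Real.exp (-κ * s))
    (i : ι) (t : ℝ) :
    ⟪B.basis i, green B.basis B.ev δ r₀ 0 g t⟫_ℝ =
        √(1 + B.ev i) * modeGreen δ r₀ (B.ev i) (fun s => ⟪B.basis i, g s⟫_ℝ) 0 t ∧
      ⟪B.basis i, green B.basis B.ev δ r₀ 1 g t⟫_ℝ =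
        modeGreen δ r₀ (B.ev i) (fun s => ⟪B.basis i, g s⟫_ℝ) 1 t := by
  rw [(inner_green hspec hδ hη hC hb hg hgM i 0 t).2,
    (inner_green hspec hδ hη hC hb hg hgM i 1 t).2,
    modeGreen, modeGreen, ← integral_const_mul]
  constructor <;> refine integral_congr_ae (ae_of_all _ fun s => ?_)
  · simp only [greenKernel, sub_nonneg, wflow, Matrix.of_apply, Matrix.cons_val',
      Matrix.cons_val_zero, Matrix.cons_val_one, Matrix.cons_val_fin_one]
    split_ifs <;> ring
  · simp [greenKernel, wflow]

/-- The linear equation with an exponentially decaying force `g` has a solution with the same decay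
and with slow initial data. It depends Lipschitz continuously on `g` for the weighted norms. -/
theorem EigenBasis.exists_forcedSolution (B : EigenBasis A ι) (hA : IsSelfAdjoint A)
    (hspec : HasDiscreteSpectrum A) (hδ : 0 < δ) (hκ : 0 < κ) (hη : 0 < η)
    (hfast : ∀ i, ∀ r ∈ modeRates δ (B.ev i), r₀ < r → κ + η < r)
    (hslow : ∀ i, ∀ r ∈ modeRates δ (B.ev i), r ≤ r₀ → r < κ - η) :
    ∃ (K : ℝ) (G : (ℝ → H) → ℝ → EnergySpace A), 0 ≤ K ∧
      (∀ (g : ℝ → H) (M : ℝ), Continuous g → (∀ s, 0 ≤ s → ‖g s‖ ≤ M * Real.exp (-κ * s)) →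
        Continuous (G g) ∧ IsLinearSolution A δ g (G g) ∧
        (G g 0, velocity (G g) 0) ∈ B.ratesSubmodule δ (Set.Iic r₀) ∧
        ∀ t, 0 ≤ t → ‖G g t‖ ≤ K * M * Real.exp (-κ * t) ∧
          ‖velocity (G g) t‖ ≤ K * M * Real.exp (-κ * t)) ∧
      ∀ (g h : ℝ → H) (M N : ℝ), Continuous g → Continuous h →
        (∀ s, 0 ≤ s → ‖g s‖ ≤ M * Real.exp (-κ * s)) →
        (∀ s, 0 ≤ s → ‖h s‖ ≤ M * Real.exp (-κ * s)) →
        (∀ s, 0 ≤ s → ‖g s - h s‖ ≤ N * Real.exp (-κ * s)) →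
        ∀ t, 0 ≤ t → ‖G g t - G h t‖ ≤ K * N * Real.exp (-κ * t) := by
  obtain ⟨C, hC, hb⟩ := B.exists_abs_greenKernel_le hspec hδ hfast hslow
  obtain ⟨E, hE⟩ := B.exists_energyEquiv hA
  refine ⟨C * ∫ s : ℝ, Real.exp (-η * |s|), fun g t => E (green B.basis B.ev δ r₀ 0 g t),
    mul_nonneg hC (integral_nonneg fun s => (Real.exp_pos _).le), ?_, ?_⟩
  · intro g M hg hgM
    have hG : ∀ j, Continuous (green B.basis B.ev δ r₀ j g) :=
      continuous_green hspec hδ hη hκ hC hb hg hgM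
    have hmode := inner_green_eq_modeGreen hspec hδ hη hC hb hg hgM
    have hx : ∀ i t, ⟪B.basis i, incl (E (green B.basis B.ev δ r₀ 0 g t))⟫_ℝ =
        modeGreen δ r₀ (B.ev i) (fun s => ⟪B.basis i, g s⟫_ℝ) 0 t := by
      intro i t
      have h0 : √(1 + B.ev i) ≠ 0 := (Real.sqrt_pos.2 (by linarith [B.nonneg i])).ne'
      rw [hE, (hmode i t).1, inv_mul_cancel_left₀ h0]
    have hγ : ∀ i, Continuous fun s => ⟪B.basis i, g s⟫_ℝ := fun i => by fun_prop
    have hint := integrableOn_flow_mul hspec hδ hη hC hb hg hgM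
    obtain ⟨hsol, hvel⟩ := B.isLinearSolution hA (δ := δ)
      (x := fun t => E (green B.basis B.ev δ r₀ 0 g t)) (y := green B.basis B.ev δ r₀ 1 g) (g := g)
      (E.continuous.comp (hG 0)) (hG 1) hg
      (fun i t ht => by
        simp only [hx, (hmode i _).2]
        exact (hasDerivWithinAt_modeGreen (hγ i) (hint i) ht).1)
      (fun i t ht => by
        simp only [hx, (hmode i _).2]
        exact (hasDerivWithinAt_modeGreen (hγ i) (hint i) ht).2)
    refine ⟨E.continuous.comp (hG 0), hsol, fun i => ?_, fun t ht => ?_⟩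
    · have : B.pair (E (green B.basis B.ev δ r₀ 0 g 0), green B.basis B.ev δ r₀ 1 g 0) i =
          ![modeGreen δ r₀ (B.ev i) (fun s => ⟪B.basis i, g s⟫_ℝ) 0 0,
            modeGreen δ r₀ (B.ev i) (fun s => ⟪B.basis i, g s⟫_ℝ) 1 0] := by
        rw [pair, hx, (hmode i 0).2]
      rw [hvel 0 le_rfl, this]
      exact flow_mulVec_modeGreen_zero (hγ i) (hint i)
    · rw [hvel t ht, E.norm_map]
      exact ⟨norm_green_le hη hC hb hgM 0 t, norm_green_le hη hC hb hgM 1 t⟩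
  · intro g h M N hg hh hgM hhM hN t ht
    simp only [← map_sub, E.norm_map]
    rw [green_sub hspec hδ hη hC hb hg hgM hh hhM]
    exact norm_green_le hη hC hb hN 0 t

end DampedWave

namespace DampedWave

/-! ### The fixed point argument -/

open scoped BoundedContinuousFunction NNReal

section

variable {V W : Type*} [NormedAddCommGroup V] [NormedAddCommGroup W]
  {f : V → W} {R ρ L p r κ K : ℝ}

theorem continuousOn_of_local_lipschitz (hp : 0 < p)
    (hf : ∀ u ∈ Metric.ball (0 : V) R, ∀ v ∈ Metric.ball (0 : V) R,
      ‖f u - f v‖ ≤ L * (‖u‖ ^ p + ‖v‖ ^ p) * ‖u - v‖) : ContinuousOn f (Metric.ball 0 R) := by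
  intro v hv
  refine tendsto_iff_norm_sub_tendsto_zero.2 (squeeze_zero' (Filter.Eventually.of_forall fun _ =>
    norm_nonneg _) (eventually_mem_nhdsWithin.mono fun u hu => hf u hu v hv) ?_)
  have : Continuous fun u : V => L * (‖u‖ ^ p + ‖v‖ ^ p) * ‖u - v‖ := by
    have := continuous_norm (E := V) |>.rpow_const (p := p) fun _ => Or.inr hp.le
    fun_prop
  simpa using (this.tendsto v).mono_left nhdsWithin_le_nhds

/-- The Lipschitz estimate for functions with decay `e^{-rt}` yields the decay `e^{-(1+p)rt}`. -/
theorem norm_sub_le_of_decay (hp : 0 < p) (hL : 0 ≤ L) (hρ : 0 ≤ ρ) (hr : 0 ≤ r) (hρR : ρ < R)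
    (hκ : κ = r * (1 + p))
    (hf : ∀ u ∈ Metric.ball (0 : V) R, ∀ v ∈ Metric.ball (0 : V) R,
      ‖f u - f v‖ ≤ L * (‖u‖ ^ p + ‖v‖ ^ p) * ‖u - v‖)
    {u v : V} {t D : ℝ} (ht : 0 ≤ t) (hu : ‖u‖ ≤ ρ * Real.exp (-r * t))
    (hv : ‖v‖ ≤ ρ * Real.exp (-r * t)) (huv : ‖u - v‖ ≤ D * Real.exp (-r * t)) :
    ‖f u - f v‖ ≤ 2 * L * ρ ^ p * D * Real.exp (-κ * t) := by
  have he : ρ * Real.exp (-r * t) ≤ ρ :=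
    mul_le_of_le_one_right hρ (Real.exp_le_one_iff.2 (by nlinarith))
  have hb : ∀ w : V, ‖w‖ ≤ ρ * Real.exp (-r * t) → w ∈ Metric.ball (0 : V) R := fun w hw =>
    mem_ball_zero_iff.2 ((hw.trans he).trans_lt hρR)
  have hpow : ∀ w : V, ‖w‖ ≤ ρ * Real.exp (-r * t) → ‖w‖ ^ p ≤ ρ ^ p * Real.exp (-r * p * t) := by
    intro w hw
    refine (Real.rpow_le_rpow (norm_nonneg w) hw hp.le).trans (le_of_eq ?_)
    rw [Real.mul_rpow hρ (Real.exp_pos _).le, ← Real.exp_mul]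
    ring_nf
  refine (hf u (hb u hu) v (hb v hv)).trans ?_
  calc L * (‖u‖ ^ p + ‖v‖ ^ p) * ‖u - v‖
      ≤ L * (ρ ^ p * Real.exp (-r * p * t) + ρ ^ p * Real.exp (-r * p * t)) *
          (D * Real.exp (-r * t)) := by
        gcongr
        · exact hpow u hu
        · exact hpow v hv
    _ = 2 * L * ρ ^ p * D * (Real.exp (-r * p * t) * Real.exp (-r * t)) := by ring
    _ = _ := by rw [← Real.exp_add, hκ]; ring_nf

/-- The contraction principle in the space of functions with decay `e^{-rt}`. -/
theorem exists_decaying_fixedPoint [NormedSpace ℝ V] [CompleteSpace V] (hp : 0 < p)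
    (hL : 0 ≤ L) (hρ : 0 < ρ)
    (hr : 0 < r) (hρR : ρ < R) (hκ : κ = r * (1 + p))
    (hf : ∀ u ∈ Metric.ball (0 : V) R, ∀ v ∈ Metric.ball (0 : V) R,
      ‖f u - f v‖ ≤ L * (‖u‖ ^ p + ‖v‖ ^ p) * ‖u - v‖) (hf0 : f 0 = 0)
    (hsmall : K * (2 * L * ρ ^ p) ≤ 1 / 2) {G : (ℝ → W) → ℝ → V}
    (hG : ∀ (g : ℝ → W) (M : ℝ), Continuous g → (∀ s, 0 ≤ s → ‖g s‖ ≤ M * Real.exp (-κ * s)) →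
      Continuous (G g) ∧ ∀ t, 0 ≤ t → ‖G g t‖ ≤ K * M * Real.exp (-κ * t))
    (hGL : ∀ (g h : ℝ → W) (M N : ℝ), Continuous g → Continuous h →
      (∀ s, 0 ≤ s → ‖g s‖ ≤ M * Real.exp (-κ * s)) →
      (∀ s, 0 ≤ s → ‖h s‖ ≤ M * Real.exp (-κ * s)) →
      (∀ s, 0 ≤ s → ‖g s - h s‖ ≤ N * Real.exp (-κ * s)) →
      ∀ t, 0 ≤ t → ‖G g t - G h t‖ ≤ K * N * Real.exp (-κ * t))
    {b : ℝ → V} (hbc : ContinuousOn b (Set.Ici 0))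
    (hb : ∀ t, 0 ≤ t → ‖b t‖ ≤ ρ / 2 * Real.exp (-r * t)) :
    ∃ u : ℝ → V, Continuous (fun t => f (u t)) ∧ (∀ t, 0 ≤ t → ‖u t‖ ≤ ρ * Real.exp (-r * t)) ∧
      (∀ t, 0 ≤ t → ‖f (u t)‖ ≤ 2 * L * ρ ^ p * ρ * Real.exp (-κ * t)) ∧
      ∀ t, 0 ≤ t → u t = b t + G (fun t => f (u t)) t := by
  -- The unknown is `h = e^{rt} u`, extended to negative times by its value at `0`.
  let S := Metric.closedBall (0 : ℝ →ᵇ V) ρ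
  let U : (ℝ →ᵇ V) → ℝ → V := fun h t => Real.exp (-r * max t 0) • h t
  have hUc : ∀ h, Continuous (U h) := fun h => by
    have := h.continuous
    fun_prop
  have hUn : ∀ (h : ℝ →ᵇ V) D, ‖h‖ ≤ D → ∀ t, ‖U h t‖ ≤ D * Real.exp (-r * max t 0) := by
    intro h D hD t
    rw [norm_smul, Real.norm_of_nonneg (Real.exp_pos _).le, mul_comm]
    gcongr
    exact (h.norm_coe_le_norm t).trans hD
  have hUS : ∀ h ∈ S, ∀ t, ‖U h t‖ ≤ ρ * Real.exp (-r * max t 0) := fun h hh =>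
    hUn h ρ (mem_closedBall_zero_iff.1 hh)
  have hgc : ∀ h ∈ S, Continuous fun t => f (U h t) := by
    intro h hh
    refine (continuousOn_of_local_lipschitz hp hf).comp_continuous (hUc h) fun t => ?_
    refine mem_ball_zero_iff.2 (((hUS h hh t).trans ?_).trans_lt hρR)
    exact mul_le_of_le_one_right hρ.le (Real.exp_le_one_iff.2
      (by nlinarith [le_max_right t 0]))
  have hgd : ∀ h ∈ S, ∀ t, 0 ≤ t → ‖f (U h t)‖ ≤ 2 * L * ρ ^ p * ρ * Real.exp (-κ * t) := by
    intro h hh t ht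
    have := hUS h hh t
    rw [max_eq_left ht] at this
    have h0 := norm_sub_le_of_decay hp hL hρ.le hr.le hρR hκ hf (v := 0) (D := ρ) ht this
      (by rw [norm_zero]; positivity) (by rwa [sub_zero])
    rwa [hf0, sub_zero] at h0
  have hexp : ∀ t, 0 ≤ t → Real.exp (r * t) * Real.exp (-κ * t) ≤ 1 := by
    intro t ht
    rw [← Real.exp_add, hκ]
    have : 0 ≤ r * p * t := by positivity
    exact Real.exp_le_one_iff.2 (by nlinarith)
  let Q : (ℝ →ᵇ V) → ℝ → V := fun h t =>
    Real.exp (r * max t 0) • (b (max t 0) + G (fun t => f (U h t)) (max t 0))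
  have hQc : ∀ h ∈ S, Continuous (Q h) := by
    intro h hh
    have h1 : Continuous fun t : ℝ => b (max t 0) :=
      hbc.comp_continuous (by fun_prop) fun t => le_max_right t 0
    have h2 : Continuous fun t : ℝ => G (fun t => f (U h t)) (max t 0) :=
      (hG _ _ (hgc h hh) (hgd h hh)).1.comp (by fun_prop)
    exact (show Continuous fun t : ℝ => Real.exp (r * max t 0) by fun_prop).smul (h1.add h2)
  have hQn : ∀ h ∈ S, ∀ t, ‖Q h t‖ ≤ ρ := by
    intro h hh t
    have ht := le_max_right t (0 : ℝ)
    have h1 := hb _ ht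
    have h2 := (hG _ _ (hgc h hh) (hgd h hh)).2 _ ht
    have h3 : Real.exp (r * max t 0) * Real.exp (-r * max t 0) = 1 := by
      rw [← Real.exp_add]; simp
    rw [norm_smul, Real.norm_of_nonneg (Real.exp_pos _).le]
    calc _ ≤ Real.exp (r * max t 0) * (ρ / 2 * Real.exp (-r * max t 0) +
          K * (2 * L * ρ ^ p * ρ) * Real.exp (-κ * max t 0)) := by
          gcongr
          exact (norm_add_le _ _).trans (add_le_add h1 h2)
      _ = ρ / 2 * (Real.exp (r * max t 0) * Real.exp (-r * max t 0)) + K * (2 * L * ρ ^ p) * ρ *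
          (Real.exp (r * max t 0) * Real.exp (-κ * max t 0)) := by ring
      _ ≤ ρ / 2 * 1 + 1 / 2 * ρ * 1 := by
          rw [h3]
          gcongr
          exact hexp _ ht
      _ = ρ := by ring
  let Ψ : S → S := fun h => ⟨BoundedContinuousFunction.ofNormedAddCommGroup (Q h.1) (hQc h.1 h.2) ρ
    (hQn h.1 h.2), mem_closedBall_zero_iff.2
      (BoundedContinuousFunction.norm_ofNormedAddCommGroup_le (hQc h.1 h.2) hρ.le (hQn h.1 h.2))⟩
  have hΨ : ContractingWith (1 / 2 : ℝ≥0) Ψ := by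
    refine ⟨by rw [← NNReal.coe_lt_coe]; norm_num, LipschitzWith.of_dist_le_mul fun h k => ?_⟩
    refine (BoundedContinuousFunction.dist_le (by positivity)).2 fun t => ?_
    have ht := le_max_right t (0 : ℝ)
    have hN : ∀ s, 0 ≤ s → ‖f (U h.1 s) - f (U k.1 s)‖ ≤
        2 * L * ρ ^ p * ‖h.1 - k.1‖ * Real.exp (-κ * s) := by
      intro s hs
      have h1 := hUS h.1 h.2 s
      have h2 := hUS k.1 k.2 s
      have h3 := hUn (h.1 - k.1) _ le_rfl s
      have h4 : U (h.1 - k.1) s = U h.1 s - U k.1 s := smul_sub _ _ _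
      rw [max_eq_left hs] at h1 h2 h3
      rw [h4] at h3
      exact norm_sub_le_of_decay hp hL hρ.le hr.le hρR hκ hf hs h1 h2 h3
    have h5 := hGL _ _ _ _ (hgc h.1 h.2) (hgc k.1 k.2) (hgd h.1 h.2) (hgd k.1 k.2) hN _ ht
    change dist (Q h.1 t) (Q k.1 t) ≤ ((1 / 2 : ℝ≥0) : ℝ) * dist h.1 k.1
    rw [dist_eq_norm, dist_eq_norm, ← smul_sub, add_sub_add_left_eq_sub, norm_smul,
      Real.norm_of_nonneg (Real.exp_pos _).le]
    calc _ ≤ Real.exp (r * max t 0) *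
          (K * (2 * L * ρ ^ p * ‖h.1 - k.1‖) * Real.exp (-κ * max t 0)) := by gcongr
      _ = K * (2 * L * ρ ^ p) * ‖h.1 - k.1‖ *
          (Real.exp (r * max t 0) * Real.exp (-κ * max t 0)) := by ring
      _ ≤ 1 / 2 * ‖h.1 - k.1‖ * 1 := by
          gcongr
          exact hexp _ ht
      _ = _ := by norm_num
  have : Nonempty S := ⟨⟨0, Metric.mem_closedBall_self hρ.le⟩⟩
  have : CompleteSpace S := Metric.isClosed_closedBall.completeSpace_coe
  obtain ⟨h, hh⟩ : ∃ h : S, Ψ h = h := ⟨_, hΨ.fixedPoint_isFixedPt⟩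
  refine ⟨U h.1, hgc h.1 h.2, fun t ht => ?_, hgd h.1 h.2, fun t ht => ?_⟩
  · have := hUS h.1 h.2 t
    rwa [max_eq_left ht] at this
  · have h1 : Q h.1 t = h.1 t := DFunLike.congr_fun (congrArg Subtype.val hh) t
    change Real.exp (-r * max t 0) • h.1 t = _
    rw [← h1]
    simp only [Q, max_eq_left ht]
    rw [smul_smul, ← Real.exp_add]
    simp

end

end DampedWave

namespace DampedWave

/-! ### The choice of the decay rate, and the theorem -/

variable {H : Type*} [NormedAddCommGroup H] [InnerProductSpace ℝ H]
  {A : H →ₗ.[ℝ] H} {ι : Type*}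

/-- Since only finitely many rates differ from `δ`, there is a gap beyond `r₀`. -/
theorem EigenBasis.exists_rate_gap (B : EigenBasis A ι) (hspec : HasDiscreteSpectrum A)
    (δ : ℝ) {r₀ c : ℝ} (hc : r₀ < c) :
    ∃ κ η, 0 < η ∧ r₀ < κ - η ∧ κ < c ∧
      ∀ i, ∀ r ∈ modeRates δ (B.ev i), r₀ < r → κ + η < r := by
  have hfin : {r | ∃ i, r ∈ modeRates δ (B.ev i)}.Finite := by
    refine (((B.finite_low hspec (δ ^ 2)).biUnion (t := fun μ => modeRates δ μ)
      fun μ _ => ?_).union (Set.finite_singleton δ)).subset ?_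
    · unfold modeRates
      split_ifs <;> exact Set.toFinite _
    · rintro r ⟨i, hr⟩
      by_cases h : B.ev i < δ ^ 2
      · exact Or.inl (Set.mem_biUnion ⟨⟨i, rfl⟩, h⟩ hr)
      · rw [modeRates, if_neg h] at hr
        exact Or.inr hr
  have h1 : ∀ᶠ κ in 𝓝[>] r₀, ∀ r ∈ {r | ∃ i, r ∈ modeRates δ (B.ev i)}, r₀ < r → κ < r := by
    refine (Filter.eventually_all_finite hfin).2 fun r _ => ?_
    by_cases h : r₀ < r
    · exact ((gt_mem_nhds h : ∀ᶠ κ in 𝓝 r₀, κ < r).filter_mono nhdsWithin_le_nhds).mono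
        fun κ hκ _ => hκ
    · exact Filter.Eventually.of_forall fun κ hr => absurd hr h
  obtain ⟨κ₁, h2, h3, h4⟩ := (h1.and ((eventually_mem_nhdsWithin).and
    ((gt_mem_nhds hc : ∀ᶠ κ in 𝓝 r₀, κ < c).filter_mono nhdsWithin_le_nhds))).exists
  have h3' : r₀ < κ₁ := h3
  refine ⟨r₀ + (κ₁ - r₀) / 2, (κ₁ - r₀) / 4, by linarith, by linarith, by linarith,
    fun i r hr hr0 => ?_⟩
  linarith [h2 r ⟨i, hr⟩ hr0]

variable [CompleteSpace H]

theorem EigenBasis.mem_ratesSubmodule (B : EigenBasis A ι) (hA : IsSelfAdjoint A)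
    (hspec : HasDiscreteSpectrum A) {δ : ℝ} {S : Set ℝ} {U : EnergySpace A × H}
    (hU : HasRatesIn A δ S U) : U ∈ B.ratesSubmodule δ S := by
  obtain ⟨u, -, hu0, hu⟩ := hU
  have := hu 0 le_rfl
  rwa [hu0.1, hu0.2, B.modeSum_eq hA δ (B.finite_low hspec _)] at this

end DampedWave

end

theorem theorem3p6 {H : Type*} [NormedAddCommGroup H] [InnerProductSpace ℝ H] [CompleteSpace H]
    [TopologicalSpace.SeparableSpace H]
    (A : H →ₗ.[ℝ] H) (hA : IsSelfAdjoint A) (hA_nonneg : ∀ x : A.domain, 0 ≤ ⟪A x, (x : H)⟫_ℝ)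
    (hA_spec : DampedWave.HasDiscreteSpectrum A)
    (δ : ℝ) (hδ : 0 < δ)
    (R₀ : ℝ) (hR₀ : 0 < R₀) (f : DampedWave.EnergySpace A → H)
    (p L : ℝ) (hp : 0 < p) (hL : 0 ≤ L)
    (hf_lip : ∀ u ∈ Metric.ball (0 : DampedWave.EnergySpace A) R₀,
      ∀ v ∈ Metric.ball (0 : DampedWave.EnergySpace A) R₀,
        ‖f u - f v‖ ≤ L * (‖u‖ ^ p + ‖v‖ ^ p) * ‖u - v‖)
    (hf_zero : f 0 = 0)
    (r₀ : ℝ) (hr₀ : r₀ ∈ DampedWave.decayRates A δ) (hr₀_pos : 0 < r₀) :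
    ∃ ε₀ : ℝ, 0 < ε₀ ∧
      ∀ (v₀ : DampedWave.EnergySpace A) (v₁ : H) (z₀ : DampedWave.EnergySpace A) (z₁ : H),
        DampedWave.IsPurePair A δ r₀ (v₀, v₁) → DampedWave.IsFastPair A δ r₀ (z₀, z₁) →
        ‖v₁‖ + ‖v₀‖ + ‖z₁‖ + ‖z₀‖ ≤ ε₀ →
        ∃ (w₀ : DampedWave.EnergySpace A) (w₁ : H),
          DampedWave.IsSlowPair A δ r₀ (w₀, w₁) ∧
          ∃ u : ℝ → DampedWave.EnergySpace A,
            DampedWave.IsSemilinearSolution A δ R₀ f u ∧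
            DampedWave.HasInitialData u (v₀ + z₀ + w₀, v₁ + z₁ + w₁) ∧
            ∀ v : ℝ → DampedWave.EnergySpace A,
              DampedWave.IsLinearSolution A δ 0 v → DampedWave.HasInitialData v (v₀, v₁) →
              Filter.Tendsto
                (fun t : ℝ => (‖DampedWave.velocity u t - DampedWave.velocity v t‖ +
                  ‖u t - v t‖) * Real.exp (r₀ * t))
                Filter.atTop (𝓝 0) := by
  open DampedWave in
  obtain ⟨ι, ⟨B⟩⟩ := exists_eigenBasis hA hA_nonneg hA_spec
  -- All fast rates exceed `κ > r₀`. Since `r = κ / (1 + p)` is still below `r₀`, all pure solutions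
  -- decay as `e^{-rt}`, and functions `u` with this decay give a force `f(u)` of size `e^{-κt}`.
  obtain ⟨κ, η, hη, hκη, hκp, hgap⟩ := B.exists_rate_gap hA_spec δ
    (show r₀ < r₀ * (1 + p) by nlinarith)
  have hκ : 0 < κ := by linarith
  obtain ⟨K, G, hK, hG, hGL⟩ := B.exists_forcedSolution hA hA_spec hδ hκ hη hgap
    (fun i r _ hr => hr.trans_lt hκη)
  obtain ⟨r, hr⟩ : ∃ r, r = κ / (1 + p) := ⟨_, rfl⟩
  have hrpos : 0 < r := by rw [hr]; positivity
  have hκr : κ = r * (1 + p) := by rw [hr]; field_simp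
  have hrr₀ : r < r₀ := by rw [hr, div_lt_iff₀ (by linarith)]; exact hκp
  have hrκ : r ≤ κ := by nlinarith
  obtain ⟨Cv, hCv, hv⟩ := exists_abs_wflow_le (κ := r) (σ := 1) hδ (B.finite_low hA_spec _)
    (S := {r₀}) (by norm_num) (fun i s hs _ => by rw [Set.mem_singleton_iff.1 hs]; linarith)
  obtain ⟨Cz, hCz, hz⟩ := exists_abs_wflow_le (κ := κ) (σ := 1) hδ (B.finite_low hA_spec _)
    (S := Set.Ioi r₀) (by norm_num) (fun i s hs hs' => by linarith [hgap i s hs' hs])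
  simp only [one_mul] at hv hz
  obtain ⟨ρ, hρ, hρR, hsmall⟩ : ∃ ρ, 0 < ρ ∧ ρ < R₀ ∧ K * (2 * L * ρ ^ p) ≤ 1 / 2 := by
    have hcont : ContinuousAt (fun ρ : ℝ => K * (2 * L * ρ ^ p)) 0 := by
      have := Real.continuousAt_rpow_const 0 p (Or.inr hp.le)
      fun_prop
    have h1 : ∀ᶠ ρ in 𝓝[>] (0 : ℝ), K * (2 * L * ρ ^ p) < 1 / 2 :=
      (hcont.eventually (gt_mem_nhds (by simp [Real.zero_rpow hp.ne']))).filter_mono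
        nhdsWithin_le_nhds
    obtain ⟨ρ, h2, h3, h4⟩ := (h1.and (eventually_mem_nhdsWithin.and
      ((gt_mem_nhds hR₀).filter_mono nhdsWithin_le_nhds))).exists
    exact ⟨ρ, h3, h4, h2.le⟩
  have : CompleteSpace (EnergySpace A) := by
    obtain ⟨E, -⟩ := B.exists_energyEquiv hA
    exact E.toIsometryEquiv.completeSpace_iff.1 inferInstance
  refine ⟨ρ / (4 * (Cv + Cz + 1)), by positivity, fun v₀ v₁ z₀ z₁ hpure hfast hε => ?_⟩
  have hV := B.mem_ratesSubmodule hA hA_spec hpure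
  have hZ := B.mem_ratesSubmodule hA hA_spec hfast
  obtain ⟨v, hvsol, hv0, -⟩ := hpure
  obtain ⟨z, hzsol, hz0, -⟩ := hfast
  have hvb := fun t (ht : 0 ≤ t) => B.norm_le_of_rates hA hCv hv hvsol hv0 hV ht
  have hzb := fun t (ht : 0 ≤ t) => B.norm_le_of_rates hA hCz hz hzsol hz0 hZ ht
  simp only at hvb hzb
  obtain ⟨u, hfu, hun, hfun, hu⟩ := exists_decaying_fixedPoint (b := fun t => v t + z t) hp hL hρ
    hrpos hρR hκr hf_lip hf_zero hsmall
    (fun g M hg hgM => ⟨(hG g M hg hgM).1, fun t ht => ((hG g M hg hgM).2.2.2 t ht).1⟩) hGL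
    (hvsol.continuousOn.add hzsol.continuousOn) (fun t ht => by
      have he : Real.exp (-κ * t) ≤ Real.exp (-r * t) := by gcongr
      rw [le_div_iff₀ (by positivity)] at hε
      have h1 : 2 * Cz * Real.exp (-κ * t) * (‖z₀‖ + ‖z₁‖) ≤
          2 * Cz * Real.exp (-r * t) * (‖z₀‖ + ‖z₁‖) := by gcongr
      have h2 : 2 * Cv * (‖v₀‖ + ‖v₁‖) + 2 * Cz * (‖z₀‖ + ‖z₁‖) ≤ ρ / 2 := by
        have a1 : 0 ≤ Cv * (‖z₀‖ + ‖z₁‖) := by positivity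
        have a2 : 0 ≤ Cz * (‖v₀‖ + ‖v₁‖) := by positivity
        have a3 : 0 ≤ ‖v₁‖ + ‖v₀‖ + ‖z₁‖ + ‖z₀‖ := by positivity
        nlinarith
      calc ‖v t + z t‖ ≤ _ := (norm_add_le _ _).trans (add_le_add (hvb t ht).1
            ((hzb t ht).1.trans h1))
        _ = (2 * Cv * (‖v₀‖ + ‖v₁‖) + 2 * Cz * (‖z₀‖ + ‖z₁‖)) * Real.exp (-r * t) := by ring
        _ ≤ _ := by gcongr)
  obtain ⟨-, hw, hwslow, hwb⟩ := hG _ _ hfu hfun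
  obtain ⟨hvz, hvzvel⟩ := hvsol.add hzsol
  obtain ⟨hsol, hvel⟩ := hvz.add hw
  refine ⟨G (fun t => f (u t)) 0, velocity (G fun t => f (u t)) 0,
    B.hasRatesIn hA hA_spec hδ hwslow, fun t => v t + z t + G (fun t => f (u t)) t,
    ⟨fun t => f (u t), hfu.continuousOn, ?_, fun t ht => ?_⟩, ⟨?_, ?_⟩, fun v' hv' hv0' => ?_⟩
  · simpa only [Pi.zero_apply, zero_add] using hsol
  · beta_reduce
    rw [← hu t ht]
    refine ⟨mem_ball_zero_iff.2 (((hun t ht).trans ?_).trans_lt hρR), rfl⟩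
    exact mul_le_of_le_one_right hρ.le (Real.exp_le_one_iff.2 (by nlinarith))
  · beta_reduce
    rw [hv0.1, hz0.1]
  · rw [hvel 0 le_rfl, hvzvel 0 le_rfl, hv0.2, hz0.2]
  · -- By uniqueness `u - v'` is the sum of the fast solution and of the one produced by the force.
    have hlim : Filter.Tendsto (fun t => (2 * (2 * Cz * (‖z₀‖ + ‖z₁‖)) +
        2 * (K * (2 * L * ρ ^ p * ρ))) * Real.exp (-(κ - r₀) * t)) Filter.atTop (𝓝 0) := by
      have h1 : Filter.Tendsto (fun t => -(κ - r₀) * t) Filter.atTop Filter.atBot :=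
        Filter.tendsto_id.const_mul_atTop_of_neg (by linarith)
      simpa using (Real.tendsto_exp_atBot.comp h1).const_mul (2 * (2 * Cz * (‖z₀‖ + ‖z₁‖)) +
        2 * (K * (2 * L * ρ ^ p * ρ)))
    refine squeeze_zero' (Filter.Eventually.of_forall fun t => by positivity) ?_ hlim
    filter_upwards [Filter.eventually_ge_atTop 0] with t ht
    have he := B.linearSolution_unique hA hv' hvsol hv0' hv0 ht
    rw [show v' t = v t from congrArg Prod.fst he, hvel t ht, hvzvel t ht,
      show velocity v' t = velocity v t from congrArg Prod.snd he, add_assoc, add_assoc,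
      add_sub_cancel_left, add_sub_cancel_left]
    have hexp : Real.exp (-(κ - r₀) * t) = Real.exp (-κ * t) * Real.exp (r₀ * t) := by
      rw [← Real.exp_add]; ring_nf
    rw [hexp, ← mul_assoc]
    gcongr
    have h1 := norm_add_le (velocity z t) (velocity (G fun t => f (u t)) t)
    have h2 := norm_add_le (z t) (G (fun t => f (u t)) t)
    have h3 := hzb t ht
    have h4 := hwb t ht
    linarith [h3.1, h3.2, h4.1, h4.2]
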